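/- Let $s\in(0,1)$, $a>0$ and let $n\ge 1$ be an integer with $n>2s$. Put $B(x,\rho)=\{y\in\mathbb R^n:|y-x|<\rho\}$, $B_\rho=B(0,\rho)$ and $$(-\Delta)^s\varphi(x)=c_{n,s}\,\mathrm{P.V.}\!\int_{\mathbb R^n}\frac{\varphi(x)-\varphi(y)}{|x-y|^{n+2s}}\,dy,\qquad c_{n,s}=\frac{2^{2s}}{\pi^{n/2}}\frac{\Gamma(\frac{n+2s}{2})}{|\Gamma(-s)|}.$$ Let $L_s(\mathbb R^n)$ be the set of $u\in L^1_{\rm loc}(\mathbb R^n)$ with $\int_{\mathbb R^n}\frac{|u(x)|}{1+|x|^{n+2s}}\,dx<\infty$, and let $\dot H^s_{\rm loc}(\mathbb R^n)$ be the set of functions $u$ such that, for every bounded open $\Omega\subset\mathbb R^n$, $u\in L^2_{\rm loc}(\Omega)$ and $\int_\Omega\int_\Omega\frac{|u(x)-u(y)|^2}{|x-y|^{n+2s}}\,dx\,dy<\infty$. Let $u\in L_s(\mathbb R^n)\cap\dot H^s_{\rm loc}(\mathbb R^n)$ be real-valued with $|x|^ae^u\in L^1_{\rm loc}(\mathbb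 R^n)$, and suppose that $u$ solves $(-\Delta)^su=|x|^ae^u$ in $\mathbb R^n$ in the sense that $$\int_{\mathbb R^n}u\,(-\Delta)^s\varphi\,dx=\int_{\mathbb R^n}|x|^ae^u\varphi\,dx\qquad\text{for every }\varphi\in C_c^\infty(\mathbb R^n).$$ Suppose that for some $R>0$ the solution $u$ is stable outside $\overline{B_R}$, that is, $$\frac{c_{n,s}}2\int_{\mathbb R^n}\int_{\mathbb R^n}\frac{(\varphi(x)-\varphi(y))^2}{|x-y|^{n+2s}}\,dx\,dy\ \ge\ \int_{\mathbb R^n}|x|^ae^u\varphi^2\,dx\qquad\text{for every }\varphi\in C_c^\infty(\mathbb R^n\setminus\overline{B_R}).$$ Below, $u$ and $R$ are fixed, and the constants $C(p)>0$ and the thresholds for "large" may depend on $n,s,a,u,R$ and $p$, but not on $r$ or $x$. For every $p\in[1,\min\{5,1+\frac n{2s}\})$ there exists $C=C(p)>0$ such that, for all sufficiently large $r$, $$\int_{B_{2r}\setminus B_r}\left(|x|^ae^{u}\right)^p\,dx\le C\,r^{n-2ps}.$$ Moreover: (i) for every $p\in[1,\min\{5,1+\frac n{2s}\})$ there exists $C=C(p)>0$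 such that, for all $x\in\mathbb R^n$ with $|x|$ sufficiently large, $$\int_{B(x,|x|/2)}\left(|y|^ae^{u(y)}\right)^p\,dy\le C\,|x|^{n-2ps};$$ (ii) for every $p\in[1,\min\{5,\frac n{2s}\})$ there exists $C=C(p)>0$ such that, for all sufficiently large $r$, $$\int_{B_r\setminus B_{2R}}\left(|x|^ae^{u}\right)^p\,dx\le C\,r^{n-2ps}.$$ In particular all these integrals are finite. -/

import Mathlib

open MeasureTheory Filter Topology
open scoped ContDiff

namespace HenonGelfand

/-- Euclidean space `ℝⁿ` with the Euclidean norm. -/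
abbrev E (n : ℕ) : Type := EuclideanSpace ℝ (Fin n)

/-- The normalizing constant `c_{n,s} = 2^{2s} π^{-n/2} Γ((n+2s)/2) / |Γ(-s)|`. -/
noncomputable def fracConst (n : ℕ) (s : ℝ) : ℝ :=
  (2 : ℝ) ^ (2 * s) / Real.pi ^ ((n : ℝ) / 2)
    * (Real.Gamma (((n : ℝ) + 2 * s) / 2) / |Real.Gamma (-s)|)

/-- The fractional Laplacian `(-Δ)^s φ (x) = c_{n,s} P.V. ∫ (φ x - φ y) / |x - y|^{n+2s} dy`.
The principal value is the limit, as `ε → 0⁺`, of the integrals over `|x - y| > ε`; it exists for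
every `φ ∈ C_c^∞(ℝⁿ)` when `0 < s < 1`, and the definition is used only for such `φ`. -/
noncomputable def fracLaplacian {n : ℕ} (s : ℝ) (φ : E n → ℝ) (x : E n) : ℝ :=
  fracConst n s * limUnder (𝓝[>] (0 : ℝ)) (fun ε : ℝ =>
    ∫ y in {y : E n | ε < ‖x - y‖}, (φ x - φ y) / ‖x - y‖ ^ ((n : ℝ) + 2 * s))

/-- `φ ∈ C_c^∞(Ω)`: smooth on `ℝⁿ`, with compact support contained in `Ω`. -/
def IsTestFunction {n : ℕ} (Ω : Set (E n)) (φ : E n → ℝ) : Prop :=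
  ContDiff ℝ ∞ φ ∧ HasCompactSupport φ ∧ tsupport φ ⊆ Ω

/-- The space `L_μ(ℝⁿ)`: locally integrable `u` with `∫ |u(x)| / (1 + |x|^{n+2μ}) dx < ∞`. -/
def MemWeightedL {n : ℕ} (μ : ℝ) (u : E n → ℝ) : Prop :=
  LocallyIntegrable u volume ∧
    Integrable (fun x : E n => |u x| / (1 + ‖x‖ ^ ((n : ℝ) + 2 * μ))) volume

/-- The space `Ḣ^s(Ω)`: functions in `L²_loc(Ω)` whose Gagliardo seminorm on `Ω × Ω` is finite. -/
def MemDotH {n : ℕ} (s : ℝ) (Ω : Set (E n)) (u : E n → ℝ) : Prop :=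
  (∀ K : Set (E n), IsCompact K → K ⊆ Ω → MemLp u 2 (volume.restrict K)) ∧
    (∫⁻ x in Ω, ∫⁻ y in Ω,
      ENNReal.ofReal (|u x - u y| ^ 2 / ‖x - y‖ ^ ((n : ℝ) + 2 * s))) < ⊤

/-- The space `Ḣ^s_loc(ℝⁿ)`: functions in `Ḣ^s(Ω)` for every bounded open `Ω`. -/
def MemDotHLoc {n : ℕ} (s : ℝ) (u : E n → ℝ) : Prop :=
  ∀ Ω : Set (E n), IsOpen Ω → Bornology.IsBounded Ω → MemDotH s Ω u

/-- The nonlinearity `|x|^a e^{u(x)}`. -/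
noncomputable def henonExp {n : ℕ} (a : ℝ) (u : E n → ℝ) (x : E n) : ℝ :=
  ‖x‖ ^ a * Real.exp (u x)

/-- `u` is a (weak) solution of `(-Δ)^s u = |x|^a e^u` in `ℝⁿ`: `u ∈ L_s(ℝⁿ)`,
`|x|^a e^u ∈ L¹_loc(ℝⁿ)` and `∫ u (-Δ)^s φ = ∫ |x|^a e^u φ` for all `φ ∈ C_c^∞(ℝⁿ)`. -/
structure IsSolution {n : ℕ} (s a : ℝ) (u : E n → ℝ) : Prop where
  memWeightedL : MemWeightedL s u
  locallyIntegrable : LocallyIntegrable (henonExp a u) volume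
  weak_eq : ∀ φ : E n → ℝ, IsTestFunction Set.univ φ →
    ∫ x, u x * fracLaplacian s φ x = ∫ x, henonExp a u x * φ x

/-- `u` is stable in the open set `Ω`:
`(c_{n,s}/2) ∫∫ (φ x - φ y)² / |x - y|^{n+2s} dx dy ≥ ∫ |x|^a e^u φ²` for all `φ ∈ C_c^∞(Ω)`. -/
def IsStableIn {n : ℕ} (s a : ℝ) (u : E n → ℝ) (Ω : Set (E n)) : Prop :=
  ∀ φ : E n → ℝ, IsTestFunction Ω φ →
    ∫ x, henonExp a u x * φ x ^ 2 ≤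
      fracConst n s / 2 * ∫ x, ∫ y, (φ x - φ y) ^ 2 / ‖x - y‖ ^ ((n : ℝ) + 2 * s)

end HenonGelfand

/-!
A direct nonlocal version of Farina's argument for stable solutions, without the `s`-harmonic
extension.

Pairs of points are written `(x + z, x)`, so that the energy form of `(-Δ)^s` becomes an integral of
products of increments against `μ ⊗ dx`, with the jump measure `μ = |z|^{-n-2s} dz`. By
mollification the weak equation (as an inequality, `IsSolution.form_le`) and the stability
inequality (`IsStableIn.integral_le`) hold for bounded compactly supported functions of finite
energy.

Adding a constant to `u` changes no increment: for `v = u + m` with a constant `m`, test the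
equation with `e^{2αv} η²` and stability with `e^{αv} η`, both truncated at height `k`, where `η` is
a cutoff vanishing near the ball of radius `R` and `0 < α < 2`. A pointwise inequality
(`caccioppoli_pointwise`) bounds the form of the equation below by `4 / (2 + α)` times the energy of
`e^{αv} η`, up to a first-order error carrying `(η(x) - η(y))²` and the increment of a convex
primitive against the increment of `η²`. Summation by parts moves both differences of the latter to
`η²`. Since `4 / (2 + α) > 1`, the energy is absorbed by stability, and `∫ |x|^a e^u e^{2αv} η²` is
bounded by `∫ e^{2αv}` near the support of `η` (`energy_estimate`). Jumps are split at a length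
comparable with the scale. The short ones stay near the support of `η`. For the long ones the
positive part of `v` at the far end is controlled by its tail, and the negative part at the near end
is absorbed by the factor `e^{2αv}`.

At scale `r` one takes `m = (2s + a) log r`, so that `e^v` is comparable with `r^{2s} |x|^a e^u` on
annuli of size `r`. Stability tested with plain cutoffs gives `∫ |x|^a e^u ≤ C r^{n-2s}` there
(`IsStableIn.lintegral_annulus_le`), which is `∫ e^v ≤ C r^n`; the same mass bound, summed over
dyadic annuli, controls the tail of `v⁺` at every scale (`lintegral_tail_le`). The energy estimate
turns a bound `∫ e^{qv} ≤ C r^n` into the same bound for `e^{(1 + 2α) v}` whenever `2α ≤ q`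
(`ScaledExpBound.improve`). Starting from `q = 1` this reaches every exponent `p < 5` in at most
four steps (`scaledExpBound_of_lt_five`), and undoing the scaling gives `∫ (|x|^a e^u)^p ≤ C
r^{n-2ps}` on annuli, in particular on the balls `B(x, |x|/2)`. Summing over dyadic annuli when `n -
2ps > 0` gives the bound on large balls.
-/

/-! ### The jump measure of the fractional Laplacian -/

namespace HenonGelfand

variable {n : ℕ} {s : ℝ}

lemma nontrivial_E (hn : 0 < n) : Nontrivial (E n) := by
  have : Nonempty (Fin n) := ⟨⟨0, hn⟩⟩
  infer_instance

lemma lintegral_ball_norm_rpow (hn : 0 < n) {β : ℝ} (hβ : β < n) :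
    ∃ C : ℝ, 0 ≤ C ∧ ∀ ρ : ℝ, 0 < ρ →
      ∫⁻ z in Metric.ball (0 : E n) ρ, ENNReal.ofReal (‖z‖ ^ (-β)) ≤
        ENNReal.ofReal (C * ρ ^ ((n : ℝ) - β)) := by
  have := nontrivial_E hn
  refine ⟨n * (volume.real (Metric.ball (0 : E n) 1) * (1 / (n - β))),
    by have : 0 ≤ (n : ℝ) - β := by linarith
       positivity, fun ρ hρ => ?_⟩
  have hfin : Module.finrank ℝ (E n) = n := by simp
  set f : ℝ → ℝ := Set.indicator (Set.Iio ρ) (fun y => y ^ (-β)) with hf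
  have hpt : ∀ y ∈ Set.Ioi (0 : ℝ), y ^ (n - 1) • f y =
      Set.indicator (Set.Iio ρ) (fun y => y ^ ((n : ℝ) - 1 - β)) y := by
    intro y hy
    by_cases h : y ∈ Set.Iio ρ
    · simp only [hf, Set.indicator_of_mem h, smul_eq_mul]
      rw [← Real.rpow_natCast, ← Real.rpow_add hy]
      congr 1
      rw [Nat.cast_sub hn]
      push_cast
      ring
    · simp [hf, Set.indicator_of_notMem h]
  have hint0 : IntegrableOn (fun y : ℝ => y ^ ((n : ℝ) - 1 - β)) (Set.Ioo 0 ρ) := by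
    rw [intervalIntegral.integrableOn_Ioo_rpow_iff hρ]
    linarith
  have hint : Integrable (fun z : E n => f ‖z‖) volume := by
    rw [integrable_fun_norm_addHaar, hfin]
    rw [integrableOn_congr_fun hpt measurableSet_Ioi]
    rw [IntegrableOn, integrable_indicator_iff measurableSet_Iio, IntegrableOn,
      Measure.restrict_restrict measurableSet_Iio, Set.inter_comm, Set.Ioi_inter_Iio]
    exact hint0
  have hval : ∫ z : E n, f ‖z‖ = n * (volume.real (Metric.ball (0 : E n) 1) * (1 / (n - β)))
      * ρ ^ ((n : ℝ) - β) := by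
    rw [integral_fun_norm_addHaar, hfin, setIntegral_congr_fun measurableSet_Ioi hpt,
      integral_indicator measurableSet_Iio, Measure.restrict_restrict measurableSet_Iio,
      Set.inter_comm, Set.Ioi_inter_Iio, ← integral_Ioc_eq_integral_Ioo,
      ← intervalIntegral.integral_of_le hρ.le, integral_rpow (Or.inl (by linarith)),
      Real.zero_rpow (by linarith)]
    simp only [nsmul_eq_mul, smul_eq_mul]
    rw [show (n : ℝ) - 1 - β + 1 = n - β by ring]
    ring
  have hnn : ∀ z : E n, 0 ≤ f ‖z‖ := fun z =>
    Set.indicator_apply_nonneg fun _ => Real.rpow_nonneg (norm_nonneg z) _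
  rw [← hval, ofReal_integral_eq_lintegral_ofReal hint (Eventually.of_forall hnn),
    ← lintegral_indicator measurableSet_ball]
  refine lintegral_mono fun z => ?_
  by_cases h : z ∈ Metric.ball (0 : E n) ρ
  · have h' : ‖z‖ ∈ Set.Iio ρ := by simpa using h
    rw [Set.indicator_of_mem h, hf, Set.indicator_of_mem h']
  · rw [Set.indicator_of_notMem h]; exact zero_le

lemma lintegral_compl_ball_norm_rpow (hn : 0 < n) {β : ℝ} (hβ : (n : ℝ) < β) :
    ∃ C : ℝ, 0 ≤ C ∧ ∀ ρ : ℝ, 0 < ρ →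
      ∫⁻ z in (Metric.ball (0 : E n) ρ)ᶜ, ENNReal.ofReal (‖z‖ ^ (-β)) ≤
        ENNReal.ofReal (C * ρ ^ ((n : ℝ) - β)) := by
  have := nontrivial_E hn
  refine ⟨n * (volume.real (Metric.ball (0 : E n) 1) * (1 / (β - n))),
    by have : 0 ≤ β - n := by linarith
       positivity, fun ρ hρ => ?_⟩
  have hfin : Module.finrank ℝ (E n) = n := by simp
  set f : ℝ → ℝ := Set.indicator (Set.Ici ρ) (fun y => y ^ (-β)) with hf
  have hpt : ∀ y ∈ Set.Ioi (0 : ℝ), y ^ (n - 1) • f y =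
      Set.indicator (Set.Ici ρ) (fun y => y ^ ((n : ℝ) - 1 - β)) y := by
    intro y hy
    by_cases h : y ∈ Set.Ici ρ
    · simp only [hf, Set.indicator_of_mem h, smul_eq_mul]
      rw [← Real.rpow_natCast, ← Real.rpow_add hy]
      congr 1
      rw [Nat.cast_sub hn]
      push_cast
      ring
    · simp [hf, Set.indicator_of_notMem h]
  have hsub : Set.Ici ρ ∩ Set.Ioi (0 : ℝ) = Set.Ici ρ :=
    Set.inter_eq_left.2 fun y hy => lt_of_lt_of_le hρ hy
  have hint0 : IntegrableOn (fun y : ℝ => y ^ ((n : ℝ) - 1 - β)) (Set.Ici ρ) := by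
    rw [integrableOn_Ici_iff_integrableOn_Ioi]
    exact integrableOn_Ioi_rpow_of_lt (by linarith) hρ
  have hint : Integrable (fun z : E n => f ‖z‖) volume := by
    rw [integrable_fun_norm_addHaar, hfin]
    rw [integrableOn_congr_fun hpt measurableSet_Ioi]
    rw [IntegrableOn, integrable_indicator_iff measurableSet_Ici, IntegrableOn,
      Measure.restrict_restrict measurableSet_Ici, hsub]
    exact hint0
  have hval : ∫ z : E n, f ‖z‖ = n * (volume.real (Metric.ball (0 : E n) 1) * (1 / (β - n)))
      * ρ ^ ((n : ℝ) - β) := by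
    rw [integral_fun_norm_addHaar, hfin, setIntegral_congr_fun measurableSet_Ioi hpt,
      integral_indicator measurableSet_Ici, Measure.restrict_restrict measurableSet_Ici,
      hsub, integral_Ici_eq_integral_Ioi, integral_Ioi_rpow_of_lt (by linarith) hρ]
    simp only [nsmul_eq_mul, smul_eq_mul]
    have h1 : β - n ≠ 0 := by linarith
    have h2 : (n : ℝ) - β ≠ 0 := by linarith
    rw [show (n : ℝ) - 1 - β + 1 = n - β by ring]
    field_simp
    ring
  have hnn : ∀ z : E n, 0 ≤ f ‖z‖ := fun z =>
    Set.indicator_apply_nonneg fun _ => Real.rpow_nonneg (norm_nonneg z) _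
  rw [← hval, ofReal_integral_eq_lintegral_ofReal hint (Eventually.of_forall hnn),
    ← lintegral_indicator measurableSet_ball.compl]
  refine lintegral_mono fun z => ?_
  by_cases h : z ∈ (Metric.ball (0 : E n) ρ)ᶜ
  · have h' : ‖z‖ ∈ Set.Ici ρ := by simpa using h
    rw [Set.indicator_of_mem h, hf, Set.indicator_of_mem h']
  · rw [Set.indicator_of_notMem h]; exact zero_le

/-- The jump measure `|z|^{-n-2s} dz` of the fractional Laplacian. -/
noncomputable def levy (n : ℕ) (s : ℝ) : Measure (E n) :=
  volume.withDensity fun z => ENNReal.ofReal (‖z‖ ^ (-((n : ℝ) + 2 * s)))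

lemma measurable_levy_density :
    Measurable fun z : E n => ENNReal.ofReal (‖z‖ ^ (-((n : ℝ) + 2 * s))) := by
  fun_prop

instance : SigmaFinite (levy n s) := SigmaFinite.withDensity_ofReal _

lemma lintegral_levy {g : E n → ENNReal} (hg : Measurable g) :
    ∫⁻ z, g z ∂(levy n s) =
      ∫⁻ z, ENNReal.ofReal (‖z‖ ^ (-((n : ℝ) + 2 * s))) * g z :=
  lintegral_withDensity_eq_lintegral_mul _ measurable_levy_density hg

lemma setLIntegral_levy {g : E n → ENNReal} (hg : Measurable g) {S : Set (E n)}
    (hS : MeasurableSet S) :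
    ∫⁻ z in S, g z ∂(levy n s) =
      ∫⁻ z in S, ENNReal.ofReal (‖z‖ ^ (-((n : ℝ) + 2 * s))) * g z := by
  rw [levy, setLIntegral_withDensity_eq_setLIntegral_mul _ measurable_levy_density hg hS]
  rfl

lemma setIntegral_levy (g : E n → ℝ) {S : Set (E n)} (hS : MeasurableSet S) :
    ∫ z in S, g z ∂(levy n s) = ∫ z in S, ‖z‖ ^ (-((n : ℝ) + 2 * s)) * g z := by
  rw [levy, setIntegral_withDensity_eq_setIntegral_toReal_smul measurable_levy_density
    (Eventually.of_forall fun z => ENNReal.ofReal_lt_top) _ hS]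
  refine integral_congr_ae (Eventually.of_forall fun z => ?_)
  simp only [smul_eq_mul]
  rw [ENNReal.toReal_ofReal (Real.rpow_nonneg (norm_nonneg z) _)]

lemma measurePreserving_neg_levy :
    MeasurePreserving (fun z : E n => -z) (levy n s) (levy n s) := by
  refine ⟨measurable_neg, Measure.ext fun S hS => ?_⟩
  rw [Measure.map_apply measurable_neg hS, levy, withDensity_apply _ (measurable_neg hS),
    withDensity_apply _ hS, ← lintegral_indicator hS, ← lintegral_indicator (measurable_neg hS)]
  conv_rhs => rw [← (Measure.measurePreserving_neg (volume : Measure (E n))).lintegral_comp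
    ((measurable_levy_density).indicator hS)]
  refine lintegral_congr fun z => ?_
  simp only [Set.indicator, norm_neg]
  rfl

lemma lintegral_ball_sq_levy (hs1 : s < 1) (hn : 0 < n) :
    ∃ C : ℝ, 0 ≤ C ∧ ∀ ρ : ℝ, 0 < ρ →
      ∫⁻ z in Metric.ball (0 : E n) ρ, ENNReal.ofReal (‖z‖ ^ 2) ∂(levy n s) ≤
        ENNReal.ofReal (C * ρ ^ (2 - 2 * s)) := by
  obtain ⟨C, hC, h⟩ := lintegral_ball_norm_rpow hn (β := n + 2 * s - 2) (by linarith)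
  refine ⟨C, hC, fun ρ hρ => ?_⟩
  rw [setLIntegral_levy (by fun_prop) measurableSet_ball]
  have := h ρ hρ
  rw [show (n : ℝ) - (n + 2 * s - 2) = 2 - 2 * s by ring] at this
  refine le_trans (lintegral_mono fun z => ?_) this
  rw [← ENNReal.ofReal_mul (by positivity)]
  apply ENNReal.ofReal_le_ofReal
  rcases eq_or_ne z 0 with rfl | hz
  · simp only [norm_zero]
    rw [zero_pow (by norm_num), mul_zero]
    exact Real.rpow_nonneg le_rfl _
  · have hz' : 0 < ‖z‖ := norm_pos_iff.2 hz
    rw [← Real.rpow_natCast ‖z‖ 2, ← Real.rpow_add hz']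
    apply le_of_eq
    congr 1
    push_cast
    ring

lemma levy_compl_ball (hs0 : 0 < s) (hn : 0 < n) :
    ∃ C : ℝ, 0 ≤ C ∧ ∀ ρ : ℝ, 0 < ρ →
      levy n s (Metric.ball (0 : E n) ρ)ᶜ ≤ ENNReal.ofReal (C * ρ ^ (-(2 * s))) := by
  obtain ⟨C, hC, h⟩ := lintegral_compl_ball_norm_rpow hn (β := n + 2 * s) (by linarith)
  refine ⟨C, hC, fun ρ hρ => ?_⟩
  rw [levy, withDensity_apply _ measurableSet_ball.compl]
  have := h ρ hρ
  rwa [show (n : ℝ) - (n + 2 * s) = -(2 * s) by ring] at this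

end HenonGelfand

/-! ### Pairs of points, increments and the class `L_s ∩ Ḣ^s_loc` -/

namespace HenonGelfand

variable {n : ℕ} {s : ℝ}

/-- The reflection `(z, x) ↦ (-z, x + z)`, which exchanges the two points `x` and `x + z` of a
pair encoded by its increment `z` and its base point `x`. -/
def pairSwap (n : ℕ) : E n × E n ≃ᵐ E n × E n where
  toFun p := (-p.1, p.2 + p.1)
  invFun p := (-p.1, p.2 + p.1)
  left_inv p := by simp
  right_inv p := by simp
  measurable_toFun := by
    change Measurable fun p : E n × E n => (-p.1, p.2 + p.1)
    fun_prop
  measurable_invFun := by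
    change Measurable fun p : E n × E n => (-p.1, p.2 + p.1)
    fun_prop

@[simp] lemma pairSwap_apply (p : E n × E n) : pairSwap n p = (-p.1, p.2 + p.1) := rfl

lemma measurePreserving_pairSwap {κ : Measure (E n)} [SFinite κ]
    (hκ : MeasurePreserving (fun z : E n => -z) κ κ) :
    MeasurePreserving (pairSwap n) (κ.prod volume) (κ.prod volume) := by
  refine hκ.skew_product (g := fun z x => x + z) ?_ (Eventually.of_forall fun z => ?_)
  · simp only [Function.uncurry_def]; fun_prop
  · exact (measurePreserving_add_right volume z).map_eq

lemma measurePreserving_shift {κ : Measure (E n)} [SFinite κ] :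
    MeasurePreserving (fun p : E n × E n => (p.1, p.2 + p.1)) (κ.prod volume)
      (κ.prod volume) := by
  refine (MeasurePreserving.id κ).skew_product (g := fun z x => x + z) ?_
    (Eventually.of_forall fun z => ?_)
  · simp only [Function.uncurry_def]; fun_prop
  · exact (measurePreserving_add_right volume z).map_eq

lemma measurePreserving_neg_fst {κ : Measure (E n)} [SFinite κ]
    (hκ : MeasurePreserving (fun z : E n => -z) κ κ) :
    MeasurePreserving ((MeasurableEquiv.neg (E n)).prodCongr (MeasurableEquiv.refl (E n)))
      (κ.prod volume) (κ.prod volume) :=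
  hκ.prod (MeasurePreserving.id volume)

lemma measurePreserving_neg_levy_restrict {S : Set (E n)} (hS : MeasurableSet S)
    (hsymm : ∀ z, -z ∈ S ↔ z ∈ S) :
    MeasurePreserving (fun z : E n => -z) ((levy n s).restrict S) ((levy n s).restrict S) := by
  have := (measurePreserving_neg_levy (n := n) (s := s)).restrict_preimage hS
  rwa [show (fun z : E n => -z) ⁻¹' S = S from Set.ext hsymm] at this

/-- The part of the jump measure on increments of length at least `ρ`. -/
noncomputable def farLevy (n : ℕ) (s ρ : ℝ) : Measure (E n) :=
  (levy n s).restrict (Metric.ball 0 ρ)ᶜ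

/-- The part of the jump measure on increments of length less than `ρ`. -/
noncomputable def nearLevy (n : ℕ) (s ρ : ℝ) : Measure (E n) :=
  (levy n s).restrict (Metric.ball 0 ρ)

instance (ρ : ℝ) : SigmaFinite (farLevy n s ρ) := by unfold farLevy; infer_instance
instance (ρ : ℝ) : SigmaFinite (nearLevy n s ρ) := by unfold nearLevy; infer_instance

lemma measurePreserving_neg_farLevy (ρ : ℝ) :
    MeasurePreserving (fun z : E n => -z) (farLevy n s ρ) (farLevy n s ρ) :=
  measurePreserving_neg_levy_restrict measurableSet_ball.compl (by simp)

lemma measurePreserving_neg_nearLevy (ρ : ℝ) :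
    MeasurePreserving (fun z : E n => -z) (nearLevy n s ρ) (nearLevy n s ρ) :=
  measurePreserving_neg_levy_restrict measurableSet_ball (by simp)

lemma near_add_far (ρ : ℝ) :
    (nearLevy n s ρ).prod (volume : Measure (E n)) + (farLevy n s ρ).prod volume
      = (levy n s).prod volume := by
  rw [← Measure.add_prod, nearLevy, farLevy,
    Measure.restrict_add_restrict_compl measurableSet_ball]

lemma integrable_iff_near_far (ρ : ℝ) {F : E n × E n → ℝ} :
    Integrable F ((levy n s).prod volume) ↔
      Integrable F ((nearLevy n s ρ).prod volume) ∧
      Integrable F ((farLevy n s ρ).prod volume) := by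
  rw [← near_add_far ρ, integrable_add_measure]

lemma integral_near_add_far (ρ : ℝ) {F : E n × E n → ℝ}
    (hF : Integrable F ((levy n s).prod volume)) :
    ∫ p, F p ∂((levy n s).prod volume) =
      ∫ p, F p ∂((nearLevy n s ρ).prod volume) + ∫ p, F p ∂((farLevy n s ρ).prod volume) := by
  have h := (integrable_iff_near_far ρ).1 hF
  rw [← near_add_far ρ, integral_add_measure h.1 h.2]

lemma ae_nearLevy (ρ : ℝ) :
    ∀ᵐ p : E n × E n ∂((nearLevy n s ρ).prod volume), ‖p.1‖ < ρ := by
  have h : ∀ᵐ z : E n ∂(nearLevy n s ρ), ‖z‖ < ρ := by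
    filter_upwards [ae_restrict_mem (μ := levy n s) (measurableSet_ball (x := (0 : E n))
      (ε := ρ))] with z hz
    simpa using hz
  exact Measure.quasiMeasurePreserving_fst.ae h

lemma isFiniteMeasure_farLevy (hs0 : 0 < s) (hn : 0 < n) {ρ : ℝ} (hρ : 0 < ρ) :
    IsFiniteMeasure (farLevy n s ρ) := by
  obtain ⟨C, -, h⟩ := levy_compl_ball (n := n) hs0 hn
  exact ⟨by rw [farLevy, Measure.restrict_apply_univ]
            exact (h ρ hρ).trans_lt ENNReal.ofReal_lt_top⟩

lemma integrable_sq_nearLevy (hs1 : s < 1) (hn : 0 < n) {ρ : ℝ} (hρ : 0 < ρ) :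
    Integrable (fun z : E n => ‖z‖ ^ 2) (nearLevy n s ρ) := by
  obtain ⟨C, -, h⟩ := lintegral_ball_sq_levy (n := n) hs1 hn
  refine ⟨by fun_prop, ?_⟩
  rw [hasFiniteIntegral_iff_ofReal (Eventually.of_forall fun z => by positivity)]
  exact (h ρ hρ).trans_lt ENNReal.ofReal_lt_top

/-- The increment `φ (x + z) - φ x`, as a function of the pair `(z, x)`. -/
def incr (φ : E n → ℝ) (p : E n × E n) : ℝ := φ (p.2 + p.1) - φ p.2

lemma measurable_incr {φ : E n → ℝ} (h : Measurable φ) : Measurable (incr φ) := by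
  unfold incr; fun_prop

lemma weight_pos (x : E n) (q : ℝ) : 0 < 1 + ‖x‖ ^ q := by
  have := Real.rpow_nonneg (norm_nonneg x) q
  linarith

/-- Measurable functions of class `L_s(ℝⁿ) ∩ Ḣ^s_loc(ℝⁿ)`, with the local energies written in the
coordinates `(z, x)`. -/
structure FracLocal (s : ℝ) (w : E n → ℝ) : Prop where
  measurable : Measurable w
  integrable_weight : Integrable (fun x : E n => |w x| / (1 + ‖x‖ ^ ((n : ℝ) + 2 * s))) volume
  energy : ∀ ρ : ℝ, IntegrableOn (fun p => incr w p ^ 2)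
    {p : E n × E n | p.2 ∈ Metric.ball 0 ρ ∧ p.2 + p.1 ∈ Metric.ball 0 ρ}
    ((levy n s).prod volume)

/-- Measurable functions bounded by `B` and vanishing outside the ball of radius `ρ`. -/
structure BddComp (ψ : E n → ℝ) (B ρ : ℝ) : Prop where
  measurable : Measurable ψ
  bound : ∀ x, |ψ x| ≤ B
  supp : ∀ x, ρ ≤ ‖x‖ → ψ x = 0

lemma measurableSet_pair_ball (ρ : ℝ) :
    MeasurableSet {p : E n × E n | p.2 ∈ Metric.ball 0 ρ ∧ p.2 + p.1 ∈ Metric.ball 0 ρ} :=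
  (measurable_snd measurableSet_ball).inter
    ((measurable_snd.add measurable_fst) measurableSet_ball)

/-- The jump measure of the increments of length at least `δ` that lead from `x` into a fixed ball
decays like the weight of the class `L_s`. -/
lemma farLevy_preimage_ball_le (hs0 : 0 < s) (hn : 0 < n) {δ ρ : ℝ} (hδ : 0 < δ) (hρ : 0 < ρ) :
    ∃ C : ℝ, 0 ≤ C ∧ ∀ x : E n, farLevy n s δ {z | x + z ∈ Metric.ball 0 ρ} ≤
      ENNReal.ofReal (C / (1 + ‖x‖ ^ ((n : ℝ) + 2 * s))) := by
  obtain ⟨C₀, hC₀, h⟩ := levy_compl_ball (n := n) hs0 hn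
  set q : ℝ := (n : ℝ) + 2 * s with hq
  have hq0 : 0 < q := by positivity
  set D : ℝ := C₀ * δ ^ (-(2 * s))
  have hD : 0 ≤ D := by positivity
  set V : ℝ := volume.real (Metric.ball (0 : E n) ρ)
  have hV : 0 ≤ V := measureReal_nonneg
  refine ⟨D * (1 + (2 * ρ) ^ q) + V * 2 ^ q * ((2 * ρ) ^ (-q) + 1), by positivity, fun x => ?_⟩
  rcases lt_or_ge ‖x‖ (2 * ρ) with hx | hx
  · calc farLevy n s δ {z | x + z ∈ Metric.ball 0 ρ} ≤ farLevy n s δ Set.univ :=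
          measure_mono (Set.subset_univ _)
      _ ≤ ENNReal.ofReal D := by
          rw [farLevy, Measure.restrict_apply_univ]; exact h δ hδ
      _ ≤ _ := by
          apply ENNReal.ofReal_le_ofReal
          rw [le_div_iff₀ (weight_pos x q)]
          have h1 : ‖x‖ ^ q ≤ (2 * ρ) ^ q := by gcongr
          have h2 : 0 ≤ V * 2 ^ q * ((2 * ρ) ^ (-q) + 1) := by positivity
          nlinarith
  · have hx0 : 0 < ‖x‖ := by linarith
    have hms : MeasurableSet {z : E n | x + z ∈ Metric.ball 0 ρ} :=
      (measurable_const_add x) measurableSet_ball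
    have hvol : volume {z : E n | x + z ∈ Metric.ball 0 ρ} = ENNReal.ofReal V := by
      rw [show ENNReal.ofReal V = volume (Metric.ball (0 : E n) ρ) from
        ENNReal.ofReal_toReal measure_ball_lt_top.ne]
      exact (measurePreserving_add_left volume x).measure_preimage
        measurableSet_ball.nullMeasurableSet
    calc farLevy n s δ {z | x + z ∈ Metric.ball 0 ρ}
        ≤ levy n s {z | x + z ∈ Metric.ball 0 ρ} := Measure.restrict_apply_le _ _
      _ = ∫⁻ z in {z | x + z ∈ Metric.ball 0 ρ}, ENNReal.ofReal (‖z‖ ^ (-q)) := by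
          rw [levy, withDensity_apply _ hms]
      _ ≤ ∫⁻ z in {z : E n | x + z ∈ Metric.ball 0 ρ}, ENNReal.ofReal ((‖x‖ / 2) ^ (-q)) := by
          refine setLIntegral_mono measurable_const fun z hz => ?_
          have hz' : ‖x + z‖ < ρ := by simpa using hz
          have h1 : ‖x‖ ≤ ‖x + z‖ + ‖z‖ := by
            simpa using norm_sub_le (x + z) z
          apply ENNReal.ofReal_le_ofReal
          apply Real.rpow_le_rpow_of_nonpos (by positivity) (by linarith) (by linarith)
      _ = ENNReal.ofReal ((‖x‖ / 2) ^ (-q) * V) := by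
          rw [setLIntegral_const, hvol, ← ENNReal.ofReal_mul (by positivity)]
      _ ≤ _ := by
          apply ENNReal.ofReal_le_ofReal
          rw [le_div_iff₀ (weight_pos x q)]
          have h1 : ‖x‖ ^ (-q) ≤ (2 * ρ) ^ (-q) :=
            Real.rpow_le_rpow_of_nonpos (by positivity) hx (by linarith)
          have h2 : ‖x‖ ^ (-q) * ‖x‖ ^ q = 1 := by
            rw [← Real.rpow_add hx0]; simp
          have h3 : (‖x‖ / 2) ^ (-q) = ‖x‖ ^ (-q) * 2 ^ q := by
            rw [Real.div_rpow hx0.le (by norm_num), Real.rpow_neg (by norm_num : (0:ℝ) ≤ 2),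
              div_inv_eq_mul]
          rw [h3]
          have h4 : 0 ≤ D * (1 + (2 * ρ) ^ q) := by positivity
          have h5 : ‖x‖ ^ (-q) * 2 ^ q * V * (1 + ‖x‖ ^ q) =
              V * 2 ^ q * (‖x‖ ^ (-q) + 1) := by
            linear_combination (2 ^ q * V) * h2
          rw [h5]
          have h6 : V * 2 ^ q * (‖x‖ ^ (-q) + 1) ≤ V * 2 ^ q * ((2 * ρ) ^ (-q) + 1) := by gcongr
          linarith

section Far

variable {w ψ : E n → ℝ} {B ρ δ : ℝ}

lemma FracLocal.integrable_mul (hw : FracLocal s w) (hs0 : 0 < s) (hψ : BddComp ψ B ρ) :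
    Integrable (fun x => w x * ψ x) volume := by
  have hB : 0 ≤ B := (abs_nonneg _).trans (hψ.bound 0)
  set q : ℝ := (n : ℝ) + 2 * s with hq
  have hq0 : 0 ≤ q := by positivity
  refine Integrable.mono' (hw.integrable_weight.mul_const (B * (1 + |ρ| ^ q)))
    (hw.measurable.mul hψ.measurable).aestronglyMeasurable (Eventually.of_forall fun x => ?_)
  rcases le_or_gt ρ ‖x‖ with h | h
  · rw [hψ.supp x h, mul_zero, norm_zero]
    have := weight_pos x q
    positivity
  · rw [Real.norm_eq_abs, abs_mul, div_mul_eq_mul_div, le_div_iff₀ (weight_pos x _)]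
    have h1 : ‖x‖ ^ q ≤ |ρ| ^ q := by
      apply Real.rpow_le_rpow (norm_nonneg x) (h.le.trans (le_abs_self ρ)) hq0
    have h2 := hψ.bound x
    rw [mul_assoc]
    gcongr

/-- Away from the diagonal all products of values of `w` and of a bounded compactly supported
function are integrable separately. -/
lemma FracLocal.integrable_far_self (hw : FracLocal s w) (hs0 : 0 < s) (hn : 0 < n) (hδ : 0 < δ)
    (hψ : BddComp ψ B ρ) :
    Integrable (fun p : E n × E n => w p.2 * ψ p.2) ((farLevy n s δ).prod volume) := by
  have := isFiniteMeasure_farLevy (n := n) hs0 hn hδ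
  exact (hw.integrable_mul hs0 hψ).comp_snd (farLevy n s δ)

lemma FracLocal.integrable_far_cross (hw : FracLocal s w) (hs0 : 0 < s) (hn : 0 < n) (hδ : 0 < δ)
    (hψ : BddComp ψ B ρ) :
    Integrable (fun p : E n × E n => w p.2 * ψ (p.2 + p.1)) ((farLevy n s δ).prod volume) := by
  have hB : 0 ≤ B := (abs_nonneg _).trans (hψ.bound 0)
  have hwm := hw.measurable
  have hψm := hψ.measurable
  wlog hρ : 0 < ρ generalizing ρ
  · exact this (ρ := 1) ⟨hψ.1, hψ.2, fun x hx => hψ.3 x (by linarith)⟩ one_pos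
  obtain ⟨C, hC, h⟩ := farLevy_preimage_ball_le (n := n) hs0 hn hδ hρ
  refine ⟨by fun_prop, ?_⟩
  rw [hasFiniteIntegral_iff_norm]
  rw [lintegral_prod_symm _ (by fun_prop)]
  have hfin := hw.integrable_weight.mul_const (B * C)
  have hfin' := hfin.2
  rw [hasFiniteIntegral_iff_ofReal (Eventually.of_forall fun x => by
    have := weight_pos x ((n : ℝ) + 2 * s)
    positivity)] at hfin'
  refine lt_of_le_of_lt (lintegral_mono fun x => ?_) hfin'
  have hms : MeasurableSet {z : E n | x + z ∈ Metric.ball 0 ρ} :=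
    (measurable_const_add x) measurableSet_ball
  calc ∫⁻ z, ENNReal.ofReal ‖w x * ψ (x + z)‖ ∂(farLevy n s δ)
      ≤ ∫⁻ z, Set.indicator {z : E n | x + z ∈ Metric.ball 0 ρ}
          (fun _ => ENNReal.ofReal (|w x| * B)) z ∂(farLevy n s δ) := by
        refine lintegral_mono fun z => ?_
        by_cases hz : z ∈ {z : E n | x + z ∈ Metric.ball 0 ρ}
        · rw [Set.indicator_of_mem hz]
          apply ENNReal.ofReal_le_ofReal
          rw [Real.norm_eq_abs, abs_mul]
          gcongr
          exact hψ.bound _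
        · rw [Set.indicator_of_notMem hz, hψ.supp _ (by simpa using hz)]
          simp
    _ = ENNReal.ofReal (|w x| * B) * farLevy n s δ {z : E n | x + z ∈ Metric.ball 0 ρ} := by
        rw [lintegral_indicator hms, setLIntegral_const]
    _ ≤ ENNReal.ofReal (|w x| * B) *
          ENNReal.ofReal (C / (1 + ‖x‖ ^ ((n : ℝ) + 2 * s))) := by gcongr; exact h x
    _ = _ := by
        rw [← ENNReal.ofReal_mul (by positivity)]
        congr 1
        ring

lemma FracLocal.integrable_far_cross' (hw : FracLocal s w) (hs0 : 0 < s) (hn : 0 < n)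
    (hδ : 0 < δ) (hψ : BddComp ψ B ρ) :
    Integrable (fun p : E n × E n => w (p.2 + p.1) * ψ p.2) ((farLevy n s δ).prod volume) := by
  have h := (measurePreserving_pairSwap (measurePreserving_neg_farLevy (n := n) (s := s) δ))
  simpa [Function.comp_def] using
    h.integrable_comp_of_integrable (hw.integrable_far_cross hs0 hn hδ hψ)

lemma FracLocal.integrable_far_self' (hw : FracLocal s w) (hs0 : 0 < s) (hn : 0 < n)
    (hδ : 0 < δ) (hψ : BddComp ψ B ρ) :
    Integrable (fun p : E n × E n => w (p.2 + p.1) * ψ (p.2 + p.1))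
      ((farLevy n s δ).prod volume) := by
  have h := (measurePreserving_pairSwap (measurePreserving_neg_farLevy (n := n) (s := s) δ))
  simpa [Function.comp_def] using
    h.integrable_comp_of_integrable (hw.integrable_far_self hs0 hn hδ hψ)

lemma FracLocal.integrable_far_incr (hw : FracLocal s w) (hs0 : 0 < s) (hn : 0 < n) (hδ : 0 < δ)
    (hψ : BddComp ψ B ρ) :
    Integrable (fun p => incr w p * incr ψ p) ((farLevy n s δ).prod volume) := by
  have := (((hw.integrable_far_self' hs0 hn hδ hψ).sub (hw.integrable_far_cross' hs0 hn hδ hψ)).sub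
    (hw.integrable_far_cross hs0 hn hδ hψ)).add (hw.integrable_far_self hs0 hn hδ hψ)
  refine this.congr (Eventually.of_forall fun p => ?_)
  simp only [incr, Pi.add_apply, Pi.sub_apply]
  ring

/-- If `ψ` is bounded with compact support and has finite energy, the form `E(w, ψ)` converges
absolutely for every `w ∈ L_s ∩ Ḣ^s_loc`. -/
lemma FracLocal.integrable_incr (hw : FracLocal s w) (hs0 : 0 < s) (hn : 0 < n)
    (hψ : BddComp ψ B ρ) (hE : Integrable (fun p => incr ψ p ^ 2) ((levy n s).prod volume)) :
    Integrable (fun p => incr w p * incr ψ p) ((levy n s).prod volume) := by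
  rw [integrable_iff_near_far 1]
  refine ⟨?_, hw.integrable_far_incr hs0 hn one_pos hψ⟩
  have h1 := (integrable_indicator_iff (measurableSet_pair_ball (n := n) (ρ + 1))).2
    (hw.energy (ρ + 1))
  have h2 := ((integrable_iff_near_far 1).1 (h1.add hE)).1
  refine Integrable.mono' h2 ((measurable_incr hw.measurable).mul
    (measurable_incr hψ.measurable)).aestronglyMeasurable ?_
  filter_upwards [ae_nearLevy (n := n) (s := s) 1] with p hp
  have hnn : 0 ≤ Set.indicator {p : E n × E n | p.2 ∈ Metric.ball 0 (ρ + 1) ∧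
      p.2 + p.1 ∈ Metric.ball 0 (ρ + 1)} (fun p => incr w p ^ 2) p :=
    Set.indicator_apply_nonneg fun _ => sq_nonneg _
  simp only [Pi.add_apply]
  by_cases hz : incr ψ p = 0
  · rw [hz]; simpa using hnn
  · have hmem : p ∈ {p : E n × E n | p.2 ∈ Metric.ball 0 (ρ + 1) ∧
        p.2 + p.1 ∈ Metric.ball 0 (ρ + 1)} := by
      simp only [Set.mem_ofPred_eq, mem_ball_zero_iff]
      by_contra hcon
      apply hz
      have hx : ‖p.2‖ ≤ ‖p.2 + p.1‖ + ‖p.1‖ := by simpa using norm_sub_le (p.2 + p.1) p.1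
      have hy : ‖p.2 + p.1‖ ≤ ‖p.2‖ + ‖p.1‖ := norm_add_le _ _
      have h3 : ρ ≤ ‖p.2‖ ∧ ρ ≤ ‖p.2 + p.1‖ := by
        by_contra hcc
        apply hcon
        rcases not_and_or.1 hcc with h | h <;> constructor <;> linarith
      rw [incr, hψ.supp _ h3.1, hψ.supp _ h3.2, sub_zero]
    rw [Set.indicator_of_mem hmem, Real.norm_eq_abs, abs_mul]
    nlinarith [sq_nonneg (|incr w p| - |incr ψ p|), sq_abs (incr w p), sq_abs (incr ψ p),
      sq_nonneg (incr w p), sq_nonneg (incr ψ p)]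

end Far

end HenonGelfand

/-! ### Second differences and summation by parts -/

namespace HenonGelfand

variable {n : ℕ} {s : ℝ}

/-- The symmetric second difference `φ (x + z) + φ (x - z) - 2 φ x`. -/
def secondDiff (φ : E n → ℝ) (p : E n × E n) : ℝ := φ (p.2 + p.1) + φ (p.2 - p.1) - 2 * φ p.2

lemma measurable_secondDiff {φ : E n → ℝ} (h : Measurable φ) : Measurable (secondDiff φ) := by
  unfold secondDiff; fun_prop

section Identity

variable {w ψ : E n → ℝ} {B ρ δ : ℝ}

lemma integrable_neg_fst {κ : Measure (E n)} [SFinite κ]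
    (hκ : MeasurePreserving (fun z : E n => -z) κ κ) {F : E n × E n → ℝ}
    (hF : Integrable F (κ.prod volume)) :
    Integrable (fun p : E n × E n => F (-p.1, p.2)) (κ.prod volume) :=
  (measurePreserving_neg_fst hκ).integrable_comp_of_integrable hF

lemma integral_neg_fst {κ : Measure (E n)} [SFinite κ]
    (hκ : MeasurePreserving (fun z : E n => -z) κ κ) (F : E n × E n → ℝ) :
    ∫ p : E n × E n, F (-p.1, p.2) ∂(κ.prod volume) = ∫ p, F p ∂(κ.prod volume) :=
  (measurePreserving_neg_fst hκ).integral_comp' F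

lemma integral_pairSwap {κ : Measure (E n)} [SFinite κ]
    (hκ : MeasurePreserving (fun z : E n => -z) κ κ) (F : E n × E n → ℝ) :
    ∫ p : E n × E n, F (-p.1, p.2 + p.1) ∂(κ.prod volume) = ∫ p, F p ∂(κ.prod volume) :=
  (measurePreserving_pairSwap hκ).integral_comp' F

lemma FracLocal.integrable_far_secondDiff (hw : FracLocal s w) (hs0 : 0 < s) (hn : 0 < n)
    (hδ : 0 < δ) (hψ : BddComp ψ B ρ) :
    Integrable (fun p => w p.2 * secondDiff ψ p) ((farLevy n s δ).prod volume) := by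
  have h1 := hw.integrable_far_cross hs0 hn hδ hψ
  have h2 := integrable_neg_fst (measurePreserving_neg_farLevy (n := n) (s := s) δ) h1
  have h3 := (h1.add h2).sub ((hw.integrable_far_self hs0 hn hδ hψ).const_mul 2)
  refine h3.congr (Eventually.of_forall fun p => ?_)
  simp only [secondDiff, Pi.add_apply, Pi.sub_apply, ← sub_eq_add_neg]
  ring

/-- Discrete integration by parts on increments bounded away from zero. -/
lemma FracLocal.integral_far_incr (hw : FracLocal s w) (hs0 : 0 < s) (hn : 0 < n)
    (hδ : 0 < δ) (hψ : BddComp ψ B ρ) {S : Set (E n)} (hS : MeasurableSet S)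
    (hsymm : ∀ z, -z ∈ S ↔ z ∈ S) :
    ∫ p, incr w p * incr ψ p ∂(((farLevy n s δ).restrict S).prod volume) =
      -∫ p, w p.2 * secondDiff ψ p ∂(((farLevy n s δ).restrict S).prod volume) := by
  have hκ : MeasurePreserving (fun z : E n => -z) ((farLevy n s δ).restrict S)
      ((farLevy n s δ).restrict S) := by
    have := (measurePreserving_neg_farLevy (n := n) (s := s) δ).restrict_preimage hS
    rwa [show (fun z : E n => -z) ⁻¹' S = S from Set.ext hsymm] at this
  set κ := (farLevy n s δ).restrict S with hκdef
  have hle : κ.prod (volume : Measure (E n)) ≤ (farLevy n s δ).prod volume :=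
    Measure.prod_mono Measure.restrict_le_self le_rfl
  have i1 := (hw.integrable_far_self hs0 hn hδ hψ).mono_measure hle
  have i2 := (hw.integrable_far_cross hs0 hn hδ hψ).mono_measure hle
  have i3 := (hw.integrable_far_self' hs0 hn hδ hψ).mono_measure hle
  have i4 := (hw.integrable_far_cross' hs0 hn hδ hψ).mono_measure hle
  have i5 := integrable_neg_fst hκ i2
  have e3 := integral_pairSwap hκ (fun p => w p.2 * ψ p.2)
  have e4 := integral_pairSwap hκ (fun p => w p.2 * ψ (p.2 + p.1))
  have e5 := integral_neg_fst hκ (fun p => w p.2 * ψ (p.2 + p.1))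
  simp only [add_neg_cancel_right] at e3 e4 e5
  have l : ∫ p, incr w p * incr ψ p ∂(κ.prod volume) =
      (∫ p, w (p.2 + p.1) * ψ (p.2 + p.1) ∂(κ.prod volume) -
        ∫ p, w (p.2 + p.1) * ψ p.2 ∂(κ.prod volume)) -
      (∫ p, w p.2 * ψ (p.2 + p.1) ∂(κ.prod volume) -
        ∫ p, w p.2 * ψ p.2 ∂(κ.prod volume)) := by
    rw [← integral_sub' i3 i4, ← integral_sub' i2 i1, ← integral_sub' (i3.sub i4) (i2.sub i1)]
    refine integral_congr_ae (Eventually.of_forall fun p => ?_)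
    simp only [incr, Pi.sub_apply]
    ring
  have r : ∫ p, w p.2 * secondDiff ψ p ∂(κ.prod volume) =
      (∫ p, w p.2 * ψ (p.2 + p.1) ∂(κ.prod volume) +
        ∫ p, w p.2 * ψ (p.2 + -p.1) ∂(κ.prod volume)) -
      2 * ∫ p, w p.2 * ψ p.2 ∂(κ.prod volume) := by
    rw [← integral_const_mul, ← integral_add' i2 i5, ← integral_sub' (i2.add i5) (i1.const_mul 2)]
    refine integral_congr_ae (Eventually.of_forall fun p => ?_)
    simp only [secondDiff, Pi.add_apply, Pi.sub_apply, ← sub_eq_add_neg]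
    ring
  rw [l, r, e3, e4, e5]
  ring

end Identity

/-- Quantitative regularity of a cutoff: `φ` is bounded by `B`, vanishes outside the ball of radius
`ρ`, its increments are at most `√L₁ |z|`, and its second differences at most `L₂ |z|²`. -/
structure TestBound (φ : E n → ℝ) (B ρ L₁ L₂ : ℝ) : Prop extends BddComp φ B ρ where
  incr_sq_le : ∀ p, incr φ p ^ 2 ≤ L₁ * ‖p.1‖ ^ 2
  secondDiff_le : ∀ p, |secondDiff φ p| ≤ L₂ * ‖p.1‖ ^ 2

lemma secondDiff_le_of_lipschitz_fderiv {φ : E n → ℝ} (hd : Differentiable ℝ φ) {L : NNReal}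
    (hL : LipschitzWith L (fderiv ℝ φ)) (p : E n × E n) :
    |secondDiff φ p| ≤ 2 * L * ‖p.1‖ ^ 2 := by
  obtain ⟨z, x⟩ := p
  have key : ∀ y : E n, ‖y‖ = ‖z‖ → ‖φ (x + y) - φ x - fderiv ℝ φ x y‖ ≤ L * ‖z‖ * ‖z‖ := by
    intro y hy
    have := (convex_closedBall x ‖z‖).norm_image_sub_le_of_norm_fderiv_le'
      (f := φ) (φ := fderiv ℝ φ x) (C := L * ‖z‖) (fun y _ => hd y)
      (fun y hy => by
        rw [← dist_eq_norm]
        refine (hL.dist_le_mul y x).trans ?_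
        gcongr
        exact hy)
      (Metric.mem_closedBall_self (norm_nonneg z))
      (show x + y ∈ Metric.closedBall x ‖z‖ by simp [hy])
    simpa [hy] using this
  have h1 := key z rfl
  have h2 := key (-z) (norm_neg z)
  simp only [secondDiff]
  have : φ (x + z) + φ (x - z) - 2 * φ x = (φ (x + z) - φ x - fderiv ℝ φ x z) +
      (φ (x + -z) - φ x - fderiv ℝ φ x (-z)) := by
    rw [map_neg, sub_eq_add_neg x z]; ring
  rw [this, ← Real.norm_eq_abs]
  refine (norm_add_le _ _).trans ?_
  nlinarith

lemma incr_sq_le_of_lipschitz {φ : E n → ℝ} {L : NNReal} (hL : LipschitzWith L φ)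
    (p : E n × E n) : incr φ p ^ 2 ≤ (L : ℝ) ^ 2 * ‖p.1‖ ^ 2 := by
  have h := hL.dist_le_mul (p.2 + p.1) p.2
  rw [Real.dist_eq, dist_eq_norm, add_sub_cancel_left] at h
  rw [incr, ← sq_abs, ← mul_pow]
  gcongr

lemma IsTestFunction.testBound {Ω : Set (E n)} {φ : E n → ℝ} (hφ : IsTestFunction Ω φ) :
    ∃ B ρ L₁ L₂ : ℝ, 0 ≤ B ∧ 0 < ρ ∧ 0 ≤ L₁ ∧ 0 ≤ L₂ ∧ TestBound φ B ρ L₁ L₂ := by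
  obtain ⟨hc, hk, -⟩ := hφ
  obtain ⟨B, hB⟩ := hk.exists_bound_of_continuous hc.continuous
  obtain ⟨ρ, hρ0, hρ⟩ := hk.isCompact.isBounded.subset_ball_lt 0 0
  obtain ⟨L, hL⟩ := ContDiff.lipschitzWith_of_hasCompactSupport hk hc (by simp)
  obtain ⟨L', hL'⟩ := ContDiff.lipschitzWith_of_hasCompactSupport (hk.fderiv ℝ)
    (hc.fderiv_right (m := ∞) (by simp)) (by simp)
  refine ⟨B, ρ, (L : ℝ) ^ 2, 2 * L', (norm_nonneg _).trans (hB 0), hρ0, by positivity,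
    by positivity, ⟨⟨hc.continuous.measurable, hB, fun x hx => ?_⟩, incr_sq_le_of_lipschitz hL,
    secondDiff_le_of_lipschitz_fderiv (hc.differentiable (by simp)) hL'⟩⟩
  by_contra h
  have := hρ (subset_tsupport φ h)
  rw [mem_ball_zero_iff] at this
  linarith

section Test

variable {w φ : E n → ℝ} {B ρ L₁ L₂ : ℝ}

lemma incr_eq_zero {φ : E n → ℝ} {B ρ : ℝ} (hφ : BddComp φ B ρ) {p : E n × E n}
    (h1 : ρ ≤ ‖p.2‖) (h2 : ρ ≤ ‖p.2 + p.1‖) : incr φ p = 0 := by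
  rw [incr, hφ.supp _ h1, hφ.supp _ h2, sub_zero]

lemma BddComp.integrable_sq (hφ : BddComp φ B ρ) : Integrable (fun x => φ x ^ 2) volume := by
  have h : IntegrableOn (fun _ : E n => B ^ 2) (Metric.ball 0 ρ) volume :=
    integrableOn_const measure_ball_lt_top.ne
  have h' := (integrable_indicator_iff measurableSet_ball).2 h
  refine h'.mono' (hφ.measurable.pow_const 2).aestronglyMeasurable
    (Eventually.of_forall fun x => ?_)
  by_cases hx : x ∈ Metric.ball (0 : E n) ρ
  · rw [Set.indicator_of_mem hx, Real.norm_eq_abs, abs_pow]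
    exact pow_le_pow_left₀ (abs_nonneg _) (hφ.bound x) 2
  · rw [Set.indicator_of_notMem hx, hφ.supp x (by simpa using hx)]
    simp

lemma integrable_far_incr_sq (hs0 : 0 < s) (hn : 0 < n) {δ : ℝ} (hδ : 0 < δ)
    (hφ : BddComp φ B ρ) :
    Integrable (fun p => incr φ p ^ 2) ((farLevy n s δ).prod volume) := by
  have := isFiniteMeasure_farLevy (n := n) hs0 hn hδ
  have h1 := hφ.integrable_sq.comp_snd (farLevy n s δ)
  have h2 := (measurePreserving_pairSwap
    (measurePreserving_neg_farLevy (n := n) (s := s) δ)).integrable_comp_of_integrable h1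
  refine Integrable.mono' ((h1.add h2).const_mul 2)
    ((measurable_incr hφ.measurable).pow_const 2).aestronglyMeasurable
    (Eventually.of_forall fun p => ?_)
  simp only [Pi.add_apply, Function.comp_def, pairSwap_apply, incr, Real.norm_eq_abs,
    abs_pow, sq_abs]
  nlinarith [sq_nonneg (φ (p.2 + p.1) + φ p.2)]

/-- A product of an integrable function of `x` and a multiple of `|z|²` is integrable for small
increments. -/
lemma integrable_near_mul (hs1 : s < 1) (hn : 0 < n) {δ : ℝ} (hδ : 0 < δ) {g : E n → ℝ}
    (hg : Integrable g volume) :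
    Integrable (fun p : E n × E n => ‖p.1‖ ^ 2 * g p.2) ((nearLevy n s δ).prod volume) :=
  (integrable_sq_nearLevy hs1 hn hδ).mul_prod hg

lemma integrable_indicator_ball (ρ : ℝ) :
    Integrable (Set.indicator (Metric.ball (0 : E n) ρ) (fun _ => (1 : ℝ))) volume :=
  (integrable_indicator_iff measurableSet_ball).2 (integrableOn_const measure_ball_lt_top.ne)

lemma integrable_near_incr_sq (hs1 : s < 1) (hn : 0 < n) {δ : ℝ} (hδ : 0 < δ)
    (hφ : BddComp φ B ρ) (hL : ∀ p, incr φ p ^ 2 ≤ L₁ * ‖p.1‖ ^ 2) :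
    Integrable (fun p => incr φ p ^ 2) ((nearLevy n s δ).prod volume) := by
  refine Integrable.mono' ((integrable_near_mul hs1 hn hδ
    (integrable_indicator_ball (ρ + δ))).const_mul L₁)
    ((measurable_incr hφ.measurable).pow_const 2).aestronglyMeasurable ?_
  filter_upwards [ae_nearLevy (n := n) (s := s) δ] with p hp
  rw [Real.norm_eq_abs, abs_pow, sq_abs]
  by_cases hx : p.2 ∈ Metric.ball (0 : E n) (ρ + δ)
  · rw [Set.indicator_of_mem hx, mul_one]
    exact hL p
  · rw [Set.indicator_of_notMem hx, mul_zero, mul_zero]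
    have hx' : ρ + δ ≤ ‖p.2‖ := by simpa using hx
    have : ‖p.2‖ ≤ ‖p.2 + p.1‖ + ‖p.1‖ := by simpa using norm_sub_le (p.2 + p.1) p.1
    rw [incr_eq_zero hφ (by linarith) (by linarith)]
    simp

lemma TestBound.integrable_incr_sq (hφ : TestBound φ B ρ L₁ L₂) (hs0 : 0 < s) (hs1 : s < 1)
    (hn : 0 < n) : Integrable (fun p => incr φ p ^ 2) ((levy n s).prod volume) :=
  (integrable_iff_near_far 1).2 ⟨integrable_near_incr_sq hs1 hn one_pos hφ.toBddComp hφ.incr_sq_le,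
    integrable_far_incr_sq hs0 hn one_pos hφ.toBddComp⟩

lemma FracLocal.integrable_near_secondDiff (hw : FracLocal s w) (hs0 : 0 < s) (hs1 : s < 1)
    (hn : 0 < n) {δ : ℝ} (hδ : 0 < δ) (hφ : TestBound φ B ρ L₁ L₂) :
    Integrable (fun p => w p.2 * secondDiff φ p) ((nearLevy n s δ).prod volume) := by
  have hb : BddComp (Set.indicator (Metric.ball (0 : E n) (ρ + δ)) (fun _ => (1 : ℝ))) 1
      (ρ + δ) := by
    refine ⟨measurable_const.indicator measurableSet_ball, fun x => ?_, fun x hx => ?_⟩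
    · by_cases hx : x ∈ Metric.ball (0 : E n) (ρ + δ)
      · simp [Set.indicator_of_mem hx]
      · simp [Set.indicator_of_notMem hx]
    · rw [Set.indicator_of_notMem (by simpa using hx)]
  have h1 := (hw.integrable_mul hs0 hb).norm
  refine Integrable.mono' ((integrable_near_mul (s := s) hs1 hn hδ h1).const_mul L₂)
    ((hw.measurable.comp measurable_snd).mul
      (measurable_secondDiff hφ.measurable)).aestronglyMeasurable ?_
  filter_upwards [ae_nearLevy (n := n) (s := s) δ] with p hp
  rw [Real.norm_eq_abs, Real.norm_eq_abs, abs_mul]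
  by_cases hx : p.2 ∈ Metric.ball (0 : E n) (ρ + δ)
  · rw [Set.indicator_of_mem hx, mul_one]
    nlinarith [hφ.secondDiff_le p, abs_nonneg (w p.2)]
  · rw [Set.indicator_of_notMem hx]
    have hx' : ρ + δ ≤ ‖p.2‖ := by simpa using hx
    have h1 : ‖p.2‖ ≤ ‖p.2 + p.1‖ + ‖p.1‖ := by simpa using norm_sub_le (p.2 + p.1) p.1
    have h2 : ‖p.2‖ ≤ ‖p.2 - p.1‖ + ‖p.1‖ := by simpa using norm_add_le (p.2 - p.1) p.1
    rw [secondDiff, hφ.supp _ (by linarith), hφ.supp (p.2 - p.1) (by linarith),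
      hφ.supp p.2 (by linarith)]
    simp

lemma FracLocal.integrable_secondDiff (hw : FracLocal s w) (hs0 : 0 < s) (hs1 : s < 1)
    (hn : 0 < n) (hφ : TestBound φ B ρ L₁ L₂) :
    Integrable (fun p => w p.2 * secondDiff φ p) ((levy n s).prod volume) :=
  (integrable_iff_near_far 1).2 ⟨hw.integrable_near_secondDiff hs0 hs1 hn one_pos hφ,
    hw.integrable_far_secondDiff hs0 hn one_pos hφ.toBddComp⟩

/-- Integration by parts for the form restricted to a symmetric set of increments: the second
difference of the smooth factor absorbs the singularity of the kernel. -/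
lemma FracLocal.integral_incr_eq (hw : FracLocal s w) (hs0 : 0 < s) (hs1 : s < 1)
    (hn : 0 < n) (hφ : TestBound φ B ρ L₁ L₂) {S : Set (E n)} (hS : MeasurableSet S)
    (hsymm : ∀ z, -z ∈ S ↔ z ∈ S) :
    ∫ p, incr w p * incr φ p ∂(((levy n s).restrict S).prod volume) =
      -∫ p, w p.2 * secondDiff φ p ∂(((levy n s).restrict S).prod volume) := by
  set A : ℕ → Set (E n) := fun k => (Metric.ball 0 (1 / ((k : ℝ) + 1)))ᶜ with hA
  have hAm : ∀ k, MeasurableSet (A k) := fun k => measurableSet_ball.compl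
  have hmono : Monotone A := by
    intro k l hkl
    apply Set.compl_subset_compl.2
    exact Metric.ball_subset_ball (Nat.one_div_le_one_div hkl)
  have hU : ⋃ k, A k = {0}ᶜ := by
    ext z
    simp only [hA, Set.mem_iUnion, Set.mem_compl_iff, mem_ball_zero_iff, not_lt,
      Set.mem_singleton_iff]
    constructor
    · rintro ⟨k, hk⟩ rfl
      rw [norm_zero] at hk
      have : 0 < 1 / ((k : ℝ) + 1) := by positivity
      linarith
    · intro hz
      obtain ⟨k, hk⟩ := exists_nat_one_div_lt (norm_pos_iff.2 hz)
      exact ⟨k, hk.le⟩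
  set μ : Measure (E n × E n) := ((levy n s).restrict S).prod volume with hμ
  have hlim : ∀ F : E n × E n → ℝ, Integrable F ((levy n s).prod volume) →
      (∀ p : E n × E n, p.1 = 0 → F p = 0) →
      Tendsto (fun k => ∫ p in A k ×ˢ Set.univ, F p ∂μ) atTop (𝓝 (∫ p, F p ∂μ)) := by
    intro F hF h0
    have hF' : Integrable F μ :=
      hF.mono_measure (Measure.prod_mono Measure.restrict_le_self le_rfl)
    have h := tendsto_setIntegral_of_monotone (μ := μ) (f := F)
      (s := fun k => A k ×ˢ (Set.univ : Set (E n)))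
      (fun k => (hAm k).prod MeasurableSet.univ)
      (fun k l hkl => Set.prod_mono (hmono hkl) subset_rfl) hF'.integrableOn
    have : ∫ p in ⋃ k, A k ×ˢ (Set.univ : Set (E n)), F p ∂μ = ∫ p, F p ∂μ := by
      apply setIntegral_eq_integral_of_forall_compl_eq_zero
      intro p hp
      apply h0
      by_contra hne
      apply hp
      rw [← Set.iUnion_prod_const, hU]
      exact ⟨hne, trivial⟩
    rwa [this] at h
  have hk : ∀ k, μ.restrict (A k ×ˢ Set.univ) =
      ((farLevy n s (1 / ((k : ℝ) + 1))).restrict S).prod volume := by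
    intro k
    have := Measure.prod_restrict (μ := (levy n s).restrict S)
      (ν := (volume : Measure (E n))) (A k) Set.univ
    rw [Measure.restrict_univ] at this
    rw [hμ, ← this, farLevy, Measure.restrict_comm (hAm k)]
  refine tendsto_nhds_unique (hlim _ (hw.integrable_incr hs0 hn hφ.toBddComp
    (hφ.integrable_incr_sq hs0 hs1 hn)) ?_) ?_
  · intro p hp; simp [incr, hp]
  · have h2 := (hlim _ (hw.integrable_secondDiff hs0 hs1 hn hφ) ?_).neg
    · refine h2.congr fun k => ?_
      rw [hk, hw.integral_far_incr hs0 hn (by positivity) hφ.toBddComp hS hsymm]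
    · intro p hp
      simp only [secondDiff, hp]
      simp; ring_nf; simp

end Test

end HenonGelfand

/-! ### The equation and the energies in terms of increments -/

namespace HenonGelfand

variable {n : ℕ} {s : ℝ}

lemma fracConst_pos (hs0 : 0 < s) (hs1 : s < 1) (hn : 0 < n) : 0 < fracConst n s := by
  have hn' : (0 : ℝ) < n := by exact_mod_cast hn
  have h1 : 0 < Real.Gamma (((n : ℝ) + 2 * s) / 2) := Real.Gamma_pos_of_pos (by positivity)
  have h2 : 0 < |Real.Gamma (-s)| := by
    refine abs_pos.2 (Real.Gamma_ne_zero fun m hm => ?_)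
    rcases Nat.eq_zero_or_pos m with rfl | hm0
    · simp at hm; linarith
    · have : (1 : ℝ) ≤ m := by exact_mod_cast hm0
      linarith
  unfold fracConst
  positivity

lemma integral_levy (g : E n → ℝ) :
    ∫ z, g z ∂(levy n s) = ∫ z, ‖z‖ ^ (-((n : ℝ) + 2 * s)) * g z := by
  have := setIntegral_levy (s := s) g MeasurableSet.univ
  simpa using this

lemma TestBound.integrable_secondDiff_levy {φ : E n → ℝ} {B ρ L₁ L₂ : ℝ}
    (hφ : TestBound φ B ρ L₁ L₂) (hs0 : 0 < s) (hs1 : s < 1) (hn : 0 < n) (x : E n) :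
    Integrable (fun z => secondDiff φ (z, x)) (levy n s) := by
  have hm := measurable_secondDiff hφ.measurable
  rw [← integrableOn_univ, ← Set.union_compl_self (Metric.ball (0 : E n) 1)]
  refine IntegrableOn.union ?_ ?_
  · refine Integrable.mono' ((integrable_sq_nearLevy hs1 hn one_pos).const_mul L₂)
      (hm.comp measurable_prodMk_right).aestronglyMeasurable
      (Eventually.of_forall fun z => hφ.secondDiff_le (z, x))
  · have := isFiniteMeasure_farLevy (n := n) hs0 hn one_pos
    refine Integrable.mono' (integrable_const (μ := farLevy n s 1) (4 * B))
      (hm.comp measurable_prodMk_right).aestronglyMeasurable (Eventually.of_forall fun z => ?_)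
    have h1 := abs_le.1 (hφ.bound (x + z))
    have h2 := abs_le.1 (hφ.bound (x - z))
    have h3 := abs_le.1 (hφ.bound x)
    rw [Real.norm_eq_abs, abs_le]
    simp only [secondDiff]
    constructor <;> linarith

/-- The principal value in the fractional Laplacian of a smooth function is an absolutely convergent
integral of second differences. -/
lemma fracLaplacian_eq {φ : E n → ℝ} {B ρ L₁ L₂ : ℝ}
    (hφ : TestBound φ B ρ L₁ L₂) (hs0 : 0 < s) (hs1 : s < 1) (hn : 0 < n) (x : E n) :
    fracLaplacian s φ x =
      -(fracConst n s / 2) * ∫ z, secondDiff φ (z, x) ∂(levy n s) := by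
  have hm := hφ.measurable
  have hint := hφ.integrable_secondDiff_levy (s := s) hs0 hs1 hn x
  have hset : ∀ ε : ℝ, MeasurableSet {z : E n | ε < ‖z‖} := fun ε =>
    measurableSet_lt measurable_const measurable_norm
  have hstep : ∀ ε : ℝ, 0 < ε →
      ∫ y in {y : E n | ε < ‖x - y‖}, (φ x - φ y) / ‖x - y‖ ^ ((n : ℝ) + 2 * s) =
      -(1 / 2) * ∫ z in {z : E n | ε < ‖z‖}, secondDiff φ (z, x) ∂(levy n s) := by
    intro ε hε
    have hms : MeasurableSet {y : E n | ε < ‖x - y‖} := by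
      exact measurableSet_lt measurable_const (by fun_prop)
    have e1 : ∫ y in {y : E n | ε < ‖x - y‖}, (φ x - φ y) / ‖x - y‖ ^ ((n : ℝ) + 2 * s) =
        ∫ z in {z : E n | ε < ‖z‖}, (φ x - φ (x + z)) ∂(levy n s) := by
      rw [setIntegral_levy _ (hset ε), ← integral_indicator hms, ← integral_indicator (hset ε),
        ← integral_add_left_eq_self _ x]
      refine integral_congr_ae (Eventually.of_forall fun z => ?_)
      simp only [Set.indicator, Set.mem_ofPred_eq, sub_add_cancel_left, norm_neg]
      rw [Real.rpow_neg (norm_nonneg z), div_eq_inv_mul]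
    have hfin : IsFiniteMeasure ((levy n s).restrict {z : E n | ε < ‖z‖}) := by
      have := isFiniteMeasure_farLevy (n := n) hs0 hn hε
      refine isFiniteMeasure_of_le (farLevy n s ε) (Measure.restrict_mono_set _ ?_)
      intro z hz
      simpa using le_of_lt hz
    have hb : ∀ y : E n → E n, Measurable y →
        Integrable (fun z => φ (y z)) ((levy n s).restrict {z : E n | ε < ‖z‖}) := by
      intro y hy
      exact Integrable.mono' (integrable_const B) (hm.comp hy).aestronglyMeasurable
        (Eventually.of_forall fun z => hφ.bound _)
    have i1 := hb (fun z => x + z) (by fun_prop)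
    have i2 := hb (fun z => x - z) (by fun_prop)
    have i3 := hb (fun _ => x) (by fun_prop)
    have hκ : MeasurePreserving (fun z : E n => -z) ((levy n s).restrict {z : E n | ε < ‖z‖})
        ((levy n s).restrict {z : E n | ε < ‖z‖}) :=
      measurePreserving_neg_levy_restrict (hset ε) (by simp)
    have e2 : ∫ z in {z : E n | ε < ‖z‖}, φ (x - z) ∂(levy n s) =
        ∫ z in {z : E n | ε < ‖z‖}, φ (x + z) ∂(levy n s) := by
      have := hκ.integral_comp (MeasurableEquiv.neg (E n)).measurableEmbedding
        (fun z => φ (x + z))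
      simpa only [← sub_eq_add_neg] using this
    rw [e1, integral_sub i3 i1]
    have e3 : ∫ z in {z : E n | ε < ‖z‖}, secondDiff φ (z, x) ∂(levy n s) =
        (∫ z in {z : E n | ε < ‖z‖}, φ (x + z) ∂(levy n s) +
          ∫ z in {z : E n | ε < ‖z‖}, φ (x - z) ∂(levy n s)) -
          2 * ∫ z in {z : E n | ε < ‖z‖}, φ x ∂(levy n s) := by
      rw [← integral_const_mul, ← integral_add' i1 i2, ← integral_sub' (i1.add i2) (i3.const_mul 2)]
      rfl
    rw [e3, e2]
    ring
  have hlim : Tendsto (fun ε : ℝ =>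
      ∫ z in {z : E n | ε < ‖z‖}, secondDiff φ (z, x) ∂(levy n s)) (𝓝[>] 0)
      (𝓝 (∫ z, secondDiff φ (z, x) ∂(levy n s))) := by
    simp_rw [← integral_indicator (hset _)]
    refine tendsto_integral_filter_of_dominated_convergence
      (fun z => ‖secondDiff φ (z, x)‖) ?_ ?_ hint.norm ?_
    · exact Eventually.of_forall fun ε => (hint.indicator (hset ε)).aestronglyMeasurable
    · exact Eventually.of_forall fun ε => Eventually.of_forall fun z =>
        norm_indicator_le_norm_self _ _
    · refine Eventually.of_forall fun z => ?_
      rcases eq_or_ne z 0 with rfl | hz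
      · have h0 : secondDiff φ (0, x) = 0 := by
          simp only [secondDiff, add_zero, sub_zero]; ring
        refine tendsto_const_nhds.congr fun ε => ?_
        simp [Set.indicator, h0]
      · refine tendsto_const_nhds.congr' ?_
        have : ∀ᶠ ε : ℝ in 𝓝[>] 0, ε < ‖z‖ :=
          nhdsWithin_le_nhds (Iio_mem_nhds (norm_pos_iff.2 hz))
        filter_upwards [this] with ε hε
        rw [Set.indicator_of_mem (show z ∈ {z : E n | ε < ‖z‖} from hε)]
  rw [fracLaplacian]
  have : Tendsto (fun ε : ℝ =>
      ∫ y in {y : E n | ε < ‖x - y‖}, (φ x - φ y) / ‖x - y‖ ^ ((n : ℝ) + 2 * s)) (𝓝[>] 0)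
      (𝓝 (-(1 / 2) * ∫ z, secondDiff φ (z, x) ∂(levy n s))) := by
    refine (hlim.const_mul (-(1 / 2))).congr' ?_
    filter_upwards [self_mem_nhdsWithin] with ε hε
    exact (hstep ε hε).symm
  rw [this.limUnder_eq]
  ring

/-- The weak formulation, tested with smooth functions, in terms of the energy form. -/
lemma IsSolution.integral_eq_form {a : ℝ} {u : E n → ℝ} (hu : IsSolution s a u)
    (hw : FracLocal s u) (hs0 : 0 < s) (hs1 : s < 1) (hn : 0 < n) {φ : E n → ℝ}
    (hφ : IsTestFunction Set.univ φ) :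
    ∫ x, henonExp a u x * φ x =
      fracConst n s / 2 * ∫ p, incr u p * incr φ p ∂((levy n s).prod volume) := by
  obtain ⟨B, ρ, L₁, L₂, -, -, -, -, hb⟩ := hφ.testBound
  rw [← hu.weak_eq φ hφ]
  have h1 := hw.integral_incr_eq hs0 hs1 hn hb MeasurableSet.univ (by simp)
  rw [Measure.restrict_univ] at h1
  rw [h1, integral_prod_symm _ (hw.integrable_secondDiff hs0 hs1 hn hb), ← integral_neg,
    ← integral_const_mul]
  refine integral_congr_ae (Eventually.of_forall fun x => ?_)
  simp only [fracLaplacian_eq hb hs0 hs1 hn x, integral_const_mul]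
  ring

/-- The energy of a smooth function in the coordinates `(z, x)`. -/
lemma TestBound.energy_eq {φ : E n → ℝ} {B ρ L₁ L₂ : ℝ} (hφ : TestBound φ B ρ L₁ L₂)
    (hs0 : 0 < s) (hs1 : s < 1) (hn : 0 < n) :
    ∫ x, ∫ y, (φ x - φ y) ^ 2 / ‖x - y‖ ^ ((n : ℝ) + 2 * s) =
      ∫ p, incr φ p ^ 2 ∂((levy n s).prod volume) := by
  rw [integral_prod_symm _ (hφ.integrable_incr_sq hs0 hs1 hn)]
  refine integral_congr_ae (Eventually.of_forall fun x => ?_)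
  simp only
  rw [integral_levy, ← integral_add_left_eq_self _ x]
  refine integral_congr_ae (Eventually.of_forall fun z => ?_)
  simp only [incr, sub_add_cancel_left, norm_neg]
  rw [Real.rpow_neg (norm_nonneg z)]
  ring

lemma fracLocal_of_mem {u : E n → ℝ} (hm : Measurable u) (hL : MemWeightedL s u)
    (hH : MemDotHLoc s u) : FracLocal s u := by
  refine ⟨hm, hL.2, fun ρ => ?_⟩
  have hfin := (hH (Metric.ball 0 ρ) Metric.isOpen_ball Metric.isBounded_ball).2
  have hmi : Measurable fun p : E n × E n => ENNReal.ofReal (incr u p ^ 2) :=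
    ((measurable_incr hm).pow_const 2).ennreal_ofReal
  refine ⟨((measurable_incr hm).pow_const 2).aestronglyMeasurable, ?_⟩
  rw [hasFiniteIntegral_iff_ofReal (Eventually.of_forall fun p => sq_nonneg _),
    ← lintegral_indicator (measurableSet_pair_ball ρ),
    lintegral_prod_symm _ ((hmi.indicator (measurableSet_pair_ball ρ)).aemeasurable)]
  refine lt_of_le_of_lt (le_of_eq ?_) hfin
  rw [← lintegral_indicator measurableSet_ball]
  refine lintegral_congr fun x => ?_
  rw [lintegral_levy (by
    have := hmi.indicator (measurableSet_pair_ball (n := n) ρ)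
    fun_prop)]
  by_cases hx : x ∈ Metric.ball (0 : E n) ρ
  · rw [Set.indicator_of_mem hx, ← lintegral_indicator measurableSet_ball]
    conv_rhs => rw [← lintegral_add_left_eq_self _ x]
    refine lintegral_congr fun z => ?_
    by_cases hz : x + z ∈ Metric.ball (0 : E n) ρ
    · have hxz : (z, x) ∈ {p : E n × E n | p.2 ∈ Metric.ball 0 ρ ∧
          p.2 + p.1 ∈ Metric.ball 0 ρ} := ⟨hx, hz⟩
      rw [Set.indicator_of_mem hz, Set.indicator_of_mem hxz,
        ← ENNReal.ofReal_mul (Real.rpow_nonneg (norm_nonneg z) _), sub_add_cancel_left, norm_neg,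
        Real.rpow_neg (norm_nonneg z), sq_abs]
      congr 1
      simp only [incr]
      ring
    · rw [Set.indicator_of_notMem hz, Set.indicator_of_notMem (fun h => hz h.2), mul_zero]
  · rw [Set.indicator_of_notMem hx]
    rw [← lintegral_zero (μ := (volume : Measure (E n)))]
    refine lintegral_congr fun z => ?_
    rw [Set.indicator_of_notMem (fun h => hx h.1), mul_zero]

end HenonGelfand

/-! ### Mollification -/

namespace HenonGelfand

variable {n : ℕ} {s : ℝ}

/-- A sequence of mollifiers supported in the balls of radius `1 / (k + 1)`. -/
noncomputable def mollBump (n : ℕ) (k : ℕ) : ContDiffBump (0 : E n) where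
  rIn := 1 / ((k : ℝ) + 1) / 2
  rOut := 1 / ((k : ℝ) + 1)
  rIn_pos := by positivity
  rIn_lt_rOut := half_lt_self (by positivity)

/-- The mollification of `ψ` at scale `1 / (k + 1)`. -/
noncomputable def moll (k : ℕ) (ψ : E n → ℝ) : E n → ℝ :=
  convolution ((mollBump n k).normed volume) ψ (ContinuousLinearMap.lsmul ℝ ℝ) volume

lemma moll_apply (k : ℕ) (ψ : E n → ℝ) (x : E n) :
    moll k ψ x = ∫ t, (mollBump n k).normed volume t * ψ (x - t) := rfl

lemma mollBump_normed_eq_zero (k : ℕ) {t : E n} (ht : 1 / ((k : ℝ) + 1) ≤ ‖t‖) :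
    (mollBump n k).normed volume t = 0 := by
  by_contra h
  have : t ∈ Function.support ((mollBump n k).normed volume) := h
  rw [ContDiffBump.support_normed_eq, mem_ball_zero_iff] at this
  exact absurd this (not_lt.2 ht)

section

variable {ψ : E n → ℝ} {B ρ : ℝ}

lemma BddComp.integrable (h : BddComp ψ B ρ) : Integrable ψ volume := by
  have h' := (integrable_indicator_ball (n := n) ρ).const_mul B
  refine h'.mono' h.measurable.aestronglyMeasurable (Eventually.of_forall fun x => ?_)
  by_cases hx : x ∈ Metric.ball (0 : E n) ρ
  · rw [Set.indicator_of_mem hx, mul_one]; exact h.bound x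
  · rw [Set.indicator_of_notMem hx, h.supp x (by simpa using hx)]; simp

lemma integrable_bump_mul (k : ℕ) {g : E n → ℝ} (hg : Measurable g) {C : ℝ}
    (hC : ∀ x, |g x| ≤ C) :
    Integrable (fun t => (mollBump n k).normed volume t * g t) volume :=
  (mollBump n k).integrable_normed.mul_bdd hg.aestronglyMeasurable
    (Eventually.of_forall hC)

lemma moll_eq_zero (k : ℕ) {x : E n} (h : ∀ y, ‖x - y‖ < 1 / ((k : ℝ) + 1) → ψ y = 0) :
    moll k ψ x = 0 := by
  rw [moll_apply]
  apply integral_eq_zero_of_ae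
  refine Eventually.of_forall fun t => ?_
  simp only [Pi.zero_apply]
  rcases le_or_gt (1 / ((k : ℝ) + 1)) ‖t‖ with ht | ht
  · rw [mollBump_normed_eq_zero k ht, zero_mul]
  · rw [h (x - t) (by simpa using ht), mul_zero]

lemma one_div_succ_le_one (k : ℕ) : 1 / ((k : ℝ) + 1) ≤ 1 := by
  rw [div_le_one (by positivity)]
  linarith [(Nat.cast_nonneg k : (0 : ℝ) ≤ k)]

lemma BddComp.contDiff_moll (h : BddComp ψ B ρ) (k : ℕ) : ContDiff ℝ ∞ (moll k ψ) :=
  (mollBump n k).hasCompactSupport_normed.contDiff_convolution_left _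
    (mollBump n k).contDiff_normed h.integrable.locallyIntegrable

lemma BddComp.moll (h : BddComp ψ B ρ) (k : ℕ) : BddComp (moll k ψ) B (ρ + 1) := by
  refine ⟨(h.contDiff_moll k).continuous.measurable, fun x => ?_, fun x hx => ?_⟩
  · have hi := integrable_bump_mul k (g := fun _ : E n => B) measurable_const
      (fun _ => le_rfl)
    rw [moll_apply, ← Real.norm_eq_abs]
    calc ‖∫ t, (mollBump n k).normed volume t * ψ (x - t)‖
        ≤ ∫ t, (mollBump n k).normed volume t * B := by
          refine norm_integral_le_of_norm_le hi (Eventually.of_forall fun t => ?_)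
          rw [Real.norm_eq_abs, abs_mul, abs_of_nonneg ((mollBump n k).nonneg_normed t)]
          exact mul_le_mul_of_nonneg_left (h.bound _) ((mollBump n k).nonneg_normed t)
      _ = B := by rw [integral_mul_const, ContDiffBump.integral_normed, one_mul]
  · refine moll_eq_zero k fun y hy => h.supp y ?_
    have := one_div_succ_le_one k
    have := norm_le_norm_add_norm_sub' x y
    linarith

lemma BddComp.hasCompactSupport (h : BddComp ψ B ρ) : HasCompactSupport ψ := by
  refine HasCompactSupport.of_support_subset_isCompact (isCompact_closedBall (0 : E n) ρ)
    fun x hx => ?_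
  by_contra hc
  exact hx (h.supp x (by simpa using (le_of_lt (by simpa using hc : ρ < ‖x‖))))

lemma BddComp.isTestFunction_moll (h : BddComp ψ B ρ) (k : ℕ) :
    IsTestFunction Set.univ (HenonGelfand.moll k ψ) :=
  ⟨h.contDiff_moll k, (h.moll k).hasCompactSupport, Set.subset_univ _⟩

lemma BddComp.isTestFunction_moll_compl (h : BddComp ψ B ρ) {k : ℕ} {R R₁ : ℝ}
    (hk : 1 / ((k : ℝ) + 1) < R₁ - R) (h0 : ∀ x, ‖x‖ < R₁ → ψ x = 0) :
    IsTestFunction (Metric.closedBall 0 R)ᶜ (HenonGelfand.moll k ψ) := by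
  refine ⟨h.contDiff_moll k, (h.moll k).hasCompactSupport, ?_⟩
  have hsub : tsupport (HenonGelfand.moll k ψ) ⊆ (Metric.ball 0 (R₁ - 1 / ((k : ℝ) + 1)))ᶜ := by
    refine closure_minimal (fun x hx => ?_) Metric.isOpen_ball.isClosed_compl
    intro hxb
    rw [mem_ball_zero_iff] at hxb
    refine hx (moll_eq_zero k fun y hy => h0 y ?_)
    have := norm_le_norm_add_norm_sub x y
    linarith
  intro x hx
  have := hsub hx
  simp only [Set.mem_compl_iff, mem_ball_zero_iff, not_lt, mem_closedBall_zero_iff,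
    not_le] at this ⊢
  linarith

lemma BddComp.ae_tendsto_moll (h : BddComp ψ B ρ) :
    ∀ᵐ x : E n, Tendsto (fun k => HenonGelfand.moll k ψ x) atTop (𝓝 (ψ x)) :=
  ContDiffBump.ae_convolution_tendsto_right_of_locallyIntegrable (K := 2)
    (φ := fun k => mollBump n k) tendsto_one_div_add_atTop_nhds_zero_nat
    (Eventually.of_forall fun k => le_of_eq (by simp [mollBump]; ring))
    h.integrable.locallyIntegrable

lemma BddComp.ae_tendsto_incr_moll (h : BddComp ψ B ρ) (κ : Measure (E n)) [SFinite κ] :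
    ∀ᵐ p ∂(κ.prod (volume : Measure (E n))),
      Tendsto (fun k => incr (HenonGelfand.moll k ψ) p) atTop (𝓝 (incr ψ p)) := by
  have h1 := (Measure.quasiMeasurePreserving_snd (μ := κ) (ν := (volume : Measure (E n)))).ae
    h.ae_tendsto_moll
  have h2 := (measurePreserving_shift (κ := κ)).quasiMeasurePreserving.ae h1
  filter_upwards [h1, h2] with p hp1 hp2
  exact hp2.sub hp1

lemma sq_integral_bump_le (k : ℕ) {g : E n → ℝ} (hg : Measurable g) {C : ℝ}
    (hC : ∀ x, |g x| ≤ C) :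
    (∫ t, (mollBump n k).normed volume t * g t) ^ 2 ≤
      ∫ t, (mollBump n k).normed volume t * g t ^ 2 := by
  set m := ∫ t, (mollBump n k).normed volume t * g t with hm
  have hC2 : ∀ x, |g x ^ 2| ≤ C ^ 2 := fun x => by
    rw [abs_pow]; exact pow_le_pow_left₀ (abs_nonneg _) (hC x) 2
  have i1 := integrable_bump_mul k hg hC
  have i2 := integrable_bump_mul k (hg.pow_const 2) hC2
  have i0 := (mollBump n k).integrable_normed (μ := (volume : Measure (E n)))
  have hnn : 0 ≤ ∫ t, (mollBump n k).normed volume t * (g t - m) ^ 2 :=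
    integral_nonneg fun t => mul_nonneg ((mollBump n k).nonneg_normed t) (sq_nonneg _)
  have heq : ∫ t, (mollBump n k).normed volume t * (g t - m) ^ 2 =
      ((∫ t, (mollBump n k).normed volume t * g t ^ 2) - 2 * m * m) + m ^ 2 * 1 := by
    have e1 : m * m = ∫ t, m * ((mollBump n k).normed volume t * g t) := by
      rw [integral_const_mul]
    rw [← (mollBump n k).integral_normed (μ := (volume : Measure (E n))), mul_assoc, e1,
      ← integral_const_mul, ← integral_const_mul,
      ← integral_sub' i2 ((i1.const_mul m).const_mul 2),
      ← integral_add' (i2.sub ((i1.const_mul m).const_mul 2)) (i0.const_mul (m ^ 2))]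
    refine integral_congr_ae (Eventually.of_forall fun t => ?_)
    simp only [Pi.add_apply, Pi.sub_apply]
    ring
  nlinarith

/-- Mollification does not increase the energy, by Jensen's inequality and translation
invariance. -/
lemma BddComp.lintegral_incr_moll_le (h : BddComp ψ B ρ) (k : ℕ) (κ : Measure (E n)) [SFinite κ] :
    ∫⁻ p, ENNReal.ofReal (incr (HenonGelfand.moll k ψ) p ^ 2) ∂(κ.prod volume) ≤
      ∫⁻ p, ENNReal.ofReal (incr ψ p ^ 2) ∂(κ.prod volume) := by
  have hmi := measurable_incr h.measurable
  have hb0 := (mollBump n k).nonneg_normed (μ := (volume : Measure (E n)))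
  have hbm : Measurable ((mollBump n k).normed (volume : Measure (E n))) :=
    (mollBump n k).continuous_normed.measurable
  have hib : ∀ p, |incr ψ p| ≤ 2 * B := fun p => by
    have h1 := abs_le.1 (h.bound (p.2 + p.1))
    have h2 := abs_le.1 (h.bound p.2)
    rw [incr, abs_le]; constructor <;> linarith
  have hpt : ∀ p : E n × E n, ENNReal.ofReal (incr (HenonGelfand.moll k ψ) p ^ 2) ≤
      ∫⁻ t, ENNReal.ofReal ((mollBump n k).normed volume t) *
        ENNReal.ofReal (incr ψ (p.1, p.2 - t) ^ 2) := by
    intro p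
    have hg : Measurable fun t : E n => incr ψ (p.1, p.2 - t) := hmi.comp (by fun_prop)
    have e : incr (HenonGelfand.moll k ψ) p =
        ∫ t, (mollBump n k).normed volume t * incr ψ (p.1, p.2 - t) := by
      have hB : ∀ y : E n, Integrable (fun t => (mollBump n k).normed volume t * ψ (y - t)) :=
        fun y => integrable_bump_mul k (h.measurable.comp (by fun_prop)) fun t => h.bound _
      rw [incr, moll_apply, moll_apply, ← integral_sub (hB _) (hB _)]
      refine integral_congr_ae (Eventually.of_forall fun t => ?_)
      simp only [incr]
      rw [show p.2 + p.1 - t = p.2 - t + p.1 by abel]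
      ring
    rw [e]
    refine (ENNReal.ofReal_le_ofReal (sq_integral_bump_le k hg fun t => hib _)).trans ?_
    rw [ofReal_integral_eq_lintegral_ofReal
      (integrable_bump_mul k (hg.pow_const 2) (C := (2 * B) ^ 2) fun t => by
        rw [abs_pow]; exact pow_le_pow_left₀ (abs_nonneg _) (hib _) 2)
      (Eventually.of_forall fun t => mul_nonneg (hb0 t) (sq_nonneg _))]
    refine lintegral_mono fun t => ?_
    rw [ENNReal.ofReal_mul (hb0 t)]
  calc ∫⁻ p, ENNReal.ofReal (incr (HenonGelfand.moll k ψ) p ^ 2) ∂(κ.prod volume)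
      ≤ ∫⁻ p, ∫⁻ t, ENNReal.ofReal ((mollBump n k).normed volume t) *
        ENNReal.ofReal (incr ψ (p.1, p.2 - t) ^ 2) ∂volume ∂(κ.prod volume) :=
        lintegral_mono hpt
    _ = ∫⁻ t, ∫⁻ p, ENNReal.ofReal ((mollBump n k).normed volume t) *
        ENNReal.ofReal (incr ψ (p.1, p.2 - t) ^ 2) ∂(κ.prod volume) ∂volume := by
        refine lintegral_lintegral_swap (Measurable.aemeasurable ?_)
        exact (hbm.comp measurable_snd).ennreal_ofReal.mul
          ((hmi.comp (by fun_prop)).pow_const 2).ennreal_ofReal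
    _ = ∫⁻ t, ENNReal.ofReal ((mollBump n k).normed volume t) *
        ∫⁻ p, ENNReal.ofReal (incr ψ p ^ 2) ∂(κ.prod volume) := by
        refine lintegral_congr fun t => ?_
        have hm' : Measurable fun p : E n × E n => incr ψ (p.1, p.2 - t) :=
          hmi.comp (by fun_prop)
        rw [lintegral_const_mul _ (hm'.pow_const 2).ennreal_ofReal]
        congr 1
        exact ((MeasurePreserving.id κ).prod
          (measurePreserving_sub_right volume t)).lintegral_comp
          (hmi.pow_const 2).ennreal_ofReal
    _ = ∫⁻ p, ENNReal.ofReal (incr ψ p ^ 2) ∂(κ.prod volume) := by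
        rw [lintegral_mul_const _ hbm.ennreal_ofReal,
          ← ofReal_integral_eq_lintegral_ofReal (mollBump n k).integrable_normed
            (Eventually.of_forall hb0), ContDiffBump.integral_normed, ENNReal.ofReal_one, one_mul]

lemma BddComp.integral_incr_moll_le (h : BddComp ψ B ρ) (k : ℕ) {κ : Measure (E n)} [SFinite κ]
    (hE : Integrable (fun p => incr ψ p ^ 2) (κ.prod volume)) :
    Integrable (fun p => incr (HenonGelfand.moll k ψ) p ^ 2) (κ.prod volume) ∧
    ∫ p, incr (HenonGelfand.moll k ψ) p ^ 2 ∂(κ.prod volume) ≤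
      ∫ p, incr ψ p ^ 2 ∂(κ.prod volume) := by
  have hle := h.lintegral_incr_moll_le k κ
  have hfin := (hasFiniteIntegral_iff_ofReal (Eventually.of_forall fun p =>
    sq_nonneg (incr ψ p))).1 hE.2
  have hi : Integrable (fun p => incr (HenonGelfand.moll k ψ) p ^ 2) (κ.prod volume) :=
    ⟨((measurable_incr (h.moll k).measurable).pow_const 2).aestronglyMeasurable,
      (hasFiniteIntegral_iff_ofReal (Eventually.of_forall fun p => sq_nonneg _)).2
        (hle.trans_lt hfin)⟩
  refine ⟨hi, ?_⟩
  rw [← ENNReal.ofReal_le_ofReal_iff (integral_nonneg fun p => sq_nonneg _),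
    ofReal_integral_eq_lintegral_ofReal hi (Eventually.of_forall fun p => sq_nonneg _),
    ofReal_integral_eq_lintegral_ofReal hE (Eventually.of_forall fun p => sq_nonneg _)]
  exact hle

end

/-- One-sided passage to the limit in a bilinear pairing: if `g k → g` almost everywhere without
increase of the `L²` norm, then `∫ F g ≤ lim ∫ F (g k)`, by Fatou's lemma applied to
`(F + g k)²`. -/
lemma integral_mul_le_of_tendsto {α : Type*} [MeasurableSpace α] {μ : Measure α} {F g : α → ℝ}
    {gk : ℕ → α → ℝ} {L : ℝ} (hFm : Measurable F) (hgm : Measurable g)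
    (hgkm : ∀ k, Measurable (gk k)) (hF : Integrable (fun x => F x ^ 2) μ)
    (hg : Integrable (fun x => g x ^ 2) μ) (hgk : ∀ k, Integrable (fun x => gk k x ^ 2) μ)
    (hle : ∀ k, ∫ x, gk k x ^ 2 ∂μ ≤ ∫ x, g x ^ 2 ∂μ)
    (hae : ∀ᵐ x ∂μ, Tendsto (fun k => gk k x) atTop (𝓝 (g x)))
    (hL : Tendsto (fun k => ∫ x, F x * gk k x ∂μ) atTop (𝓝 L)) :
    ∫ x, F x * g x ∂μ ≤ L := by
  have hmul : ∀ h : α → ℝ, Measurable h → Integrable (fun x => h x ^ 2) μ →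
      Integrable (fun x => F x * h x) μ := by
    intro h hm hi
    refine (hF.add hi).mono' (hFm.mul hm).aestronglyMeasurable (Eventually.of_forall fun x => ?_)
    rw [Real.norm_eq_abs, abs_mul]
    simp only [Pi.add_apply]
    nlinarith [sq_nonneg (|F x| - |h x|), sq_abs (F x), sq_abs (h x), sq_nonneg (F x),
      sq_nonneg (h x)]
  have hexp : ∀ h : α → ℝ, Measurable h → Integrable (fun x => h x ^ 2) μ →
      Integrable (fun x => (F x + h x) ^ 2) μ ∧ ∫ x, (F x + h x) ^ 2 ∂μ =
        (∫ x, F x ^ 2 ∂μ + 2 * ∫ x, F x * h x ∂μ) + ∫ x, h x ^ 2 ∂μ := by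
    intro h hm hi
    have i := hmul h hm hi
    have e : (fun x => (F x + h x) ^ 2) =
        ((fun x => F x ^ 2) + fun x => 2 * (F x * h x)) + fun x => h x ^ 2 := by
      ext x; simp only [Pi.add_apply]; ring
    rw [e]
    refine ⟨(hF.add (i.const_mul 2)).add hi, ?_⟩
    rw [integral_add' (hF.add (i.const_mul 2)) hi, integral_add' hF (i.const_mul 2),
      integral_const_mul]
  set A := ∫ x, F x ^ 2 ∂μ
  set G := ∫ x, g x ^ 2 ∂μ
  have hup : ∀ k, ∫ x, (F x + gk k x) ^ 2 ∂μ ≤ A + 2 * ∫ x, F x * gk k x ∂μ + G := fun k => by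
    rw [(hexp _ (hgkm k) (hgk k)).2]; linarith [hle k]
  have hlim : Tendsto (fun k => A + 2 * ∫ x, F x * gk k x ∂μ + G) atTop (𝓝 (A + 2 * L + G)) :=
    ((hL.const_mul 2).const_add A).add_const G
  have hpos : 0 ≤ A + 2 * L + G := ge_of_tendsto' hlim fun k =>
    (integral_nonneg fun x => sq_nonneg _).trans (hup k)
  have hfat : ENNReal.ofReal (∫ x, (F x + g x) ^ 2 ∂μ) ≤ ENNReal.ofReal (A + 2 * L + G) := by
    rw [ofReal_integral_eq_lintegral_ofReal (hexp g hgm hg).1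
      (Eventually.of_forall fun x => sq_nonneg _)]
    calc ∫⁻ x, ENNReal.ofReal ((F x + g x) ^ 2) ∂μ
        = ∫⁻ x, liminf (fun k => ENNReal.ofReal ((F x + gk k x) ^ 2)) atTop ∂μ := by
          refine lintegral_congr_ae ?_
          filter_upwards [hae] with x hx
          exact (ENNReal.tendsto_ofReal ((hx.const_add (F x)).pow 2)).liminf_eq.symm
      _ ≤ liminf (fun k => ∫⁻ x, ENNReal.ofReal ((F x + gk k x) ^ 2) ∂μ) atTop :=
          lintegral_liminf_le fun k => ((hFm.add (hgkm k)).pow_const 2).ennreal_ofReal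
      _ ≤ liminf (fun k => ENNReal.ofReal (A + 2 * ∫ x, F x * gk k x ∂μ + G)) atTop := by
          refine liminf_le_liminf (Eventually.of_forall fun k => ?_)
          rw [← ofReal_integral_eq_lintegral_ofReal (hexp _ (hgkm k) (hgk k)).1
            (Eventually.of_forall fun x => sq_nonneg _)]
          exact ENNReal.ofReal_le_ofReal (hup k)
      _ = _ := (ENNReal.tendsto_ofReal hlim).liminf_eq
  rw [ENNReal.ofReal_le_ofReal_iff hpos, (hexp g hgm hg).2] at hfat
  linarith

end HenonGelfand

/-! ### Test functions of finite energy -/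

namespace HenonGelfand

variable {n : ℕ} {s a : ℝ} {u ψ : E n → ℝ} {B ρ : ℝ}

lemma henonExp_nonneg (a : ℝ) (u : E n → ℝ) (x : E n) : 0 ≤ henonExp a u x :=
  mul_nonneg (Real.rpow_nonneg (norm_nonneg x) a) (Real.exp_pos _).le

lemma measurable_henonExp (hu : Measurable u) : Measurable (henonExp a u) := by
  unfold henonExp; fun_prop

lemma BddComp.integrable_mul_of_locallyIntegrable (hψ : BddComp ψ B ρ) {f : E n → ℝ}
    (hf : LocallyIntegrable f volume) : Integrable (fun x => f x * ψ x) volume := by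
  have h1 : IntegrableOn f (Metric.closedBall 0 ρ) volume :=
    hf.integrableOn_isCompact (isCompact_closedBall 0 ρ)
  have h2 : IntegrableOn (fun x => f x * ψ x) (Metric.closedBall 0 ρ) volume :=
    h1.mul_bdd hψ.measurable.aestronglyMeasurable (Eventually.of_forall hψ.bound)
  refine (integrableOn_iff_integrable_of_support_subset fun x hx => ?_).1 h2
  by_contra hc
  apply hx
  rw [hψ.supp x (by simpa using (le_of_lt (by simpa using hc : ρ < ‖x‖))), mul_zero]

lemma BddComp.sq (hψ : BddComp ψ B ρ) : BddComp (fun x => ψ x ^ 2) (B ^ 2) ρ :=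
  ⟨hψ.measurable.pow_const 2, fun x => by
    rw [abs_pow]; exact pow_le_pow_left₀ (abs_nonneg _) (hψ.bound x) 2,
    fun x hx => by rw [hψ.supp x hx]; norm_num⟩

/-- Stability extends from smooth functions to bounded functions of finite energy supported away
from the ball, by mollification and Fatou's lemma. -/
lemma IsStableIn.integral_le (hn : 0 < n) (hs0 : 0 < s) (hs1 : s < 1) {R R₁ : ℝ} (hR : R < R₁)
    (hstab : IsStableIn s a u (Metric.closedBall 0 R)ᶜ) (hum : Measurable u)
    (hf : LocallyIntegrable (henonExp a u) volume) (hψ : BddComp ψ B ρ)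
    (h0 : ∀ x, ‖x‖ < R₁ → ψ x = 0)
    (hE : Integrable (fun p => incr ψ p ^ 2) ((levy n s).prod volume)) :
    ∫ x, henonExp a u x * ψ x ^ 2 ≤
      fracConst n s / 2 * ∫ p, incr ψ p ^ 2 ∂((levy n s).prod volume) := by
  have hc := fracConst_pos (n := n) hs0 hs1 hn
  have hfm := measurable_henonExp (a := a) hum
  set f := henonExp a u with hfdef
  have hf0 : ∀ x, 0 ≤ f x := henonExp_nonneg a u
  set Q := fracConst n s / 2 * ∫ p, incr ψ p ^ 2 ∂((levy n s).prod volume)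
  have hQ : 0 ≤ Q := mul_nonneg (by positivity) (integral_nonneg fun p => sq_nonneg _)
  have hev : ∀ᶠ k : ℕ in atTop, ∫⁻ x, ENNReal.ofReal (f x * moll k ψ x ^ 2) ≤ ENNReal.ofReal Q := by
    have h1 : ∀ᶠ k : ℕ in atTop, 1 / ((k : ℝ) + 1) < R₁ - R :=
      tendsto_one_div_add_atTop_nhds_zero_nat.eventually (Iio_mem_nhds (sub_pos.2 hR))
    filter_upwards [h1] with k hk
    rw [← ofReal_integral_eq_lintegral_ofReal
      ((hψ.moll k).sq.integrable_mul_of_locallyIntegrable hf)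
      (Eventually.of_forall fun x => mul_nonneg (hf0 x) (sq_nonneg _))]
    apply ENNReal.ofReal_le_ofReal
    obtain ⟨B', ρ', L₁, L₂, -, -, -, -, hb⟩ := (hψ.isTestFunction_moll k).testBound
    refine (hstab _ (hψ.isTestFunction_moll_compl hk h0)).trans ?_
    rw [hb.energy_eq hs0 hs1 hn]
    exact mul_le_mul_of_nonneg_left (hψ.integral_incr_moll_le k hE).2 (by positivity)
  have hle : ∫⁻ x, ENNReal.ofReal (f x * ψ x ^ 2) ≤ ENNReal.ofReal Q := by
    calc ∫⁻ x, ENNReal.ofReal (f x * ψ x ^ 2)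
        = ∫⁻ x, liminf (fun k => ENNReal.ofReal (f x * moll k ψ x ^ 2)) atTop := by
          refine lintegral_congr_ae ?_
          filter_upwards [hψ.ae_tendsto_moll] with x hx
          exact (ENNReal.tendsto_ofReal ((hx.pow 2).const_mul (f x))).liminf_eq.symm
      _ ≤ liminf (fun k => ∫⁻ x, ENNReal.ofReal (f x * moll k ψ x ^ 2)) atTop :=
          lintegral_liminf_le fun k =>
            (hfm.mul ((hψ.moll k).measurable.pow_const 2)).ennreal_ofReal
      _ ≤ liminf (fun _ : ℕ => ENNReal.ofReal Q) atTop := liminf_le_liminf hev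
      _ = ENNReal.ofReal Q := by simp
  rw [← ofReal_integral_eq_lintegral_ofReal (hψ.sq.integrable_mul_of_locallyIntegrable hf)
      (Eventually.of_forall fun x => mul_nonneg (hf0 x) (sq_nonneg _)),
    ENNReal.ofReal_le_ofReal_iff hQ] at hle
  exact hle

lemma bddComp_indicator_ball (hB : 0 ≤ B) (ρ : ℝ) :
    BddComp (Set.indicator (Metric.ball (0 : E n) ρ) (fun _ => B)) B ρ := by
  refine ⟨measurable_const.indicator measurableSet_ball, fun x => ?_, fun x hx => ?_⟩
  · by_cases hx : x ∈ Metric.ball (0 : E n) ρ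
    · simp [Set.indicator_of_mem hx, abs_of_nonneg hB]
    · simp [Set.indicator_of_notMem hx, hB]
  · rw [Set.indicator_of_notMem (by simpa using hx)]

lemma BddComp.abs_le_indicator (hψ : BddComp ψ B ρ) (x : E n) :
    |ψ x| ≤ Set.indicator (Metric.ball (0 : E n) ρ) (fun _ => B) x := by
  by_cases hx : x ∈ Metric.ball (0 : E n) ρ
  · rw [Set.indicator_of_mem hx]; exact hψ.bound x
  · rw [Set.indicator_of_notMem hx, hψ.supp x (by simpa using hx), abs_zero]

/-- Away from the diagonal the form passes to the limit under mollification, by dominated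
convergence. -/
lemma FracLocal.tendsto_far (hw : FracLocal s u) (hs0 : 0 < s) (hn : 0 < n)
    (hψ : BddComp ψ B ρ) :
    Tendsto (fun k => ∫ p, incr u p * incr (moll k ψ) p ∂((farLevy n s 1).prod volume)) atTop
      (𝓝 (∫ p, incr u p * incr ψ p ∂((farLevy n s 1).prod volume))) := by
  have hB : 0 ≤ B := (abs_nonneg _).trans (hψ.bound 0)
  set χ := Set.indicator (Metric.ball (0 : E n) (ρ + 1)) (fun _ => B) with hχ
  have hχb : BddComp χ B (ρ + 1) := bddComp_indicator_ball hB _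
  have hdom := (((hw.integrable_far_self' hs0 hn one_pos hχb).norm.add
    (hw.integrable_far_cross' hs0 hn one_pos hχb).norm).add
    (hw.integrable_far_cross hs0 hn one_pos hχb).norm).add
    (hw.integrable_far_self hs0 hn one_pos hχb).norm
  refine tendsto_integral_filter_of_dominated_convergence _
    (Eventually.of_forall fun k => ((measurable_incr hw.measurable).mul
      (measurable_incr (hψ.moll k).measurable)).aestronglyMeasurable)
    (Eventually.of_forall fun k => Eventually.of_forall fun p => ?_) hdom ?_
  · have h1 := (hψ.moll k).abs_le_indicator (p.2 + p.1)
    have h2 := (hψ.moll k).abs_le_indicator p.2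
    have h3 : 0 ≤ χ (p.2 + p.1) := (abs_nonneg _).trans h1
    have h4 : 0 ≤ χ p.2 := (abs_nonneg _).trans h2
    simp only [Pi.add_apply, norm_mul, Real.norm_eq_abs, abs_of_nonneg h3, abs_of_nonneg h4, incr]
    have h5 := abs_sub (u (p.2 + p.1)) (u p.2)
    have h6 := abs_sub (moll k ψ (p.2 + p.1)) (moll k ψ p.2)
    calc |u (p.2 + p.1) - u p.2| * |moll k ψ (p.2 + p.1) - moll k ψ p.2|
        ≤ (|u (p.2 + p.1)| + |u p.2|) * (χ (p.2 + p.1) + χ p.2) := by gcongr; linarith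
      _ = _ := by ring
  · filter_upwards [hψ.ae_tendsto_incr_moll (farLevy n s 1)] with p hp
    exact hp.const_mul _

/-- The weak formulation, as an inequality, for bounded compactly supported test functions of finite
energy. -/
lemma IsSolution.form_le (hu : IsSolution s a u) (hw : FracLocal s u) (hs0 : 0 < s) (hs1 : s < 1)
    (hn : 0 < n) (hψ : BddComp ψ B ρ)
    (hE : Integrable (fun p => incr ψ p ^ 2) ((levy n s).prod volume)) :
    fracConst n s / 2 * ∫ p, incr u p * incr ψ p ∂((levy n s).prod volume) ≤
      ∫ x, henonExp a u x * ψ x := by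
  have hc := fracConst_pos (n := n) hs0 hs1 hn
  have hf := hu.locallyIntegrable
  set f := henonExp a u with hfdef
  have hB : 0 ≤ B := (abs_nonneg _).trans (hψ.bound 0)
  have hmE : ∀ k, Integrable (fun p => incr (moll k ψ) p ^ 2) ((levy n s).prod volume) :=
    fun k => (hψ.integral_incr_moll_le k hE).1
  have hrhs : Tendsto (fun k => ∫ x, f x * moll k ψ x) atTop (𝓝 (∫ x, f x * ψ x)) := by
    have hχb : BddComp (Set.indicator (Metric.ball (0 : E n) (ρ + 1)) (fun _ => B)) B (ρ + 1) :=
      bddComp_indicator_ball hB _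
    refine tendsto_integral_filter_of_dominated_convergence _
      (Eventually.of_forall fun k =>
        ((hψ.moll k).integrable_mul_of_locallyIntegrable hf).aestronglyMeasurable)
      (Eventually.of_forall fun k => Eventually.of_forall fun x => ?_)
      (hχb.integrable_mul_of_locallyIntegrable hf) ?_
    · rw [norm_mul, Real.norm_eq_abs, Real.norm_eq_abs, abs_of_nonneg (henonExp_nonneg a u x)]
      exact mul_le_mul_of_nonneg_left ((hψ.moll k).abs_le_indicator x) (henonExp_nonneg a u x)
    · filter_upwards [hψ.ae_tendsto_moll] with x hx
      exact hx.const_mul _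
  have hX : Tendsto (fun k => ∫ p, incr u p * incr (moll k ψ) p ∂((levy n s).prod volume)) atTop
      (𝓝 (2 / fracConst n s * ∫ x, f x * ψ x)) := by
    refine (hrhs.const_mul (2 / fracConst n s)).congr fun k => ?_
    rw [hu.integral_eq_form hw hs0 hs1 hn (hψ.isTestFunction_moll k)]
    field_simp
  have hfar := hw.tendsto_far hs0 hn hψ
  have hint := hw.integrable_incr hs0 hn hψ hE
  set G := {p : E n × E n | p.2 ∈ Metric.ball 0 (ρ + 3) ∧ p.2 + p.1 ∈ Metric.ball 0 (ρ + 3)}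
    with hG
  have hGm : MeasurableSet G := measurableSet_pair_ball (ρ + 3)
  set F : E n × E n → ℝ := G.indicator (incr u) with hF
  have hFm : Measurable F := (measurable_incr hw.measurable).indicator hGm
  have hF2 : Integrable (fun p => F p ^ 2) ((nearLevy n s 1).prod volume) := by
    have h1 := (integrable_indicator_iff hGm).2 (hw.energy (ρ + 3))
    refine ((integrable_iff_near_far 1).1 h1).1.congr (Eventually.of_forall fun p => ?_)
    by_cases hp : p ∈ G
    · simp only [hF, Set.indicator_of_mem hp]
    · simp [hF, Set.indicator_of_notMem hp]
  -- On increments shorter than `1` the pairing only sees `u` on a bounded set.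
  have hnear : ∀ {φ : E n → ℝ} {B' : ℝ}, BddComp φ B' (ρ + 1) →
      ∫ p, F p * incr φ p ∂((nearLevy n s 1).prod volume) =
        ∫ p, incr u p * incr φ p ∂((nearLevy n s 1).prod volume) := by
    intro φ B' hφ
    refine integral_congr_ae ?_
    filter_upwards [ae_nearLevy (n := n) (s := s) 1] with p hp
    by_cases hpG : p ∈ G
    · rw [hF, Set.indicator_of_mem hpG]
    · have hx : ‖p.2‖ ≤ ‖p.2 + p.1‖ + ‖p.1‖ := by simpa using norm_sub_le (p.2 + p.1) p.1
      have hy : ‖p.2 + p.1‖ ≤ ‖p.2‖ + ‖p.1‖ := norm_add_le _ _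
      have h3 : ρ + 1 ≤ ‖p.2‖ ∧ ρ + 1 ≤ ‖p.2 + p.1‖ := by
        by_contra hcc
        apply hpG
        simp only [hG, Set.mem_ofPred_eq, mem_ball_zero_iff]
        rcases not_and_or.1 hcc with h | h <;> constructor <;> linarith
      rw [incr_eq_zero hφ h3.1 h3.2, mul_zero, mul_zero]
  -- Near the diagonal `F` is square integrable, and the increments of the mollified functions
  -- converge without increase of the energy, which gives one inequality.
  have hψ' : BddComp ψ B (ρ + 1) := ⟨hψ.1, hψ.2, fun x hx => hψ.3 x (by linarith)⟩
  have hEn := ((integrable_iff_near_far 1).1 hE).1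
  have hkey := integral_mul_le_of_tendsto (μ := (nearLevy n s 1).prod volume) (F := F)
    (g := incr ψ) (gk := fun k => incr (moll k ψ))
    (L := (2 / fracConst n s * ∫ x, f x * ψ x) -
      ∫ p, incr u p * incr ψ p ∂((farLevy n s 1).prod volume))
    hFm (measurable_incr hψ.measurable) (fun k => measurable_incr (hψ.moll k).measurable)
    hF2 hEn (fun k => (hψ.integral_incr_moll_le k hEn).1)
    (fun k => (hψ.integral_incr_moll_le k hEn).2) (hψ.ae_tendsto_incr_moll _) (by
      refine (hX.sub hfar).congr fun k => ?_
      rw [hnear (hψ.moll k), integral_near_add_far 1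
        (hw.integrable_incr hs0 hn (hψ.moll k) (hmE k))]
      ring)
  rw [hnear hψ'] at hkey
  rw [integral_near_add_far 1 hint]
  have : (∫ p, incr u p * incr ψ p ∂((nearLevy n s 1).prod volume)) +
      ∫ p, incr u p * incr ψ p ∂((farLevy n s 1).prod volume) ≤
      2 / fracConst n s * ∫ x, f x * ψ x := by linarith
  calc _ ≤ fracConst n s / 2 * (2 / fracConst n s * ∫ x, f x * ψ x) := by gcongr
    _ = _ := by field_simp

end HenonGelfand

/-! ### Truncated exponentials and the pointwise inequality -/

namespace HenonGelfand

/-- The truncated exponential `exp (c min(t, k))`. -/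
noncomputable def truncExp (c k t : ℝ) : ℝ := Real.exp (c * min t k)

/-- The convex primitive of `truncExp c k` which equals `exp (c t) / c` for `t ≤ k` and is affine
for `t ≥ k`. -/
noncomputable def truncPrim (c k t : ℝ) : ℝ := truncExp c k t * (1 / c + (t - min t k))

lemma truncExp_pos (c k t : ℝ) : 0 < truncExp c k t := Real.exp_pos _

lemma truncExp_le {c : ℝ} (hc : 0 ≤ c) (k t : ℝ) : truncExp c k t ≤ Real.exp (c * k) :=
  Real.exp_le_exp.2 (mul_le_mul_of_nonneg_left (min_le_right _ _) hc)

lemma truncExp_le' {c : ℝ} (hc : 0 ≤ c) (k t : ℝ) : truncExp c k t ≤ Real.exp (c * t) :=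
  Real.exp_le_exp.2 (mul_le_mul_of_nonneg_left (min_le_left _ _) hc)

lemma measurable_truncExp (c k : ℝ) : Measurable (truncExp c k) := by
  unfold truncExp; fun_prop

lemma measurable_truncPrim (c k : ℝ) : Measurable (truncPrim c k) := by
  unfold truncPrim truncExp; fun_prop

lemma exp_tangent (x y : ℝ) : Real.exp x + Real.exp x * (y - x) ≤ Real.exp y := by
  have h := Real.add_one_le_exp (y - x)
  have : Real.exp y = Real.exp x * Real.exp (y - x) := by rw [← Real.exp_add]; ring_nf
  rw [this]
  nlinarith [Real.exp_pos x]

lemma truncPrim_tangent {c : ℝ} (hc : 0 < c) (k a b : ℝ) :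
    truncExp c k a * (b - a) ≤ truncPrim c k b - truncPrim c k a := by
  have h1 := exp_tangent (c * min a k) (c * min b k)
  have h2 : 0 ≤ (truncExp c k b - truncExp c k a) * (b - min b k) := by
    rcases le_or_gt b k with h | h
    · rw [min_eq_left h]; simp
    · refine mul_nonneg (sub_nonneg.2 (Real.exp_le_exp.2 ?_)) (by simp)
      rw [min_eq_right h.le]
      exact mul_le_mul_of_nonneg_left (min_le_right _ _) hc.le
  have h3 : truncPrim c k b - truncPrim c k a - truncExp c k a * (b - a) =
      (truncExp c k b - (truncExp c k a + truncExp c k a * (c * min b k - c * min a k))) / c +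
        (truncExp c k b - truncExp c k a) * (b - min b k) := by
    unfold truncPrim
    field_simp
    ring
  have h4 : 0 ≤ (truncExp c k b -
      (truncExp c k a + truncExp c k a * (c * min b k - c * min a k))) / c :=
    div_nonneg (sub_nonneg.2 h1) hc.le
  linarith

lemma truncPrim_nonneg {c : ℝ} (hc : 0 < c) (k t : ℝ) : 0 ≤ truncPrim c k t := by
  refine mul_nonneg (truncExp_pos c k t).le (add_nonneg (by positivity) (by simp))

lemma truncPrim_le {c : ℝ} (hc : 0 < c) (k t : ℝ) : truncPrim c k t ≤ Real.exp (c * t) / c := by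
  have h := exp_tangent (c * min t k) (c * t)
  rw [le_div_iff₀ hc]
  calc truncPrim c k t * c =
      Real.exp (c * min t k) + Real.exp (c * min t k) * (c * t - c * min t k) := by
        unfold truncPrim truncExp; field_simp
    _ ≤ _ := h

lemma abs_truncPrim_sub_le {c : ℝ} (hc : 0 < c) (k a b : ℝ) :
    |truncPrim c k a - truncPrim c k b| ≤ Real.exp (c * k) * |a - b| := by
  wlog h : b ≤ a generalizing a b
  · rw [abs_sub_comm, abs_sub_comm a b]; exact this b a (le_of_not_ge h)
  have h1 := truncPrim_tangent hc k a b
  have h2 := truncPrim_tangent hc k b a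
  have h3 : 0 ≤ truncExp c k b * (a - b) := mul_nonneg (truncExp_pos _ _ _).le (sub_nonneg.2 h)
  rw [abs_of_nonneg (by linarith), abs_of_nonneg (sub_nonneg.2 h)]
  have h4 := truncExp_le hc.le k a
  nlinarith

lemma min_sub_min_le {a b : ℝ} (h : b ≤ a) (k : ℝ) : min a k - min b k ≤ a - b := by
  rcases le_or_gt a k with h' | h'
  · rw [min_eq_left h', min_eq_left (h.trans h')]
  · rw [min_eq_right h'.le]
    rcases le_or_gt b k with h'' | h''
    · rw [min_eq_left h'']; linarith
    · rw [min_eq_right h''.le]; linarith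

lemma abs_truncExp_sub_le {c : ℝ} (hc : 0 < c) (k a b : ℝ) :
    |truncExp c k a - truncExp c k b| ≤ c * Real.exp (c * k) * |a - b| := by
  wlog h : b ≤ a generalizing a b
  · rw [abs_sub_comm, abs_sub_comm a b]; exact this b a (le_of_not_ge h)
  have hmin : min b k ≤ min a k := min_le_min_right k h
  have h1 := exp_tangent (c * min a k) (c * min b k)
  have h2 : truncExp c k b ≤ truncExp c k a :=
    Real.exp_le_exp.2 (mul_le_mul_of_nonneg_left hmin hc.le)
  have h3 := min_sub_min_le h k
  rw [abs_of_nonneg (sub_nonneg.2 h2), abs_of_nonneg (sub_nonneg.2 h)]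
  have h4 := truncExp_le hc.le k a
  calc truncExp c k a - truncExp c k b ≤ truncExp c k a * (c * (min a k - min b k)) := by
        unfold truncExp at *; linarith
    _ ≤ Real.exp (c * k) * (c * (a - b)) := by
        have : 0 ≤ min a k - min b k := sub_nonneg.2 hmin
        gcongr
    _ = _ := by ring

/-- The trapezoidal bound for the integral of the exponential. -/
lemma exp_sub_one_le_trapezoid {d : ℝ} (hd : 0 ≤ d) :
    Real.exp d - 1 ≤ d / 2 * (Real.exp d + 1) := by
  have hder : ∀ x : ℝ, HasDerivAt (fun y : ℝ => y / 2 * (Real.exp y + 1) - Real.exp y)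
      (1 / 2 * (Real.exp x + 1) + x / 2 * Real.exp x - Real.exp x) x := fun x =>
    (((hasDerivAt_id x).div_const 2).mul ((Real.hasDerivAt_exp x).add_const 1)).sub
      (Real.hasDerivAt_exp x)
  have hmono : MonotoneOn (fun y : ℝ => y / 2 * (Real.exp y + 1) - Real.exp y) (Set.Ici 0) := by
    refine monotoneOn_of_deriv_nonneg (convex_Ici 0)
      (fun x _ => (hder x).continuousAt.continuousWithinAt)
      (fun x _ => (hder x).differentiableAt.differentiableWithinAt) fun x _ => ?_
    rw [(hder x).deriv]
    have h := exp_tangent x 0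
    rw [Real.exp_zero] at h
    nlinarith
  have := hmono Set.self_mem_Ici hd hd
  simp only [Real.exp_zero] at this
  linarith

lemma sq_exp_sub_exp_le (x y : ℝ) :
    (Real.exp x - Real.exp y) ^ 2 ≤ (x - y) / 2 * (Real.exp (2 * x) - Real.exp (2 * y)) := by
  wlog h : y ≤ x generalizing x y
  · have := this y x (le_of_not_ge h); linarith
  have h1 := exp_sub_one_le_trapezoid (sub_nonneg.2 h)
  have hx : Real.exp x = Real.exp y * Real.exp (x - y) := by rw [← Real.exp_add]; ring_nf
  have h2x : Real.exp (2 * x) = Real.exp x ^ 2 := by rw [← Real.exp_nat_mul]; norm_num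
  have h2y : Real.exp (2 * y) = Real.exp y ^ 2 := by rw [← Real.exp_nat_mul]; norm_num
  have hy := Real.exp_pos y
  have hd : 0 ≤ Real.exp (x - y) - 1 := by
    have := Real.add_one_le_exp (x - y); linarith
  rw [h2x, h2y, hx]
  have : 0 ≤ Real.exp y ^ 2 * ((Real.exp (x - y) - 1) *
      ((x - y) / 2 * (Real.exp (x - y) + 1) - (Real.exp (x - y) - 1))) :=
    mul_nonneg (sq_nonneg _) (mul_nonneg hd (sub_nonneg.2 h1))
  nlinarith

lemma truncExp_two_mul (α k t : ℝ) : truncExp (2 * α) k t = truncExp α k t ^ 2 := by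
  rw [truncExp, truncExp, ← Real.exp_nat_mul]; congr 1; push_cast; ring

lemma sq_truncExp_sub_le {α : ℝ} (hα : 0 < α) (k a b : ℝ) :
    (truncExp α k a - truncExp α k b) ^ 2 ≤
      α / 2 * ((a - b) * (truncExp (2 * α) k a - truncExp (2 * α) k b)) := by
  wlog h : b ≤ a generalizing a b
  · have := this b a (le_of_not_ge h); linarith
  have hmin : min b k ≤ min a k := min_le_min_right k h
  have h1 := sq_exp_sub_exp_le (α * min a k) (α * min b k)
  have h2 : truncExp (2 * α) k b ≤ truncExp (2 * α) k a :=
    Real.exp_le_exp.2 (mul_le_mul_of_nonneg_left hmin (by positivity))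
  have h3 := min_sub_min_le h k
  have h4 : (min a k - min b k) * (truncExp (2 * α) k a - truncExp (2 * α) k b) ≤
      (a - b) * (truncExp (2 * α) k a - truncExp (2 * α) k b) :=
    mul_le_mul_of_nonneg_right h3 (sub_nonneg.2 h2)
  calc (truncExp α k a - truncExp α k b) ^ 2
      ≤ α / 2 * ((min a k - min b k) * (truncExp (2 * α) k a - truncExp (2 * α) k b)) := by
        refine h1.trans (le_of_eq ?_)
        unfold truncExp
        rw [mul_assoc 2 α, mul_assoc 2 α]
        ring
    _ ≤ _ := by gcongr

/-- A weighted Young inequality for a square of a sum. -/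
lemma young_sq {α : ℝ} (h0 : 0 < α) (h2 : α < 2) (X Y : ℝ) :
    4 / (2 + α) * (X + Y) ^ 2 ≤ 2 / α * X ^ 2 + 4 / (2 - α) * Y ^ 2 := by
  have h3 : 0 < 2 - α := by linarith
  have : 2 / α * X ^ 2 + 4 / (2 - α) * Y ^ 2 - 4 / (2 + α) * (X + Y) ^ 2 =
      2 * ((2 - α) * X - 2 * α * Y) ^ 2 / (α * (2 - α) * (2 + α)) := by
    field_simp
    ring
  have h4 : 0 ≤ 2 * ((2 - α) * X - 2 * α * Y) ^ 2 / (α * (2 - α) * (2 + α)) := by positivity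
  linarith

lemma caccioppoli_pointwise_aux {α : ℝ} (h0 : 0 < α) (h2 : α < 2) (k a b : ℝ) {η ζ : ℝ}
    (hζ : 0 ≤ ζ) (h : ζ ≤ η) :
    (truncPrim (2 * α) k a - truncPrim (2 * α) k b) * (η ^ 2 - ζ ^ 2) +
      4 / (2 + α) * (truncExp α k a * η - truncExp α k b * ζ) ^ 2 -
      4 / (2 - α) * ((η - ζ) ^ 2 * truncExp (2 * α) k a) ≤
    (a - b) * (truncExp (2 * α) k a * η ^ 2 - truncExp (2 * α) k b * ζ ^ 2) := by
  have hc : 0 < 2 * α := by positivity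
  have D1 := truncPrim_tangent hc k a b
  have hsq : ζ ^ 2 ≤ η ^ 2 := pow_le_pow_left₀ hζ h 2
  have hT := sq_truncExp_sub_le h0 k a b
  have hY := young_sq h0 h2 ((truncExp α k a - truncExp α k b) * ζ) (truncExp α k a * (η - ζ))
  rw [show (truncExp α k a - truncExp α k b) * ζ + truncExp α k a * (η - ζ) =
    truncExp α k a * η - truncExp α k b * ζ by ring] at hY
  have hT' : 2 / α * ((truncExp α k a - truncExp α k b) * ζ) ^ 2 ≤
      (a - b) * (truncExp (2 * α) k a - truncExp (2 * α) k b) * ζ ^ 2 := by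
    calc 2 / α * ((truncExp α k a - truncExp α k b) * ζ) ^ 2
        = 2 / α * (truncExp α k a - truncExp α k b) ^ 2 * ζ ^ 2 := by ring
      _ ≤ 2 / α * (α / 2 * ((a - b) * (truncExp (2 * α) k a - truncExp (2 * α) k b))) * ζ ^ 2 := by
          gcongr
      _ = _ := by field_simp
  have hD : 0 ≤ (truncPrim (2 * α) k b - truncPrim (2 * α) k a -
      truncExp (2 * α) k a * (b - a)) * (η ^ 2 - ζ ^ 2) :=
    mul_nonneg (by linarith) (by linarith)
  have hA : (truncExp α k a * (η - ζ)) ^ 2 = (η - ζ) ^ 2 * truncExp (2 * α) k a := by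
    rw [truncExp_two_mul]; ring
  rw [hA] at hY
  linarith

/-- The pointwise inequality behind the energy estimate. Its quadratic term has the coefficient
`4 / (2 + α) > 1`, so that it wins against stability; the first term on the left is a difference of
a convex primitive against a smooth function and loses no regularity after summation by parts. -/
lemma caccioppoli_pointwise {α : ℝ} (h0 : 0 < α) (h2 : α < 2) (k a b : ℝ) {η ζ : ℝ}
    (hη : 0 ≤ η) (hζ : 0 ≤ ζ) :
    (truncPrim (2 * α) k a - truncPrim (2 * α) k b) * (η ^ 2 - ζ ^ 2) +
      4 / (2 + α) * (truncExp α k a * η - truncExp α k b * ζ) ^ 2 -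
      4 / (2 - α) * ((η - ζ) ^ 2 * (truncExp (2 * α) k a + truncExp (2 * α) k b)) ≤
    (a - b) * (truncExp (2 * α) k a * η ^ 2 - truncExp (2 * α) k b * ζ ^ 2) := by
  have hC : 0 < 4 / (2 - α) := div_pos (by norm_num) (by linarith)
  have ha : 0 ≤ 4 / (2 - α) * ((η - ζ) ^ 2 * truncExp (2 * α) k a) :=
    mul_nonneg hC.le (mul_nonneg (sq_nonneg _) (truncExp_pos _ _ _).le)
  have hb : 0 ≤ 4 / (2 - α) * ((η - ζ) ^ 2 * truncExp (2 * α) k b) :=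
    mul_nonneg hC.le (mul_nonneg (sq_nonneg _) (truncExp_pos _ _ _).le)
  rcases le_total ζ η with h | h
  · have := caccioppoli_pointwise_aux h0 h2 k a b hζ h
    rw [mul_add ((η - ζ) ^ 2), mul_add (4 / (2 - α))]
    linarith
  · have := caccioppoli_pointwise_aux h0 h2 k b a hη h
    rw [mul_add ((η - ζ) ^ 2), mul_add (4 / (2 - α))]
    rw [show (ζ - η) ^ 2 = (η - ζ) ^ 2 by ring,
      show (truncExp α k b * ζ - truncExp α k a * η) ^ 2 =
        (truncExp α k a * η - truncExp α k b * ζ) ^ 2 by ring] at this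
    linarith

end HenonGelfand

/-! ### Energies of products and short jumps -/

namespace HenonGelfand

variable {n : ℕ} {s a : ℝ}

lemma integrable_weight_one (hs0 : 0 < s) :
    Integrable (fun x : E n => 1 / (1 + ‖x‖ ^ ((n : ℝ) + 2 * s))) volume := by
  set q : ℝ := (n : ℝ) + 2 * s with hq
  have hq0 : 0 ≤ q := by positivity
  have h := (integrable_one_add_norm (E := E n) (μ := volume) (r := q)
    (by simp [hq]; exact hs0)).const_mul (2 ^ q)
  refine h.mono' (Measurable.aestronglyMeasurable (by fun_prop)) (Eventually.of_forall fun x => ?_)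
  have hx := norm_nonneg x
  have hw := weight_pos x q
  rw [Real.norm_eq_abs, abs_of_nonneg (by positivity), Real.rpow_neg (by positivity),
    ← div_eq_mul_inv, div_le_div_iff₀ hw (by positivity), one_mul]
  rcases le_total ‖x‖ 1 with h1 | h1
  · calc (1 + ‖x‖) ^ q ≤ 2 ^ q := by
          apply Real.rpow_le_rpow (by positivity) (by linarith) hq0
      _ ≤ 2 ^ q * (1 + ‖x‖ ^ q) := by
          have h2 : 0 ≤ ‖x‖ ^ q := by positivity
          have h3 : (0 : ℝ) ≤ 2 ^ q := by positivity
          nlinarith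
  · calc (1 + ‖x‖) ^ q ≤ (2 * ‖x‖) ^ q := by
          apply Real.rpow_le_rpow (by positivity) (by linarith) hq0
      _ = 2 ^ q * ‖x‖ ^ q := Real.mul_rpow (by norm_num) hx
      _ ≤ 2 ^ q * (1 + ‖x‖ ^ q) := by
          gcongr; linarith

/-- The class `L_s ∩ Ḣ^s_loc` is stable under composition with Lipschitz functions. -/
lemma FracLocal.comp {w : E n → ℝ} (hw : FracLocal s w) (hs0 : 0 < s) {θ : ℝ → ℝ}
    (hθ : Measurable θ) {L : ℝ} (hL : ∀ x y, |θ x - θ y| ≤ L * |x - y|) :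
    FracLocal s (fun x => θ (w x)) := by
  have hL0 : 0 ≤ L := by
    have := (abs_nonneg _).trans (hL 1 0); simpa using this
  have hm : Measurable fun x => θ (w x) := hθ.comp hw.measurable
  refine ⟨hm, ?_, fun ρ => ?_⟩
  · refine (((integrable_weight_one (n := n) hs0).const_mul |θ 0|).add
      (hw.integrable_weight.const_mul L)).mono'
      ((continuous_abs.measurable.comp hm).div (by fun_prop)).aestronglyMeasurable
      (Eventually.of_forall fun x => ?_)
    have hwp := weight_pos x ((n : ℝ) + 2 * s)
    have h1 := hL (w x) 0
    rw [sub_zero] at h1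
    have h2 : |θ (w x)| ≤ |θ 0| + L * |w x| := by
      have := abs_sub_abs_le_abs_sub (θ (w x)) (θ 0); linarith
    simp only [Pi.add_apply]
    rw [Real.norm_eq_abs, abs_of_nonneg (by positivity), mul_one_div, ← mul_div_assoc, ← add_div]
    gcongr
  · refine ((hw.energy ρ).const_mul (L ^ 2)).mono'
      ((measurable_incr hm).pow_const 2).aestronglyMeasurable (Eventually.of_forall fun p => ?_)
    rw [Real.norm_eq_abs, abs_pow, sq_abs, ← sq_abs (incr w p), ← mul_pow, ← sq_abs]
    exact pow_le_pow_left₀ (abs_nonneg _) (hL _ _) 2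

section Product

variable {w φ : E n → ℝ} {B ρ L₁ L₂ : ℝ} {θ : ℝ → ℝ} {D L : ℝ}

lemma BddComp.comp_mul (hφ : BddComp φ B ρ) (hw : Measurable w) (hθ : Measurable θ)
    (hD : ∀ t, |θ t| ≤ D) : BddComp (fun x => θ (w x) * φ x) (D * B) ρ := by
  refine ⟨(hθ.comp hw).mul hφ.measurable, fun x => ?_, fun x hx => by rw [hφ.supp x hx, mul_zero]⟩
  rw [abs_mul]
  exact mul_le_mul (hD _) (hφ.bound x) (abs_nonneg _) ((abs_nonneg _).trans (hD 0))

/-- The product of a bounded Lipschitz function of `w ∈ Ḣ^s_loc` with a smooth cutoff has finite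
energy. -/
lemma TestBound.integrable_incr_comp_mul (hφ : TestBound φ B ρ L₁ L₂) (hw : FracLocal s w)
    (hs0 : 0 < s) (hs1 : s < 1) (hn : 0 < n) (hθ : Measurable θ) (hD : ∀ t, |θ t| ≤ D)
    (hL : ∀ x y, |θ x - θ y| ≤ L * |x - y|) :
    Integrable (fun p => incr (fun x => θ (w x) * φ x) p ^ 2) ((levy n s).prod volume) := by
  have hψ := hφ.toBddComp.comp_mul hw.measurable hθ hD
  rw [integrable_iff_near_far 1]
  refine ⟨?_, integrable_far_incr_sq hs0 hn one_pos hψ⟩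
  have h1 := (integrable_indicator_iff (measurableSet_pair_ball (n := n) (ρ + 1))).2
    ((hw.comp hs0 hθ hL).energy (ρ + 1))
  have h2 := ((integrable_iff_near_far 1).1 h1).1
  have h3 := integrable_near_incr_sq (s := s) hs1 hn one_pos hφ.toBddComp hφ.incr_sq_le
  refine ((h2.const_mul (2 * B ^ 2)).add (h3.const_mul (2 * D ^ 2))).mono'
    ((measurable_incr hψ.measurable).pow_const 2).aestronglyMeasurable ?_
  filter_upwards [ae_nearLevy (n := n) (s := s) 1] with p hp
  have hsplit : incr (fun x => θ (w x) * φ x) p =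
      θ (w (p.2 + p.1)) * incr φ p + incr (fun x => θ (w x)) p * φ p.2 := by
    simp only [incr]; ring
  have hi : (incr (fun x => θ (w x)) p * φ p.2) ^ 2 ≤ B ^ 2 *
      Set.indicator {p : E n × E n | p.2 ∈ Metric.ball 0 (ρ + 1) ∧
        p.2 + p.1 ∈ Metric.ball 0 (ρ + 1)} (fun p => incr (fun x => θ (w x)) p ^ 2) p := by
    rcases le_or_gt ρ ‖p.2‖ with hx | hx
    · rw [hφ.supp _ hx]
      have : 0 ≤ Set.indicator {p : E n × E n | p.2 ∈ Metric.ball 0 (ρ + 1) ∧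
        p.2 + p.1 ∈ Metric.ball 0 (ρ + 1)} (fun p => incr (fun x => θ (w x)) p ^ 2) p :=
        Set.indicator_apply_nonneg fun _ => sq_nonneg _
      have h4 : 0 ≤ B ^ 2 := sq_nonneg B
      rw [mul_zero, zero_pow two_ne_zero]
      positivity
    · have hmem : p ∈ {p : E n × E n | p.2 ∈ Metric.ball 0 (ρ + 1) ∧
        p.2 + p.1 ∈ Metric.ball 0 (ρ + 1)} := by
        have hy : ‖p.2 + p.1‖ ≤ ‖p.2‖ + ‖p.1‖ := norm_add_le _ _
        simp only [Set.mem_ofPred_eq, mem_ball_zero_iff]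
        constructor <;> linarith
      rw [Set.indicator_of_mem hmem, mul_pow, mul_comm, ← sq_abs (φ p.2)]
      gcongr
      exact hφ.bound _
  have hj : (θ (w (p.2 + p.1)) * incr φ p) ^ 2 ≤ D ^ 2 * incr φ p ^ 2 := by
    rw [mul_pow, ← sq_abs (θ _)]
    gcongr
    exact hD _
  rw [hsplit, Real.norm_eq_abs, abs_pow, sq_abs]
  simp only [Pi.add_apply]
  nlinarith [sq_nonneg (θ (w (p.2 + p.1)) * incr φ p - incr (fun x => θ (w x)) p * φ p.2)]

end Product

section Cutoff

variable {η : E n → ℝ} {ρ₀ L₁ L₂ L₁' L₂' r α k N : ℝ} {v : E n → ℝ} {A : Set (E n)}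

/-- The first-order error of the energy estimate, an integral over increments shorter than `r`. -/
lemma integral_near_incr_sq_mul_le (hs1 : s < 1) (hn : 0 < n) (hr : 0 < r) (hα : 0 < α)
    (hη : TestBound η 1 ρ₀ L₁ L₂) (hL₁ : 0 ≤ L₁) (hv : Measurable v) (hA : MeasurableSet A)
    (hsub : ∀ x z : E n, ‖z‖ < r → η x ≠ 0 → x + z ∈ A)
    (hint : IntegrableOn (fun x => Real.exp (2 * α * v x)) A volume)
    (hN : ∫ z, ‖z‖ ^ 2 ∂(nearLevy n s r) ≤ N) :
    Integrable (fun p : E n × E n => incr η p ^ 2 *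
        (truncExp (2 * α) k (v (p.2 + p.1)) + truncExp (2 * α) k (v p.2)))
      ((nearLevy n s r).prod volume) ∧
    ∫ p : E n × E n, incr η p ^ 2 *
        (truncExp (2 * α) k (v (p.2 + p.1)) + truncExp (2 * α) k (v p.2))
      ∂((nearLevy n s r).prod volume) ≤
      2 * L₁ * N * ∫ x in A, Real.exp (2 * α * v x) := by
  set e : E n → ℝ := A.indicator (fun x => Real.exp (2 * α * v x)) with he
  have hei : Integrable e volume := (integrable_indicator_iff hA).2 hint
  have hem : ∫ x, e x = ∫ x in A, Real.exp (2 * α * v x) := integral_indicator hA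
  have he0 : ∀ x, 0 ≤ e x := fun x => Set.indicator_apply_nonneg fun _ => (Real.exp_pos _).le
  have hge : ∀ x ∈ A, truncExp (2 * α) k (v x) ≤ e x := fun x hx => by
    rw [he, Set.indicator_of_mem hx]; exact truncExp_le' (by positivity) k (v x)
  have i1 := integrable_near_mul (s := s) hs1 hn hr hei
  have i2 := (measurePreserving_shift (κ := nearLevy n s r)).integrable_comp_of_integrable i1
  have i3 := (i2.add i1).const_mul L₁
  have hpt : ∀ᵐ p : E n × E n ∂((nearLevy n s r).prod volume), incr η p ^ 2 *
      (truncExp (2 * α) k (v (p.2 + p.1)) + truncExp (2 * α) k (v p.2)) ≤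
      L₁ * (‖p.1‖ ^ 2 * e (p.2 + p.1) + ‖p.1‖ ^ 2 * e p.2) := by
    filter_upwards [ae_nearLevy (n := n) (s := s) r] with p hp
    by_cases hz : incr η p = 0
    · rw [hz, zero_pow two_ne_zero, zero_mul]
      have := he0 (p.2 + p.1)
      have := he0 p.2
      positivity
    · have hmem : p.2 ∈ A ∧ p.2 + p.1 ∈ A := by
        by_cases hx : η p.2 = 0
        · have hy : η (p.2 + p.1) ≠ 0 := fun hy => hz (by rw [incr, hx, hy, sub_zero])
          have h1 := hsub _ (-p.1) (by simpa using hp) hy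
          have h2 := hsub _ 0 (by simpa using hr) hy
          exact ⟨by simpa using h1, by simpa using h2⟩
        · have h2 := hsub _ 0 (by simpa using hr) hx
          exact ⟨by simpa using h2, hsub _ _ hp hx⟩
      have h1 := hge _ hmem.1
      have h2 := hge _ hmem.2
      calc _ ≤ L₁ * ‖p.1‖ ^ 2 * (e (p.2 + p.1) + e p.2) := by
            have := hη.incr_sq_le p
            have := (truncExp_pos (2 * α) k (v (p.2 + p.1))).le
            have := (truncExp_pos (2 * α) k (v p.2)).le
            gcongr
        _ = _ := by ring
  have hnn : ∀ p : E n × E n, 0 ≤ incr η p ^ 2 *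
      (truncExp (2 * α) k (v (p.2 + p.1)) + truncExp (2 * α) k (v p.2)) := fun p =>
    mul_nonneg (sq_nonneg _) (add_nonneg (truncExp_pos _ _ _).le (truncExp_pos _ _ _).le)
  have hmeas : Measurable (fun p : E n × E n => incr η p ^ 2 *
      (truncExp (2 * α) k (v (p.2 + p.1)) + truncExp (2 * α) k (v p.2))) := by
    have h1 := measurable_incr hη.measurable
    have h2 := measurable_truncExp (2 * α) k
    fun_prop
  have hI : Integrable (fun p : E n × E n => incr η p ^ 2 *
        (truncExp (2 * α) k (v (p.2 + p.1)) + truncExp (2 * α) k (v p.2)))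
      ((nearLevy n s r).prod volume) := by
    refine i3.mono' hmeas.aestronglyMeasurable ?_
    filter_upwards [hpt] with p hp
    rw [Real.norm_eq_abs, abs_of_nonneg (hnn p)]
    exact hp
  refine ⟨hI, ?_⟩
  have e1 : ∫ p : E n × E n, ‖p.1‖ ^ 2 * e p.2 ∂((nearLevy n s r).prod volume) =
      (∫ z, ‖z‖ ^ 2 ∂(nearLevy n s r)) * ∫ x, e x :=
    integral_prod_mul (fun z : E n => ‖z‖ ^ 2) e
  have e2 : ∫ p : E n × E n, ‖p.1‖ ^ 2 * e (p.2 + p.1) ∂((nearLevy n s r).prod volume) =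
      ∫ p : E n × E n, ‖p.1‖ ^ 2 * e p.2 ∂((nearLevy n s r).prod volume) := by
    have hs := integral_pairSwap (measurePreserving_neg_nearLevy (n := n) (s := s) r)
      (fun p => ‖p.1‖ ^ 2 * e p.2)
    simpa using hs
  calc _ ≤ ∫ p : E n × E n, L₁ * (‖p.1‖ ^ 2 * e (p.2 + p.1) + ‖p.1‖ ^ 2 * e p.2)
        ∂((nearLevy n s r).prod volume) := integral_mono_ae hI i3 hpt
    _ = L₁ * (2 * ((∫ z, ‖z‖ ^ 2 ∂(nearLevy n s r)) * ∫ x, e x)) := by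
        have := integral_add' (μ := (nearLevy n s r).prod volume) i2 i1
        rw [integral_const_mul, show (∫ p : E n × E n, (‖p.1‖ ^ 2 * e (p.2 + p.1) +
          ‖p.1‖ ^ 2 * e p.2) ∂((nearLevy n s r).prod volume)) = _ from this]
        simp only [Function.comp_def]
        rw [e2, e1]
        ring
    _ ≤ L₁ * (2 * (N * ∫ x, e x)) := by
        have he1 : 0 ≤ ∫ x, e x := integral_nonneg he0
        gcongr
    _ = _ := by rw [hem]; ring

/-- The second-order error of the energy estimate: summation by parts puts both differences on the
smooth cutoff. -/
lemma FracLocal.neg_integral_near_prim_le (hv : FracLocal s v) (hs0 : 0 < s) (hs1 : s < 1)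
    (hn : 0 < n) (hr : 0 < r) (hα : 0 < α)
    (hη : TestBound (fun x => η x ^ 2) 1 ρ₀ L₁' L₂') (hL₂ : 0 ≤ L₂') (hA : MeasurableSet A)
    (hsub : ∀ x z : E n, ‖z‖ < r → η x ≠ 0 → x + z ∈ A)
    (hint : IntegrableOn (fun x => Real.exp (2 * α * v x)) A volume)
    (hN : ∫ z, ‖z‖ ^ 2 ∂(nearLevy n s r) ≤ N) :
    -∫ p, incr (fun x => truncPrim (2 * α) k (v x)) p * incr (fun x => η x ^ 2) p
      ∂((nearLevy n s r).prod volume) ≤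
      L₂' * N * ((∫ x in A, Real.exp (2 * α * v x)) / (2 * α)) := by
  have hc : 0 < 2 * α := by positivity
  have hG : FracLocal s (fun x => truncPrim (2 * α) k (v x)) :=
    hv.comp hs0 (measurable_truncPrim _ _) (abs_truncPrim_sub_le hc k)
  set e : E n → ℝ := A.indicator (fun x => Real.exp (2 * α * v x)) with he
  have hei : Integrable e volume := (integrable_indicator_iff hA).2 hint
  have hem : ∫ x, e x = ∫ x in A, Real.exp (2 * α * v x) := integral_indicator hA
  have he0 : ∀ x, 0 ≤ e x := fun x => Set.indicator_apply_nonneg fun _ => (Real.exp_pos _).le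
  rw [nearLevy, hG.integral_incr_eq hs0 hs1 hn hη measurableSet_ball (by simp), neg_neg,
    ← nearLevy]
  have i1 := (integrable_near_mul (s := s) hs1 hn hr hei).const_mul (L₂' / (2 * α))
  have i2 := hG.integrable_near_secondDiff hs0 hs1 hn hr hη
  calc _ ≤ ∫ p : E n × E n, L₂' / (2 * α) * (‖p.1‖ ^ 2 * e p.2)
        ∂((nearLevy n s r).prod volume) := by
        refine integral_mono_ae i2 i1 ?_
        filter_upwards [ae_nearLevy (n := n) (s := s) r] with p hp
        by_cases hx : p.2 ∈ A
        · rw [he, Set.indicator_of_mem hx]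
          have h1 := truncPrim_le hc k (v p.2)
          have h2 := truncPrim_nonneg hc k (v p.2)
          have h3 := (le_abs_self _).trans (hη.secondDiff_le p)
          calc truncPrim (2 * α) k (v p.2) * secondDiff (fun x => η x ^ 2) p
              ≤ truncPrim (2 * α) k (v p.2) * (L₂' * ‖p.1‖ ^ 2) := by gcongr
            _ ≤ Real.exp (2 * α * v p.2) / (2 * α) * (L₂' * ‖p.1‖ ^ 2) := by gcongr
            _ = _ := by ring
        · have h0 : ∀ z : E n, ‖z‖ < r → η (p.2 + z) = 0 := by
            intro z hz
            by_contra hne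
            exact hx (by simpa using hsub _ (-z) (by simpa using hz) hne)
          have h1 := h0 p.1 hp
          have h2 := h0 (-p.1) (by simpa using hp)
          have h3 := h0 0 (by simpa using hr)
          rw [← sub_eq_add_neg] at h2
          rw [add_zero] at h3
          have : secondDiff (fun x => η x ^ 2) p = 0 := by
            simp only [secondDiff, h1, h2, h3]; norm_num
          rw [this, mul_zero]
          have := he0 p.2
          positivity
    _ = L₂' / (2 * α) * ((∫ z, ‖z‖ ^ 2 ∂(nearLevy n s r)) * ∫ x, e x) := by
        rw [integral_const_mul]
        congr 1
        exact integral_prod_mul (fun z : E n => ‖z‖ ^ 2) e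
    _ ≤ L₂' / (2 * α) * (N * ∫ x, e x) := by
        have he1 : 0 ≤ ∫ x, e x := integral_nonneg he0
        gcongr
    _ = _ := by rw [hem]; ring

end Cutoff

end HenonGelfand

/-! ### Long jumps and the energy estimate -/

namespace HenonGelfand

variable {n : ℕ} {s a : ℝ}

section Cutoff

variable {η : E n → ℝ} {ρ₀ L₁ L₂ L₁' L₂' r α k N T τ : ℝ} {u v : E n → ℝ} {A : Set (E n)}

lemma truncExp_mul_sq_le (hα : 0 < α) (hη0 : ∀ x, 0 ≤ η x) (hη1 : ∀ x, η x ≤ 1)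
    (hsub : ∀ x, η x ≠ 0 → x ∈ A) (x : E n) :
    truncExp (2 * α) k (v x) * η x ^ 2 ≤ A.indicator (fun x => Real.exp (2 * α * v x)) x := by
  by_cases hx : η x = 0
  · rw [hx, zero_pow two_ne_zero, mul_zero]
    exact Set.indicator_apply_nonneg fun _ => (Real.exp_pos _).le
  · rw [Set.indicator_of_mem (hsub x hx)]
    have h1 : η x ^ 2 ≤ 1 := pow_le_one₀ (hη0 x) (hη1 x)
    have h2 := truncExp_le' (c := 2 * α) (by positivity) k (v x)
    have h3 := truncExp_pos (2 * α) k (v x)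
    nlinarith

lemma neg_mul_truncExp_le (hα : 0 < α) (hk : 0 ≤ k) (t : ℝ) :
    max (-t) 0 * truncExp (2 * α) k t ≤ 1 / (2 * α) := by
  rcases le_total 0 t with ht | ht
  · rw [max_eq_right (by linarith), zero_mul]; positivity
  · rw [max_eq_left (by linarith), truncExp, min_eq_left (ht.trans hk), le_div_iff₀ (by positivity)]
    have h1 := Real.add_one_le_exp (-(2 * α * t))
    have h2 : Real.exp (-(2 * α * t)) * Real.exp (2 * α * t) = 1 := by
      rw [← Real.exp_add]; simp
    nlinarith [Real.exp_pos (2 * α * t)]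

/-- The contribution of long jumps to the equation is bounded below in terms of the positive part of
`v` far away and the negative part of `v` in the support of the test function. -/
lemma FracLocal.neg_integral_far_le (hv : FracLocal s v) (hs0 : 0 < s) (hn : 0 < n)
    (hr : 0 < r) (hα : 0 < α) (hk : 0 ≤ k) {Bψ : ℝ}
    (hψ : BddComp (fun x => truncExp (2 * α) k (v x) * η x ^ 2) Bψ ρ₀)
    (hη0 : ∀ x, 0 ≤ η x) (hη1 : ∀ x, η x ≤ 1) (hA : MeasurableSet A) (hAv : volume A ≠ ⊤)
    (hsub : ∀ x, η x ≠ 0 → x ∈ A)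
    (hint : IntegrableOn (fun x => Real.exp (2 * α * v x)) A volume)
    (hT : (farLevy n s r).real Set.univ ≤ T) (hτ0 : 0 ≤ τ)
    (hτ : ∀ x, η x ≠ 0 → ∫⁻ z, ENNReal.ofReal (v (x + z)) ∂(farLevy n s r) ≤ ENNReal.ofReal τ) :
    -∫ p, incr v p * incr (fun x => truncExp (2 * α) k (v x) * η x ^ 2) p
      ∂((farLevy n s r).prod volume) ≤
      2 * (τ * (∫ x in A, Real.exp (2 * α * v x)) + T * (volume.real A / (2 * α))) := by
  have hfinm := isFiniteMeasure_farLevy (n := n) hs0 hn hr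
  set ψ : E n → ℝ := fun x => truncExp (2 * α) k (v x) * η x ^ 2 with hψdef
  have hψ0 : ∀ x, 0 ≤ ψ x := fun x => mul_nonneg (truncExp_pos _ _ _).le (sq_nonneg _)
  set e : E n → ℝ := A.indicator (fun x => Real.exp (2 * α * v x)) with he
  have hei : Integrable e volume := (integrable_indicator_iff hA).2 hint
  have hem : ∫ x, e x = ∫ x in A, Real.exp (2 * α * v x) := integral_indicator hA
  have hψe : ∀ x, ψ x ≤ e x := truncExp_mul_sq_le hα hη0 hη1 hsub
  have hψz : ∀ x, η x = 0 → ψ x = 0 := fun x hx => by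
    simp only [hψdef, hx]; norm_num
  have hp : FracLocal s (fun x => max (v x) 0) :=
    hv.comp hs0 (measurable_id.max measurable_const) (L := 1) fun x y => by
      rw [one_mul]; exact abs_max_sub_max_le_abs x y 0
  have hm : FracLocal s (fun x => max (-v x) 0) :=
    hv.comp hs0 (θ := fun t => max (-t) 0) (measurable_neg.max measurable_const) (L := 1)
      fun x y => by
        rw [one_mul]
        refine (abs_max_sub_max_le_abs (-x) (-y) 0).trans (le_of_eq ?_)
        rw [← abs_neg]; ring_nf
  have i1 := hp.integrable_far_cross' hs0 hn hr hψ
  have i2 := hm.integrable_far_self hs0 hn hr hψ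
  have j0 : Integrable (fun p => incr v p * ψ p.2) ((farLevy n s r).prod volume) := by
    refine ((hv.integrable_far_cross' hs0 hn hr hψ).sub
      (hv.integrable_far_self hs0 hn hr hψ)).congr (Eventually.of_forall fun p => ?_)
    simp only [incr, Pi.sub_apply]; ring
  have j1 : Integrable (fun p => incr v p * ψ (p.2 + p.1)) ((farLevy n s r).prod volume) := by
    refine ((hv.integrable_far_self' hs0 hn hr hψ).sub
      (hv.integrable_far_cross hs0 hn hr hψ)).congr (Eventually.of_forall fun p => ?_)
    simp only [incr, Pi.sub_apply]; ring
  have hsw : ∫ p, incr v p * ψ (p.2 + p.1) ∂((farLevy n s r).prod volume) =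
      -∫ p, incr v p * ψ p.2 ∂((farLevy n s r).prod volume) := by
    rw [← integral_pairSwap (measurePreserving_neg_farLevy (n := n) (s := s) r)
      (fun p => incr v p * ψ p.2), ← integral_neg]
    refine integral_congr_ae (Eventually.of_forall fun p => ?_)
    simp only [incr, add_neg_cancel_right]
    ring
  have hX : -∫ p, incr v p * incr ψ p ∂((farLevy n s r).prod volume) =
      2 * ∫ p, incr v p * ψ p.2 ∂((farLevy n s r).prod volume) := by
    have : ∫ p, incr v p * incr ψ p ∂((farLevy n s r).prod volume) =
        ∫ p, incr v p * ψ (p.2 + p.1) ∂((farLevy n s r).prod volume) -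
        ∫ p, incr v p * ψ p.2 ∂((farLevy n s r).prod volume) := by
      rw [← integral_sub j1 j0]
      refine integral_congr_ae (Eventually.of_forall fun p => ?_)
      simp only [incr]
      ring
    rw [this, hsw]; ring
  have hI1 : ∫ p : E n × E n, max (v (p.2 + p.1)) 0 * ψ p.2 ∂((farLevy n s r).prod volume) ≤
      τ * ∫ x, e x := by
    rw [integral_prod_symm _ i1, ← integral_const_mul]
    refine integral_mono_ae i1.integral_prod_right (hei.const_mul τ)
      (Eventually.of_forall fun x => ?_)
    simp only
    rw [integral_mul_const]
    by_cases hx : η x = 0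
    · rw [hψz x hx, mul_zero]
      exact mul_nonneg hτ0 ((hψ0 x).trans (hψe x))
    · have hin : ∫ z, max (v (x + z)) 0 ∂(farLevy n s r) ≤ τ := by
        have hmz : Measurable fun z => max (v (x + z)) 0 :=
          (hv.measurable.comp (measurable_const_add x)).max measurable_const
        rw [integral_eq_lintegral_of_nonneg_ae (f := fun z => max (v (x + z)) 0)
          (Eventually.of_forall fun z => le_max_right _ _)
          hmz.aestronglyMeasurable]
        refine ENNReal.toReal_le_of_le_ofReal hτ0 (le_trans (le_of_eq ?_) (hτ x hx))
        refine lintegral_congr fun z => ?_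
        rcases le_total (v (x + z)) 0 with h | h
        · rw [max_eq_right h, ENNReal.ofReal_of_nonpos h, ENNReal.ofReal_zero]
        · rw [max_eq_left h]
      exact mul_le_mul hin (hψe x) (hψ0 x) hτ0
  have hI2 : ∫ p : E n × E n, max (-v p.2) 0 * ψ p.2 ∂((farLevy n s r).prod volume) ≤
      T * (volume.real A / (2 * α)) := by
    have hint1 : Integrable (A.indicator fun _ => 1 / (2 * α)) (volume : Measure (E n)) :=
      (integrable_indicator_iff hA).2 (integrableOn_const hAv)
    have hle : ∫ x, max (-v x) 0 * ψ x ≤ volume.real A / (2 * α) := by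
      calc ∫ x, max (-v x) 0 * ψ x ≤ ∫ x, A.indicator (fun _ => 1 / (2 * α)) x := by
            refine integral_mono (hm.integrable_mul hs0 hψ) hint1 fun x => ?_
            by_cases hx : η x = 0
            · rw [hψz x hx, mul_zero]
              exact Set.indicator_apply_nonneg fun _ => by positivity
            · rw [Set.indicator_of_mem (hsub x hx)]
              have h1 := neg_mul_truncExp_le hα hk (v x)
              have h2 : η x ^ 2 ≤ 1 := pow_le_one₀ (hη0 x) (hη1 x)
              have h3 : 0 ≤ max (-v x) 0 * truncExp (2 * α) k (v x) :=
                mul_nonneg (le_max_right _ _) (truncExp_pos _ _ _).le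
              calc max (-v x) 0 * ψ x =
                  max (-v x) 0 * truncExp (2 * α) k (v x) * η x ^ 2 := by
                    simp only [hψdef]; ring
                _ ≤ max (-v x) 0 * truncExp (2 * α) k (v x) * 1 := by gcongr
                _ ≤ _ := by rw [mul_one]; exact h1
        _ = volume.real A / (2 * α) := by
            rw [integral_indicator hA, setIntegral_const, smul_eq_mul, mul_one_div]
    have hnn : 0 ≤ ∫ x, max (-v x) 0 * ψ x :=
      integral_nonneg fun x => mul_nonneg (le_max_right _ _) (hψ0 x)
    have := integral_prod_mul (μ := farLevy n s r) (ν := (volume : Measure (E n)))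
      (fun _ => (1 : ℝ)) (fun x => max (-v x) 0 * ψ x)
    simp only [one_mul, integral_const, smul_eq_mul, mul_one] at this
    rw [this]
    exact mul_le_mul hT hle hnn (measureReal_nonneg.trans hT)
  have hle : ∫ p, incr v p * ψ p.2 ∂((farLevy n s r).prod volume) ≤
      τ * (∫ x, e x) + T * (volume.real A / (2 * α)) := by
    calc _ ≤ ∫ p : E n × E n, (max (v (p.2 + p.1)) 0 * ψ p.2 + max (-v p.2) 0 * ψ p.2)
          ∂((farLevy n s r).prod volume) := by
          refine integral_mono j0 (i1.add i2) fun p => ?_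
          simp only [incr]
          rw [← add_mul]
          refine mul_le_mul_of_nonneg_right ?_ (hψ0 _)
          have h1 := le_max_left (v (p.2 + p.1)) 0
          have h2 := le_max_left (-v p.2) 0
          linarith
      _ = _ := integral_add i1 i2
      _ ≤ _ := add_le_add hI1 hI2
  rw [hX, ← hem]
  linarith

/-- Long jumps contribute little to the energy of a function with small mass. -/
lemma BddComp.integral_far_incr_sq_le {ξ : E n → ℝ} {B : ℝ} (hξ : BddComp ξ B ρ₀) (hs0 : 0 < s)
    (hn : 0 < n) (hr : 0 < r) (hT : (farLevy n s r).real Set.univ ≤ T) :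
    ∫ p, incr ξ p ^ 2 ∂((farLevy n s r).prod volume) ≤ 4 * T * ∫ x, ξ x ^ 2 := by
  have hfinm := isFiniteMeasure_farLevy (n := n) hs0 hn hr
  have h1 := hξ.integrable_sq.comp_snd (farLevy n s r)
  have h2 := (measurePreserving_pairSwap
    (measurePreserving_neg_farLevy (n := n) (s := s) r)).integrable_comp_of_integrable h1
  have e2 := integral_pairSwap (measurePreserving_neg_farLevy (n := n) (s := s) r)
    (fun p => ξ p.2 ^ 2)
  have e1 := integral_prod_mul (μ := farLevy n s r) (ν := (volume : Measure (E n)))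
      (fun _ => (1 : ℝ)) (fun x => ξ x ^ 2)
  simp only [one_mul, integral_const, smul_eq_mul, mul_one] at e1
  have hnn : 0 ≤ ∫ x, ξ x ^ 2 := integral_nonneg fun x => sq_nonneg _
  calc _ ≤ ∫ p : E n × E n, 2 * (ξ (p.2 + p.1) ^ 2 + ξ p.2 ^ 2)
        ∂((farLevy n s r).prod volume) := by
        refine integral_mono (integrable_far_incr_sq hs0 hn hr hξ) ((h2.add h1).const_mul 2)
          fun p => ?_
        simp only [incr]
        nlinarith [sq_nonneg (ξ (p.2 + p.1) + ξ p.2)]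
    _ = 2 * ((farLevy n s r).real Set.univ * (∫ x, ξ x ^ 2) +
          (farLevy n s r).real Set.univ * ∫ x, ξ x ^ 2) := by
        rw [integral_const_mul]
        congr 1
        refine (integral_add h2 h1).trans ?_
        rw [← e1]
        congr 1
    _ ≤ 2 * (T * (∫ x, ξ x ^ 2) + T * ∫ x, ξ x ^ 2) := by gcongr
    _ = _ := by ring

/-- The algebra of the energy estimate. The equation gives `c/2 X ≤ I` and stability gives
`I ≤ c/2 H`, while the pointwise inequality bounds `X` below by `4 / (2 + α) H` up to errors. As
`4 / (2 + α) > 1`, the integral `I` is absorbed and the errors bound it. -/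
lemma energy_absorption {c I H Hn Hf X Xn Xf G Q S V : ℝ} (hα0 : 0 < α) (hα2 : α < 2) (hc : 0 < c)
    (hS0 : 0 ≤ S) (hV0 : 0 ≤ V) (hN0 : 0 ≤ N) (hT0 : 0 ≤ T) (hτ0 : 0 ≤ τ) (hL₁ : 0 ≤ L₁)
    (hL₂ : 0 ≤ L₂') (eq1 : c / 2 * X ≤ I) (eq2 : I ≤ c / 2 * H) (hX : X = Xn + Xf)
    (hH : H = Hn + Hf) (hnear : G + 4 / (2 + α) * Hn - 4 / (2 - α) * Q ≤ Xn)
    (hG : -G ≤ L₂' * N * (S / (2 * α))) (hQ : Q ≤ 2 * L₁ * N * S)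
    (hfarX : -Xf ≤ 2 * (τ * S + T * (V / (2 * α)))) (hHf : Hf ≤ 4 * T * S) :
    I ≤ (2 + α) / (2 - α) * (c / 2) * (1 / α + 8 / (2 - α) + 8 + 2) *
      ((L₁ + L₂') * N + T + τ) * (S + V) := by
  have h2α : 0 < 2 - α := by linarith
  have hβ : 4 / (2 + α) ≤ 2 := by rw [div_le_iff₀ (by positivity)]; linarith
  have hβ0 : 0 < 4 / (2 + α) := by positivity
  have hHI : 2 / c * I ≤ H := by
    rw [div_mul_eq_mul_div, div_le_iff₀ hc]; linarith
  have hXI : X ≤ 2 / c * I := by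
    rw [div_mul_eq_mul_div, le_div_iff₀ hc]; linarith
  have hbHf : 4 / (2 + α) * Hf ≤ 8 * T * S := by
    calc 4 / (2 + α) * Hf ≤ 4 / (2 + α) * (4 * T * S) := by gcongr
      _ ≤ 2 * (4 * T * S) := by gcongr
      _ = _ := by ring
  have hmain : 4 / (2 + α) * (2 / c * I) ≤ 2 / c * I + (L₂' * N * (S / (2 * α)) +
      4 / (2 - α) * (2 * L₁ * N * S) + 8 * T * S + 2 * (τ * S + T * (V / (2 * α)))) := by
    have h1 : 4 / (2 + α) * (2 / c * I) ≤ 4 / (2 + α) * (Hn + Hf) := by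
      rw [← hH]; gcongr
    have h2 := mul_le_mul_of_nonneg_left hQ (show (0 : ℝ) ≤ 4 / (2 - α) by positivity)
    have h3 : Xn = X - Xf := by rw [hX]; ring
    have h4 : 4 / (2 + α) * (Hn + Hf) = 4 / (2 + α) * Hn + 4 / (2 + α) * Hf := by ring
    linarith
  set W := (L₁ + L₂') * N + T + τ with hWdef
  have herr : L₂' * N * (S / (2 * α)) + 4 / (2 - α) * (2 * L₁ * N * S) + 8 * T * S +
      2 * (τ * S + T * (V / (2 * α))) ≤
      (1 / α + 8 / (2 - α) + 8 + 2) * (W * (S + V)) := by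
    have hLN₁ : 0 ≤ L₁ * N := by positivity
    have hLN₂ : 0 ≤ L₂' * N := by positivity
    have hW : W = L₁ * N + L₂' * N + T + τ := by simp only [W]; ring
    have hW0 : 0 ≤ W := by rw [hW]; positivity
    have hWS : W * S ≤ W * (S + V) := by gcongr; linarith
    have hWV : W * S + W * V = W * (S + V) := by ring
    have w1 : L₁ * N * S ≤ W * S := by gcongr; linarith
    have w2 : L₂' * N * S ≤ W * S := by gcongr; linarith
    have w3 : T * S ≤ W * S := by gcongr; linarith
    have w4 : T * V ≤ W * V := by gcongr; linarith
    have w5 : τ * S ≤ W * S := by gcongr; linarith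
    have t1 : L₂' * N * (S / (2 * α)) + 2 * (T * (V / (2 * α))) ≤ 1 / α * (W * (S + V)) := by
      have h1 : L₂' * N * (S / (2 * α)) + 2 * (T * (V / (2 * α))) =
          1 / α * (L₂' * N * S / 2 + T * V) := by field_simp
      have h2 : 0 ≤ L₂' * N * S := by positivity
      rw [h1]
      gcongr
      linarith
    have t2 : 4 / (2 - α) * (2 * L₁ * N * S) ≤ 8 / (2 - α) * (W * (S + V)) := by
      have h1 : 4 / (2 - α) * (2 * L₁ * N * S) = 8 / (2 - α) * (L₁ * N * S) := by ring
      rw [h1]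
      exact mul_le_mul_of_nonneg_left (w1.trans hWS) (by positivity)
    have t3 : 8 * T * S ≤ 8 * (W * (S + V)) := by linarith
    have t4 : 2 * (τ * S) ≤ 2 * (W * (S + V)) := by linarith
    calc _ = (L₂' * N * (S / (2 * α)) + 2 * (T * (V / (2 * α)))) +
          4 / (2 - α) * (2 * L₁ * N * S) + 8 * T * S + 2 * (τ * S) := by ring
      _ ≤ _ := by linarith
  have hfin : (2 - α) / (2 + α) * (2 / c * I) ≤ (1 / α + 8 / (2 - α) + 8 + 2) * (W * (S + V)) := by
    have : (2 - α) / (2 + α) = 4 / (2 + α) - 1 := by field_simp; ring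
    rw [this, sub_mul]
    linarith
  calc I = (2 + α) / (2 - α) * (c / 2) * ((2 - α) / (2 + α) * (2 / c * I)) := by
        field_simp
    _ ≤ (2 + α) / (2 - α) * (c / 2) * ((1 / α + 8 / (2 - α) + 8 + 2) * (W * (S + V))) := by
        gcongr
    _ = _ := by ring

/-- The energy estimate at a single scale. The exponential `exp (2 α v)` of the shifted solution
`v = u + m`, integrated over a neighbourhood `A` of the support of a cutoff `η`, controls
`|x|^a e^u exp (2 α v)` on the set where `η = 1`; the truncation level `k` does not enter the
constant. -/
theorem energy_estimate (hs0 : 0 < s) (hs1 : s < 1) (hn : 0 < n) (hα0 : 0 < α) (hα2 : α < 2) :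
    ∃ C : ℝ, 0 ≤ C ∧ ∀ (u : E n → ℝ), IsSolution s a u → FracLocal s u → ∀ (R R₁ : ℝ), R < R₁ →
      IsStableIn s a u (Metric.closedBall 0 R)ᶜ →
      ∀ (m : ℝ) (η : E n → ℝ) (ρ₀ L₁ L₂ L₁' L₂' r N T τ k : ℝ) (A : Set (E n)),
      TestBound η 1 ρ₀ L₁ L₂ → TestBound (fun x => η x ^ 2) 1 ρ₀ L₁' L₂' → 0 ≤ L₁ → 0 ≤ L₂' →
      (∀ x, 0 ≤ η x) → (∀ x, ‖x‖ < R₁ → η x = 0) → 0 < r → 0 ≤ k → 0 ≤ τ →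
      MeasurableSet A → volume A ≠ ⊤ → (∀ x z : E n, ‖z‖ < r → η x ≠ 0 → x + z ∈ A) →
      IntegrableOn (fun x => Real.exp (2 * α * (u x + m))) A volume →
      ∫ z, ‖z‖ ^ 2 ∂(nearLevy n s r) ≤ N → (farLevy n s r).real Set.univ ≤ T →
      (∀ x, η x ≠ 0 → ∫⁻ z, ENNReal.ofReal (u (x + z) + m) ∂(farLevy n s r) ≤
        ENNReal.ofReal τ) →
      ∫ x, henonExp a u x * (truncExp (2 * α) k (u x + m) * η x ^ 2) ≤
        C * ((L₁ + L₂') * N + T + τ) *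
          ((∫ x in A, Real.exp (2 * α * (u x + m))) + volume.real A) := by
  have hc := fracConst_pos (n := n) hs0 hs1 hn
  have h2α : 0 < 2 - α := by linarith
  refine ⟨(2 + α) / (2 - α) * (fracConst n s / 2) * (1 / α + 8 / (2 - α) + 8 + 2),
    by positivity, ?_⟩
  intro u hu hw R R₁ hR hstab m η ρ₀ L₁ L₂ L₁' L₂' r N T τ k A hη hη2 hL₁ hL₂ hη0 hηR hr hk hτ0 hA
    hAv hsub hint hN hT hτ
  have hcα : 0 < 2 * α := by positivity
  have hη1 : ∀ x, η x ≤ 1 := fun x => (le_abs_self _).trans (hη.bound x)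
  have hsub' : ∀ x, η x ≠ 0 → x ∈ A := fun x hx => by
    simpa using hsub x 0 (by simpa using hr) hx
  have hv : FracLocal s (fun x => u x + m) :=
    hw.comp hs0 (θ := fun t => t + m) (by fun_prop) (L := 1) fun x y => by simp
  set v : E n → ℝ := fun x => u x + m with hvdef
  have hincr : ∀ p, incr u p = incr v p := fun p => by simp only [incr, hvdef]; ring
  set f := henonExp a u
  set ψ : E n → ℝ := fun x => truncExp (2 * α) k (v x) * η x ^ 2 with hψdef
  set ξ : E n → ℝ := fun x => truncExp α k (v x) * η x with hξdef
  have hξψ : ∀ x, ξ x ^ 2 = ψ x := fun x => by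
    simp only [hξdef, hψdef, truncExp_two_mul]; ring
  have habs : ∀ {c : ℝ}, 0 ≤ c → ∀ t, |truncExp c k t| ≤ Real.exp (c * k) := fun hc t => by
    rw [abs_of_pos (truncExp_pos _ _ _)]; exact truncExp_le hc k t
  have hψb : BddComp ψ (Real.exp (2 * α * k) * 1) ρ₀ :=
    hη2.toBddComp.comp_mul hv.measurable (measurable_truncExp _ k) (habs hcα.le)
  have hψE : Integrable (fun p => incr ψ p ^ 2) ((levy n s).prod volume) :=
    hη2.integrable_incr_comp_mul hv hs0 hs1 hn (measurable_truncExp _ k) (habs hcα.le)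
      (abs_truncExp_sub_le hcα k)
  have hξb : BddComp ξ (Real.exp (α * k) * 1) ρ₀ :=
    hη.toBddComp.comp_mul hv.measurable (measurable_truncExp _ k) (habs hα0.le)
  have hξE : Integrable (fun p => incr ξ p ^ 2) ((levy n s).prod volume) :=
    hη.integrable_incr_comp_mul hv hs0 hs1 hn (measurable_truncExp _ k) (habs hα0.le)
      (abs_truncExp_sub_le hα0 k)
  set I := ∫ x, f x * ψ x with hI
  set S := ∫ x in A, Real.exp (2 * α * v x) with hS
  have hS0 : 0 ≤ S := integral_nonneg fun x => (Real.exp_pos _).le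
  -- the equation tested with `ψ = ξ²`, and stability tested with `ξ`
  have eq1 := hu.form_le hw hs0 hs1 hn hψb hψE
  simp only [hincr] at eq1
  have eq2 := hstab.integral_le hn hs0 hs1 hR hw.measurable hu.locallyIntegrable hξb
    (fun x hx => by simp only [hξdef, hηR x hx, mul_zero]) hξE
  simp only [hξψ] at eq2
  have hform := hv.integrable_incr hs0 hn hψb hψE
  have hX := integral_near_add_far r hform
  have hH := integral_near_add_far r hξE
  have hfarX := hv.neg_integral_far_le hs0 hn hr hα0 hk hψb hη0 hη1 hA hAv hsub' hint hT hτ0 hτ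
  have hfarH := hξb.integral_far_incr_sq_le hs0 hn hr hT
  have hξS : ∫ x, ξ x ^ 2 ≤ S := by
    simp only [hξψ]
    rw [hS, ← integral_indicator hA]
    exact integral_mono hψb.integrable ((integrable_indicator_iff hA).2 hint)
      (truncExp_mul_sq_le hα0 hη0 hη1 hsub')
  have hG := hv.neg_integral_near_prim_le (k := k) hs0 hs1 hn hr hα0 hη2 hL₂ hA hsub hint hN
  obtain ⟨hQi, hQ⟩ := integral_near_incr_sq_mul_le (k := k) hs1 hn hr hα0 hη hL₁ hv.measurable hA
    hsub hint hN
  have hGF : FracLocal s (fun x => truncPrim (2 * α) k (v x)) :=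
    hv.comp hs0 (measurable_truncPrim _ _) (abs_truncPrim_sub_le hcα k)
  have hGi := ((integrable_iff_near_far r).1 (hGF.integrable_incr hs0 hn hη2.toBddComp
    (hη2.integrable_incr_sq hs0 hs1 hn))).1
  have hξEn := ((integrable_iff_near_far r).1 hξE).1
  have hXn := ((integrable_iff_near_far r).1 hform).1
  have hnear : (∫ p, incr (fun x => truncPrim (2 * α) k (v x)) p * incr (fun x => η x ^ 2) p
        ∂((nearLevy n s r).prod volume)) +
      4 / (2 + α) * (∫ p, incr ξ p ^ 2 ∂((nearLevy n s r).prod volume)) -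
      4 / (2 - α) * (∫ p : E n × E n, incr η p ^ 2 *
        (truncExp (2 * α) k (v (p.2 + p.1)) + truncExp (2 * α) k (v p.2))
        ∂((nearLevy n s r).prod volume)) ≤
      ∫ p, incr v p * incr ψ p ∂((nearLevy n s r).prod volume) := by
    rw [← integral_const_mul, ← integral_const_mul, ← integral_add' hGi (hξEn.const_mul _),
      ← integral_sub' (hGi.add (hξEn.const_mul _)) (hQi.const_mul _)]
    refine integral_mono ((hGi.add (hξEn.const_mul _)).sub (hQi.const_mul _)) hXn fun p => ?_
    exact caccioppoli_pointwise hα0 hα2 k (v (p.2 + p.1)) (v p.2) (hη0 _) (hη0 _)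
  set X := ∫ p, incr v p * incr ψ p ∂((levy n s).prod volume)
  set H := ∫ p, incr ξ p ^ 2 ∂((levy n s).prod volume)
  set Xn := ∫ p, incr v p * incr ψ p ∂((nearLevy n s r).prod volume)
  set Xf := ∫ p, incr v p * incr ψ p ∂((farLevy n s r).prod volume)
  set Hn := ∫ p, incr ξ p ^ 2 ∂((nearLevy n s r).prod volume)
  set Hf := ∫ p, incr ξ p ^ 2 ∂((farLevy n s r).prod volume)
  have hHf : Hf ≤ 4 * T * S := hfarH.trans (by
    have := measureReal_nonneg.trans hT
    gcongr)
  exact energy_absorption hα0 hα2 hc hS0 measureReal_nonneg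
    ((integral_nonneg fun z => by positivity).trans hN) (measureReal_nonneg.trans hT) hτ0 hL₁ hL₂
    eq1 eq2 hX hH hnear hG hQ hfarX hHf

end Cutoff

end HenonGelfand

/-! ### Dilated cutoffs and the mass of the nonlinearity in annuli -/

namespace HenonGelfand

variable {n : ℕ} {s a : ℝ}

lemma integral_sq_nearLevy_le (hs1 : s < 1) (hn : 0 < n) :
    ∃ C : ℝ, 0 ≤ C ∧ ∀ r : ℝ, 0 < r →
      ∫ z : E n, ‖z‖ ^ 2 ∂(nearLevy n s r) ≤ C * r ^ (2 - 2 * s) := by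
  obtain ⟨C, hC, h⟩ := lintegral_ball_sq_levy (n := n) hs1 hn
  refine ⟨C, hC, fun r hr => ?_⟩
  rw [integral_eq_lintegral_of_nonneg_ae (Eventually.of_forall fun z => by positivity)
    (by fun_prop)]
  exact ENNReal.toReal_le_of_le_ofReal (by positivity) (h r hr)

lemma farLevy_real_univ_le (hs0 : 0 < s) (hn : 0 < n) :
    ∃ C : ℝ, 0 ≤ C ∧ ∀ r : ℝ, 0 < r →
      (farLevy n s r).real Set.univ ≤ C * r ^ (-(2 * s)) := by
  obtain ⟨C, hC, h⟩ := levy_compl_ball (n := n) hs0 hn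
  refine ⟨C, hC, fun r hr => ?_⟩
  rw [Measure.real, farLevy, Measure.restrict_apply_univ]
  exact ENNReal.toReal_le_of_le_ofReal (by positivity) (h r hr)

lemma volume_real_ball (hn : 0 < n) {r : ℝ} (hr : 0 ≤ r) :
    volume.real (Metric.ball (0 : E n) r) =
      r ^ (n : ℝ) * volume.real (Metric.ball (0 : E n) 1) := by
  have := nontrivial_E hn
  rw [Measure.real, Measure.addHaar_ball _ _ hr, ENNReal.toReal_mul,
    ENNReal.toReal_ofReal (by positivity)]
  simp [Measure.real]

/-- The dilation `x ↦ φ (x / t)`. -/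
noncomputable def dilate (t : ℝ) (φ : E n → ℝ) (x : E n) : ℝ := φ (t⁻¹ • x)

lemma incr_dilate (t : ℝ) (φ : E n → ℝ) (p : E n × E n) :
    incr (dilate t φ) p = incr φ (t⁻¹ • p.1, t⁻¹ • p.2) := by
  simp only [incr, dilate, smul_add]

lemma secondDiff_dilate (t : ℝ) (φ : E n → ℝ) (p : E n × E n) :
    secondDiff (dilate t φ) p = secondDiff φ (t⁻¹ • p.1, t⁻¹ • p.2) := by
  simp only [secondDiff, dilate, smul_add, smul_sub]

lemma TestBound.dilate {φ : E n → ℝ} {B ρ L₁ L₂ : ℝ} (hφ : TestBound φ B ρ L₁ L₂) {t : ℝ}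
    (ht : 0 < t) : TestBound (dilate t φ) B (t * ρ) (L₁ / t ^ 2) (L₂ / t ^ 2) := by
  have hnorm : ∀ x : E n, ‖t⁻¹ • x‖ = ‖x‖ / t := fun x => by
    rw [norm_smul, norm_inv, Real.norm_eq_abs, abs_of_pos ht, inv_mul_eq_div]
  refine ⟨⟨hφ.measurable.comp (by fun_prop), fun x => hφ.bound _, fun x hx => hφ.supp _ ?_⟩,
    fun p => ?_, fun p => ?_⟩
  · rw [hnorm, le_div_iff₀ ht, mul_comm]; exact hx
  · rw [incr_dilate]
    refine (hφ.incr_sq_le _).trans (le_of_eq ?_)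
    simp only [hnorm]
    field_simp
  · rw [secondDiff_dilate]
    refine (hφ.secondDiff_le _).trans (le_of_eq ?_)
    simp only [hnorm]
    field_simp

/-- The energy of a cutoff dilated to scale `t` is at most of order `t ^ (n - 2 s)`. -/
lemma TestBound.energy_dilate_le {φ : E n → ℝ} {ρ L₁ L₂ : ℝ} (hφ : TestBound φ 1 ρ L₁ L₂)
    (hs0 : 0 < s) (hs1 : s < 1) (hn : 0 < n) (hL : 0 ≤ L₁) (hρ : 0 < ρ) :
    ∃ C : ℝ, 0 ≤ C ∧ ∀ t : ℝ, 0 < t →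
      ∫ p, incr (HenonGelfand.dilate t φ) p ^ 2 ∂((levy n s).prod volume) ≤
        C * t ^ ((n : ℝ) - 2 * s) := by
  obtain ⟨CN, hCN, hN⟩ := integral_sq_nearLevy_le (n := n) hs1 hn
  obtain ⟨CT, hCT, hT⟩ := farLevy_real_univ_le (n := n) hs0 hn
  set V := volume.real (Metric.ball (0 : E n) 1) with hV
  have hV0 : 0 ≤ V := measureReal_nonneg
  refine ⟨(L₁ * CN + 4 * CT) * ((ρ + 1) ^ (n : ℝ) * V), by positivity, fun t ht => ?_⟩
  have hb := hφ.dilate ht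
  set η := HenonGelfand.dilate t φ with hη
  set A := Metric.ball (0 : E n) ((ρ + 1) * t) with hA
  have hvol : volume.real A = (ρ + 1) ^ (n : ℝ) * t ^ (n : ℝ) * V := by
    rw [hA, volume_real_ball hn (by positivity), Real.mul_rpow (by positivity) ht.le]
  have hsub : ∀ x z : E n, ‖z‖ < t → η x ≠ 0 → x + z ∈ A := by
    intro x z hz hx
    have h1 : ‖x‖ < t * ρ := by
      by_contra hc
      exact hx (hb.supp x (not_lt.1 hc))
    rw [hA, mem_ball_zero_iff]
    have := norm_add_le x z
    linarith
  have hnear := integral_near_incr_sq_mul_le (s := s) (k := 0) (α := 1) (v := fun _ => 0) (A := A)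
    hs1 hn ht one_pos hb (by positivity) measurable_const measurableSet_ball hsub
    (integrableOn_const measure_ball_lt_top.ne) (hN t ht)
  have h1 : truncExp 2 0 0 = 1 := by simp [truncExp]
  simp only [mul_one, h1, mul_zero, Real.exp_zero, setIntegral_const, smul_eq_mul, mul_one] at hnear
  have hn2 : ∫ p : E n × E n, incr η p ^ 2 ∂((nearLevy n s t).prod volume) ≤
      L₁ / t ^ 2 * (CN * t ^ (2 - 2 * s)) * volume.real A := by
    have := hnear.2
    rw [integral_mul_const] at this
    linarith
  have hfar := hb.toBddComp.integral_far_incr_sq_le hs0 hn ht (hT t ht)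
  have hsq : ∫ x, η x ^ 2 ≤ volume.real A := by
    have : volume.real A = ∫ x, A.indicator (fun _ => (1 : ℝ)) x := by
      rw [integral_indicator measurableSet_ball, setIntegral_const, smul_eq_mul, mul_one]
    rw [this]
    refine integral_mono hb.toBddComp.integrable_sq (integrable_indicator_ball _) fun x => ?_
    by_cases hx : η x = 0
    · rw [hx, zero_pow two_ne_zero]
      exact Set.indicator_apply_nonneg fun _ => zero_le_one
    · rw [Set.indicator_of_mem (by simpa using hsub x 0 (by simpa using ht) hx)]
      exact (sq_le_one_iff_abs_le_one _).2 (hb.bound x)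
  rw [integral_near_add_far t (hb.integrable_incr_sq hs0 hs1 hn)]
  have e1 : t ^ (2 - 2 * s) = t ^ 2 * t ^ (-(2 * s)) := by
    rw [← Real.rpow_natCast, ← Real.rpow_add ht]; norm_num [sub_eq_add_neg]
  have e2 : t ^ ((n : ℝ) - 2 * s) = t ^ (n : ℝ) * t ^ (-(2 * s)) := by
    rw [← Real.rpow_add ht, sub_eq_add_neg]
  calc _ ≤ L₁ / t ^ 2 * (CN * t ^ (2 - 2 * s)) * volume.real A +
        4 * (CT * t ^ (-(2 * s))) * volume.real A := by
        refine add_le_add hn2 (hfar.trans ?_)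
        gcongr
    _ = _ := by
        rw [hvol, e1, e2]
        field_simp

lemma contDiffBump_testBound (b : ContDiffBump (0 : E n)) :
    ∃ L₁ L₂ : ℝ, 0 ≤ L₁ ∧ 0 ≤ L₂ ∧ TestBound b 1 b.rOut L₁ L₂ := by
  obtain ⟨B, ρ, L₁, L₂, -, -, h1, h2, hb⟩ := IsTestFunction.testBound (Ω := Set.univ) (φ := b)
    ⟨b.contDiff, b.hasCompactSupport, Set.subset_univ _⟩
  exact ⟨L₁, L₂, h1, h2, ⟨b.continuous.measurable, fun x => by
    rw [abs_of_nonneg b.nonneg]; exact b.le_one, fun x hx => b.zero_of_le_dist (by simpa using hx)⟩,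
    hb.incr_sq_le, hb.secondDiff_le⟩

/-- The closed annulus `a ≤ |x| ≤ b`. -/
def annulus (n : ℕ) (a b : ℝ) : Set (E n) := Metric.closedBall 0 b \ Metric.ball 0 a

lemma mem_annulus {a b : ℝ} {x : E n} : x ∈ annulus n a b ↔ a ≤ ‖x‖ ∧ ‖x‖ ≤ b := by
  simp [annulus, and_comm]

lemma measurableSet_annulus (a b : ℝ) : MeasurableSet (annulus n a b) :=
  measurableSet_closedBall.diff measurableSet_ball

/-- Stability tested with cutoffs bounds the mass of the nonlinearity in annuli. -/
theorem IsStableIn.lintegral_annulus_le {u : E n → ℝ} {R ρ : ℝ} (hs0 : 0 < s) (hs1 : s < 1)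
    (hn : 2 * s < n) (hR : 0 < R) (hρ : R < ρ)
    (hstab : IsStableIn s a u (Metric.closedBall 0 R)ᶜ)
    (hf : LocallyIntegrable (henonExp a u) volume) :
    ∃ C : ℝ, 0 ≤ C ∧ ∀ t : ℝ, ρ ≤ t →
      ∫⁻ x in annulus n ρ t, ENNReal.ofReal (henonExp a u x) ≤
        ENNReal.ofReal (C * t ^ ((n : ℝ) - 2 * s)) := by
  have hn0 : 0 < n := by
    have : (0 : ℝ) < n := by linarith
    exact_mod_cast this
  have hc := fracConst_pos (n := n) hs0 hs1 hn0
  have hρ0 : 0 < ρ := by linarith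
  set ρ₁ := (R + ρ) / 2 with hρ₁
  let b₀ : ContDiffBump (0 : E n) := ⟨ρ₁, ρ, by linarith, by linarith⟩
  let b : ContDiffBump (0 : E n) := ⟨1, 2, one_pos, one_lt_two⟩
  obtain ⟨K₁, K₂, -, -, hb₀⟩ := contDiffBump_testBound b₀
  obtain ⟨L₁, L₂, hL₁, -, hb⟩ := contDiffBump_testBound b
  obtain ⟨C, hC, hCE⟩ := hb.energy_dilate_le hs0 hs1 hn0 hL₁ (show (0 : ℝ) < 2 by norm_num)
  set E₀ := ∫ p, incr b₀ p ^ 2 ∂((levy n s).prod volume)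
  have hE₀ : 0 ≤ E₀ := integral_nonneg fun p => sq_nonneg _
  refine ⟨fracConst n s * (C + E₀ / ρ ^ ((n : ℝ) - 2 * s)), by positivity, fun t ht => ?_⟩
  have ht0 : 0 < t := by linarith
  have hnorm : ∀ x : E n, ‖t⁻¹ • x‖ = ‖x‖ / t := fun x => by
    rw [norm_smul, norm_inv, Real.norm_eq_abs, abs_of_pos ht0, inv_mul_eq_div]
  have hbt := hb.dilate ht0
  have hone : ∀ x : E n, ‖x‖ ≤ t → HenonGelfand.dilate t b x = 1 := fun x hx => by
    refine b.one_of_mem_closedBall ?_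
    rw [mem_closedBall_zero_iff, hnorm]
    exact (div_le_one ht0).2 hx
  set φ : E n → ℝ := fun x => HenonGelfand.dilate t b x - b₀ x with hφ
  have hcd : ContDiff ℝ ∞ φ := by
    have h1 : ContDiff ℝ ∞ b := b.contDiff
    have h2 : ContDiff ℝ ∞ b₀ := b₀.contDiff
    exact (h1.comp (contDiff_const_smul _)).sub h2
  have hzero : ∀ x : E n, ‖x‖ < ρ₁ → φ x = 0 := fun x hx => by
    simp only [hφ]
    rw [hone x (by linarith), b₀.one_of_mem_closedBall (by simpa using hx.le), sub_self]
  have hφb : BddComp φ 2 (t * 2 + ρ) := by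
    refine ⟨hcd.continuous.measurable, fun x => ?_, fun x hx => ?_⟩
    · have h1 := hbt.bound x
      have h2 := hb₀.bound x
      have := abs_sub (HenonGelfand.dilate t b x) (b₀ x)
      simp only [hφ]
      linarith
    · simp only [hφ]
      rw [hbt.supp x (by change t * 2 ≤ ‖x‖; linarith), hb₀.supp x (by change ρ ≤ ‖x‖; linarith),
        sub_self]
  have htest : IsTestFunction (Metric.closedBall 0 R)ᶜ φ := by
    refine ⟨hcd, hφb.hasCompactSupport, ?_⟩
    have hsub : tsupport φ ⊆ (Metric.ball 0 ρ₁)ᶜ :=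
      closure_minimal (fun x hx hxb => hx (hzero x (by simpa using hxb)))
        Metric.isOpen_ball.isClosed_compl
    intro x hx
    have := hsub hx
    simp only [Set.mem_compl_iff, mem_ball_zero_iff, not_lt, mem_closedBall_zero_iff,
      not_le] at this ⊢
    linarith
  have hst := hstab φ htest
  obtain ⟨B', ρ', M₁, M₂, -, -, -, -, hφt⟩ := htest.testBound
  rw [hφt.energy_eq hs0 hs1 hn0] at hst
  have hEle : ∫ p, incr φ p ^ 2 ∂((levy n s).prod volume) ≤
      2 * (C * t ^ ((n : ℝ) - 2 * s)) + 2 * E₀ := by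
    have i1 := hbt.integrable_incr_sq (s := s) hs0 hs1 hn0
    have i2 := hb₀.integrable_incr_sq (s := s) hs0 hs1 hn0
    calc _ ≤ ∫ p, (2 * incr (HenonGelfand.dilate t b) p ^ 2 + 2 * incr b₀ p ^ 2)
          ∂((levy n s).prod volume) := by
          refine integral_mono (hφt.integrable_incr_sq hs0 hs1 hn0)
            ((i1.const_mul 2).add (i2.const_mul 2)) fun p => ?_
          have : incr φ p = incr (HenonGelfand.dilate t b) p - incr b₀ p := by
            simp only [incr, hφ]; ring
          simp only [this]
          nlinarith [sq_nonneg (incr (HenonGelfand.dilate t b) p + incr b₀ p)]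
      _ = 2 * (∫ p, incr (HenonGelfand.dilate t b) p ^ 2 ∂((levy n s).prod volume)) +
          2 * E₀ := by
          rw [integral_add (i1.const_mul 2) (i2.const_mul 2), integral_const_mul,
            integral_const_mul]
      _ ≤ _ := by have := hCE t ht0; linarith
  have hpow : E₀ ≤ E₀ / ρ ^ ((n : ℝ) - 2 * s) * t ^ ((n : ℝ) - 2 * s) := by
    rw [div_mul_eq_mul_div, le_div_iff₀ (by positivity)]
    have : ρ ^ ((n : ℝ) - 2 * s) ≤ t ^ ((n : ℝ) - 2 * s) :=
      Real.rpow_le_rpow hρ0.le ht (by linarith)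
    gcongr
  have hle : ∫ x, henonExp a u x * φ x ^ 2 ≤
      fracConst n s * (C + E₀ / ρ ^ ((n : ℝ) - 2 * s)) * t ^ ((n : ℝ) - 2 * s) := by
    refine hst.trans ?_
    calc _ ≤ fracConst n s / 2 * (2 * (C * t ^ ((n : ℝ) - 2 * s)) + 2 * E₀) := by gcongr
      _ = fracConst n s * (C * t ^ ((n : ℝ) - 2 * s) + E₀) := by ring
      _ ≤ fracConst n s * (C * t ^ ((n : ℝ) - 2 * s) +
          E₀ / ρ ^ ((n : ℝ) - 2 * s) * t ^ ((n : ℝ) - 2 * s)) := by gcongr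
      _ = _ := by ring
  refine le_trans ?_ (ENNReal.ofReal_le_ofReal hle)
  rw [ofReal_integral_eq_lintegral_ofReal (hφb.sq.integrable_mul_of_locallyIntegrable hf)
    (Eventually.of_forall fun x => mul_nonneg (henonExp_nonneg a u x) (sq_nonneg _))]
  refine (setLIntegral_mono' (measurableSet_annulus ρ t) fun x hx => ?_).trans
    (setLIntegral_le_lintegral (annulus n ρ t) _)
  rw [mem_annulus] at hx
  have : φ x = 1 := by
    simp only [hφ]
    rw [hone x hx.2, hb₀.supp x hx.1, sub_zero]
  rw [this, one_pow, mul_one]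

end HenonGelfand

/-! ### Tails of the rescaled solution -/

namespace HenonGelfand

variable {n : ℕ} {s a : ℝ}

/-- Dyadic summation: a bound of order `t ^ (n - 2 s)` for the mass in balls gives convergence of
the integral against `|x| ^ (-n)`. -/
lemma lintegral_compl_ball_mul_rpow_le (hs0 : 0 < s) {ρ C : ℝ} (hρ : 0 < ρ) (hC : 0 ≤ C)
    {f : E n → ℝ} (hf : Measurable f) (hf0 : ∀ x, 0 ≤ f x)
    (hF : ∀ t : ℝ, ρ ≤ t → ∫⁻ x in annulus n ρ t, ENNReal.ofReal (f x) ≤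
      ENNReal.ofReal (C * t ^ ((n : ℝ) - 2 * s))) :
    ∃ C' : ℝ, 0 ≤ C' ∧ ∀ t : ℝ, ρ ≤ t →
      ∫⁻ x in (Metric.ball (0 : E n) t)ᶜ, ENNReal.ofReal (f x * ‖x‖ ^ (-(n : ℝ))) ≤
        ENNReal.ofReal (C' * t ^ (-(2 * s))) := by
  set G : E n → ENNReal := fun x => ENNReal.ofReal (f x * ‖x‖ ^ (-(n : ℝ))) with hG
  have hGm : Measurable G := by rw [hG]; fun_prop
  set d : ℝ := (2 : ℝ) ^ (-(2 * s)) with hd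
  have hd1 : d < 1 := Real.rpow_lt_one_of_one_lt_of_neg (by norm_num) (by linarith)
  have hd0 : 0 < d := by positivity
  set D : ℝ := C * 2 ^ ((n : ℝ) - 2 * s) with hD
  have hD0 : 0 ≤ D := by positivity
  have h1d : 0 < 1 - d := by linarith
  have hone : ∀ t : ℝ, ρ ≤ t → ∫⁻ x in annulus n t (2 * t), G x ≤
      ENNReal.ofReal (D * t ^ (-(2 * s))) := by
    intro t ht
    have ht0 : 0 < t := by linarith
    calc ∫⁻ x in annulus n t (2 * t), G x
        ≤ ∫⁻ x in annulus n t (2 * t), ENNReal.ofReal (t ^ (-(n : ℝ))) * ENNReal.ofReal (f x) := by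
          refine setLIntegral_mono' (measurableSet_annulus _ _) fun x hx => ?_
          rw [mem_annulus] at hx
          rw [← ENNReal.ofReal_mul (by positivity), mul_comm]
          apply ENNReal.ofReal_le_ofReal
          refine mul_le_mul_of_nonneg_left ?_ (hf0 x)
          exact Real.rpow_le_rpow_of_nonpos ht0 hx.1 (by simp)
      _ = ENNReal.ofReal (t ^ (-(n : ℝ))) * ∫⁻ x in annulus n t (2 * t), ENNReal.ofReal (f x) :=
          lintegral_const_mul _ hf.ennreal_ofReal
      _ ≤ ENNReal.ofReal (t ^ (-(n : ℝ))) * ENNReal.ofReal (C * (2 * t) ^ ((n : ℝ) - 2 * s)) := by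
          gcongr
          refine (lintegral_mono_set fun x hx => ?_).trans (hF (2 * t) (by linarith))
          rw [mem_annulus] at hx ⊢
          exact ⟨ht.trans hx.1, hx.2⟩
      _ = ENNReal.ofReal (D * t ^ (-(2 * s))) := by
          rw [← ENNReal.ofReal_mul (by positivity), Real.mul_rpow (by norm_num) ht0.le]
          congr 1
          have : t ^ (-(n : ℝ)) * t ^ ((n : ℝ) - 2 * s) = t ^ (-(2 * s)) := by
            rw [← Real.rpow_add ht0]; congr 1; ring
          rw [← this]; ring
  have hind : ∀ k : ℕ, ∀ t : ℝ, ρ ≤ t →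
      ∫⁻ x in Metric.ball 0 (2 ^ k * t) \ Metric.ball 0 t, G x ≤
        ENNReal.ofReal (D / (1 - d) * t ^ (-(2 * s))) := by
    intro k
    induction k with
    | zero => intro t ht; simp
    | succ k ih =>
      intro t ht
      have ht0 : 0 < t := by linarith
      have hsub : Metric.ball (0 : E n) (2 ^ (k + 1) * t) \ Metric.ball 0 t ⊆
          annulus n t (2 * t) ∪ (Metric.ball 0 (2 ^ k * (2 * t)) \ Metric.ball 0 (2 * t)) := by
        intro x hx
        simp only [Set.mem_sdiff, mem_ball_zero_iff, not_lt, Set.mem_union, mem_annulus] at hx ⊢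
        rcases le_or_gt ‖x‖ (2 * t) with h | h
        · exact Or.inl ⟨hx.2, h⟩
        · exact Or.inr ⟨by rw [← mul_assoc, ← pow_succ]; exact hx.1, h.le⟩
      calc _ ≤ ∫⁻ x in annulus n t (2 * t) ∪
            (Metric.ball 0 (2 ^ k * (2 * t)) \ Metric.ball 0 (2 * t)), G x :=
            lintegral_mono_set hsub
        _ ≤ _ := lintegral_union_le _ _ _
        _ ≤ ENNReal.ofReal (D * t ^ (-(2 * s))) +
            ENNReal.ofReal (D / (1 - d) * (2 * t) ^ (-(2 * s))) :=
            add_le_add (hone t ht) (ih (2 * t) (by linarith))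
        _ = _ := by
            rw [← ENNReal.ofReal_add (by positivity) (by positivity),
              Real.mul_rpow (by norm_num) ht0.le, ← hd]
            congr 1
            field_simp
            ring
  refine ⟨D / (1 - d), by positivity, fun t ht => ?_⟩
  have ht0 : 0 < t := by linarith
  have hU : (Metric.ball (0 : E n) t)ᶜ =
      ⋃ k : ℕ, Metric.ball (0 : E n) (2 ^ k * t) \ Metric.ball 0 t := by
    ext x
    simp only [Set.mem_compl_iff, mem_ball_zero_iff, not_lt, Set.mem_iUnion, Set.mem_sdiff]
    refine ⟨fun h => ?_, fun ⟨k, hk⟩ => hk.2⟩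
    obtain ⟨k, hk⟩ := pow_unbounded_of_one_lt (‖x‖ / t) (one_lt_two : (1 : ℝ) < 2)
    exact ⟨k, (div_lt_iff₀ ht0).1 hk, h⟩
  have hmono : Monotone fun k : ℕ => Metric.ball (0 : E n) (2 ^ k * t) \ Metric.ball 0 t := by
    intro k l hkl
    refine Set.sdiff_subset_sdiff_left (Metric.ball_subset_ball ?_)
    have : (2 : ℝ) ^ k ≤ 2 ^ l := pow_le_pow_right₀ (by norm_num) hkl
    gcongr
  rw [← withDensity_apply _ measurableSet_ball.compl, hU, hmono.measure_iUnion]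
  refine iSup_le fun k => ?_
  rw [withDensity_apply _ (measurableSet_ball.diff measurableSet_ball)]
  exact hind k t ht

lemma abs_log_le_add_inv {r : ℝ} (hr : 0 < r) : |Real.log r| ≤ r + r⁻¹ := by
  have h1 := Real.log_le_self hr.le
  have h2 := Real.log_le_self (inv_pos.2 hr).le
  rw [Real.log_inv] at h2
  have h3 := inv_pos.2 hr
  rw [abs_le]; constructor <;> linarith

/-- Powers of exponent at most `n` are dominated by `r ^ n` when `r` stays away from zero. -/
lemma rpow_le_const_mul_rpow {r₀ r p q : ℝ} (hr₀ : 0 < r₀) (hr : r₀ ≤ r) (hpq : p ≤ q) :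
    r ^ p ≤ r₀ ^ (p - q) * r ^ q := by
  have hr' : 0 < r := hr₀.trans_le hr
  calc r ^ p = r ^ (p - q) * r ^ q := by rw [← Real.rpow_add hr']; congr 1; ring
    _ ≤ _ := by
      exact mul_le_mul_of_nonneg_right
        (Real.rpow_le_rpow_of_nonpos hr₀ hr (sub_nonpos.2 hpq)) (by positivity)

lemma exp_add_mul_log_norm {a s : ℝ} {u : E n → ℝ} {y : E n} (hy : 0 < ‖y‖) :
    Real.exp (u y + (2 * s + a) * Real.log ‖y‖) = ‖y‖ ^ (2 * s) * henonExp a u y := by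
  rw [Real.exp_add, henonExp, Real.rpow_def_of_pos hy, Real.rpow_def_of_pos hy, ← Real.exp_add,
    ← mul_assoc, ← Real.exp_add, ← Real.exp_add]
  congr 1
  ring

/-- The positive part of the rescaled solution `u + (2 s + a) log r` has bounded tail at every scale
`r`: outside a fixed ball it is bounded by `|y|^{2 s} |y|^a e^u` plus a power of `r / |y|`. -/
theorem lintegral_tail_le {u : E n → ℝ} {ρ C : ℝ} (hs0 : 0 < s) (hn : 2 * s < n) (ha : 0 < a)
    (hρ : 0 < ρ) (hC : 0 ≤ C) (hum : Measurable u) (hu : LocallyIntegrable u volume)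
    (hF : ∀ t : ℝ, ρ ≤ t → ∫⁻ x in annulus n ρ t, ENNReal.ofReal (henonExp a u x) ≤
      ENNReal.ofReal (C * t ^ ((n : ℝ) - 2 * s))) {r₀ : ℝ} (hr₀ : 0 < r₀) :
    ∃ C' : ℝ, 0 ≤ C' ∧ ∀ r : ℝ, r₀ ≤ r →
      ∫⁻ y, ENNReal.ofReal (u y + (2 * s + a) * Real.log r) *
        ENNReal.ofReal ((r + ‖y‖) ^ (-((n : ℝ) + 2 * s))) ≤
        ENNReal.ofReal (C' * r ^ (-(2 * s))) := by
  have hn0' : (0 : ℝ) < n := by linarith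
  have hn0 : 0 < n := by exact_mod_cast hn0'
  have hfm := measurable_henonExp (a := a) hum
  have hf0 := henonExp_nonneg a u
  set f := henonExp a u with hfdef
  set σ := 2 * s + a with hσ
  have hσ0 : 0 < σ := by positivity
  set q := (n : ℝ) + 2 * s with hq
  have hq0 : 0 < q := by positivity
  obtain ⟨C₁, hC₁, h₁⟩ := lintegral_compl_ball_mul_rpow_le hs0 hρ hC hfm hf0 hF
  obtain ⟨C₂, hC₂, h₂⟩ := lintegral_ball_norm_rpow hn0 (β := 2 * s) hn
  set V := volume.real (Metric.ball (0 : E n) ρ) with hV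
  have hV0 : 0 ≤ V := measureReal_nonneg
  set U := ∫ y in Metric.ball (0 : E n) ρ, |u y| with hU
  have hU0 : 0 ≤ U := integral_nonneg fun y => abs_nonneg _
  set A₁ := U * r₀ ^ (-(n : ℝ)) + σ * V * (r₀ ^ (1 - (n : ℝ)) + r₀ ^ (-1 - (n : ℝ))) with hA₁
  have hA₁0 : 0 ≤ A₁ := by positivity
  set A₂ := C + σ / (2 * s) * C₂ with hA₂
  have hA₂0 : 0 ≤ A₂ := by positivity
  refine ⟨A₁ + A₂ + C₁, by positivity, fun r hr => ?_⟩
  have hr0 : 0 < r := hr₀.trans_le hr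
  set m := σ * Real.log r with hm
  set F : E n → ENNReal := fun y => ENNReal.ofReal (u y + m) *
    ENNReal.ofReal ((r + ‖y‖) ^ (-q)) with hFdef
  have hker : ∀ y : E n, (r + ‖y‖) ^ (-q) ≤ r ^ (-q) := fun y =>
    Real.rpow_le_rpow_of_nonpos hr0 (by linarith [norm_nonneg y]) (by linarith)
  have hrq : r ^ (-q) * r ^ (n : ℝ) = r ^ (-(2 * s)) := by
    rw [← Real.rpow_add hr0]; congr 1; rw [hq]; ring
  -- the inner ball
  have hin : ∫⁻ y in Metric.ball (0 : E n) ρ, F y ≤ ENNReal.ofReal (A₁ * r ^ (-(2 * s))) := by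
    have hiu : IntegrableOn (fun y => |u y|) (Metric.ball (0 : E n) ρ) volume :=
      ((hu.integrableOn_isCompact (isCompact_closedBall 0 ρ)).mono_set
        Metric.ball_subset_closedBall).abs
    have hi : IntegrableOn (fun y => (|u y| + |m|) * r ^ (-q)) (Metric.ball (0 : E n) ρ) volume :=
      (hiu.add (integrableOn_const measure_ball_lt_top.ne)).mul_const _
    calc ∫⁻ y in Metric.ball (0 : E n) ρ, F y
        ≤ ∫⁻ y in Metric.ball (0 : E n) ρ, ENNReal.ofReal ((|u y| + |m|) * r ^ (-q)) := by
          refine lintegral_mono fun y => ?_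
          rw [hFdef, ENNReal.ofReal_mul (by positivity)]
          refine mul_le_mul' (ENNReal.ofReal_le_ofReal ?_) (ENNReal.ofReal_le_ofReal (hker y))
          exact add_le_add (le_abs_self _) (le_abs_self _)
      _ = ENNReal.ofReal ((U + V * |m|) * r ^ (-q)) := by
          rw [← ofReal_integral_eq_lintegral_ofReal hi
            (Eventually.of_forall fun y => by positivity), integral_mul_const,
            integral_add hiu (integrableOn_const measure_ball_lt_top.ne), setIntegral_const,
            smul_eq_mul]
      _ ≤ _ := by
          apply ENNReal.ofReal_le_ofReal
          have e0 := rpow_le_const_mul_rpow (p := 0) hr₀ hr hn0'.le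
          have e1 := rpow_le_const_mul_rpow (p := 1) hr₀ hr
            (show (1 : ℝ) ≤ n by exact_mod_cast hn0)
          have e2 := rpow_le_const_mul_rpow (p := -1) hr₀ hr (show (-1 : ℝ) ≤ n by linarith)
          rw [Real.rpow_zero, zero_sub] at e0
          rw [Real.rpow_one] at e1
          rw [Real.rpow_neg_one] at e2
          have hmle : |m| ≤ σ * ((r₀ ^ (1 - (n : ℝ)) + r₀ ^ (-1 - (n : ℝ))) * r ^ (n : ℝ)) := by
            rw [hm, abs_mul, abs_of_pos hσ0]
            refine mul_le_mul_of_nonneg_left ?_ hσ0.le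
            have := abs_log_le_add_inv hr0
            linarith
          calc (U + V * |m|) * r ^ (-q)
              ≤ (U * (r₀ ^ (-(n : ℝ)) * r ^ (n : ℝ)) +
                V * (σ * ((r₀ ^ (1 - (n : ℝ)) + r₀ ^ (-1 - (n : ℝ))) * r ^ (n : ℝ)))) *
                r ^ (-q) := by
                gcongr
                exact le_mul_of_one_le_right hU0 e0
            _ = A₁ * (r ^ (-q) * r ^ (n : ℝ)) := by rw [hA₁]; ring
            _ = _ := by rw [hrq]
  -- the pointwise bound outside the inner ball
  have hpt : ∀ y : E n, ρ ≤ ‖y‖ → u y + m ≤ ‖y‖ ^ (2 * s) * f y + σ * Real.log (r / ‖y‖) := by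
    intro y hy
    have hy0 : 0 < ‖y‖ := by linarith
    have h1 := Real.add_one_le_exp (u y + (2 * s + a) * Real.log ‖y‖)
    rw [exp_add_mul_log_norm hy0, ← hσ] at h1
    rw [Real.log_div hr0.ne' hy0.ne', hm]
    linarith
  have hmid : ∫⁻ y in annulus n ρ r, F y ≤ ENNReal.ofReal (A₂ * r ^ (-(2 * s))) := by
    rcases lt_or_ge r ρ with hrρ | hrρ
    · have : annulus n ρ r = ∅ := by
        ext y
        rw [mem_annulus]
        simp only [Set.mem_empty_iff_false, iff_false, not_and, not_le]
        intro h; linarith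
      rw [this]; simp
    · calc ∫⁻ y in annulus n ρ r, F y
          ≤ ∫⁻ y in annulus n ρ r, (ENNReal.ofReal (r ^ (2 * s) * r ^ (-q)) * ENNReal.ofReal (f y) +
            ENNReal.ofReal (σ / (2 * s) * r ^ (2 * s) * r ^ (-q)) *
              ENNReal.ofReal (‖y‖ ^ (-(2 * s)))) := by
            refine setLIntegral_mono' (measurableSet_annulus _ _) fun y hy => ?_
            rw [mem_annulus] at hy
            have hy0 : 0 < ‖y‖ := by linarith
            rw [← ENNReal.ofReal_mul (by positivity), ← ENNReal.ofReal_mul (by positivity),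
              ← ENNReal.ofReal_add (mul_nonneg (by positivity) (hf0 y)) (by positivity), hFdef]
            have hlog : Real.log (r / ‖y‖) ≤ (r / ‖y‖) ^ (2 * s) / (2 * s) :=
              Real.log_le_rpow_div (by positivity) (by positivity)
            have hb : u y + m ≤ r ^ (2 * s) * f y +
                σ / (2 * s) * r ^ (2 * s) * ‖y‖ ^ (-(2 * s)) := by
              refine (hpt y hy.1).trans (add_le_add ?_ ?_)
              · exact mul_le_mul_of_nonneg_right
                  (Real.rpow_le_rpow hy0.le hy.2 (by positivity)) (hf0 y)
              · calc σ * Real.log (r / ‖y‖) ≤ σ * ((r / ‖y‖) ^ (2 * s) / (2 * s)) := by gcongr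
                  _ = _ := by
                    rw [Real.div_rpow hr0.le hy0.le, Real.rpow_neg hy0.le]; field_simp
            calc ENNReal.ofReal (u y + m) * ENNReal.ofReal ((r + ‖y‖) ^ (-q))
                ≤ ENNReal.ofReal (r ^ (2 * s) * f y +
                  σ / (2 * s) * r ^ (2 * s) * ‖y‖ ^ (-(2 * s))) * ENNReal.ofReal (r ^ (-q)) :=
                  mul_le_mul' (ENNReal.ofReal_le_ofReal hb) (ENNReal.ofReal_le_ofReal (hker y))
              _ = _ := by
                  rw [← ENNReal.ofReal_mul' (by positivity)]
                  congr 1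
                  ring
        _ = ENNReal.ofReal (r ^ (2 * s) * r ^ (-q)) *
              (∫⁻ y in annulus n ρ r, ENNReal.ofReal (f y)) +
            ENNReal.ofReal (σ / (2 * s) * r ^ (2 * s) * r ^ (-q)) *
              ∫⁻ y in annulus n ρ r, ENNReal.ofReal (‖y‖ ^ (-(2 * s))) := by
            rw [lintegral_add_left (hfm.ennreal_ofReal.const_mul _),
              lintegral_const_mul _ hfm.ennreal_ofReal, lintegral_const_mul _ (by fun_prop)]
        _ ≤ ENNReal.ofReal (r ^ (2 * s) * r ^ (-q)) *
              ENNReal.ofReal (C * r ^ ((n : ℝ) - 2 * s)) +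
            ENNReal.ofReal (σ / (2 * s) * r ^ (2 * s) * r ^ (-q)) *
              ENNReal.ofReal (C₂ * r ^ ((n : ℝ) - 2 * s)) := by
            gcongr
            · exact hF r hrρ
            · have hae : ∫⁻ y in annulus n ρ r, ENNReal.ofReal (‖y‖ ^ (-(2 * s))) ≤
                  ∫⁻ y in Metric.closedBall (0 : E n) r, ENNReal.ofReal (‖y‖ ^ (-(2 * s))) :=
                lintegral_mono_set Set.sdiff_subset
              have := nontrivial_E hn0
              have hb : Metric.closedBall (0 : E n) r =ᵐ[volume] Metric.ball 0 r := by
                rw [← Metric.ball_union_sphere]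
                exact union_ae_eq_left_of_ae_eq_empty
                  (ae_eq_empty.2 (Measure.addHaar_sphere _ _ _))
              rw [setLIntegral_congr hb] at hae
              exact hae.trans (h₂ r hr0)
        _ = _ := by
            rw [← ENNReal.ofReal_mul (by positivity), ← ENNReal.ofReal_mul (by positivity),
              ← ENNReal.ofReal_add (by positivity) (by positivity)]
            congr 1
            have : r ^ (2 * s) * r ^ ((n : ℝ) - 2 * s) = r ^ (n : ℝ) := by
              rw [← Real.rpow_add hr0]; congr 1; ring
            calc _ = A₂ * (r ^ (-q) * (r ^ (2 * s) * r ^ ((n : ℝ) - 2 * s))) := by rw [hA₂]; ring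
              _ = _ := by rw [this, hrq]
  have hout : ∫⁻ y in (Metric.ball (0 : E n) (max r ρ))ᶜ, F y ≤
      ENNReal.ofReal (C₁ * r ^ (-(2 * s))) := by
    calc ∫⁻ y in (Metric.ball (0 : E n) (max r ρ))ᶜ, F y
        ≤ ∫⁻ y in (Metric.ball (0 : E n) (max r ρ))ᶜ, ENNReal.ofReal (f y * ‖y‖ ^ (-(n : ℝ))) := by
          refine setLIntegral_mono' measurableSet_ball.compl fun y hy => ?_
          have hy' : max r ρ ≤ ‖y‖ := by simpa using hy
          have hyr : r ≤ ‖y‖ := (le_max_left _ _).trans hy'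
          have hyρ : ρ ≤ ‖y‖ := (le_max_right _ _).trans hy'
          have hy0 : 0 < ‖y‖ := by linarith
          have hb : u y + m ≤ ‖y‖ ^ (2 * s) * f y := by
            have h1 := hpt y hyρ
            have h2 : Real.log (r / ‖y‖) ≤ 0 :=
              Real.log_nonpos (by positivity) ((div_le_one hy0).2 hyr)
            nlinarith
          have hk : (r + ‖y‖) ^ (-q) ≤ ‖y‖ ^ (-q) :=
            Real.rpow_le_rpow_of_nonpos hy0 (by linarith) (by linarith)
          calc F y ≤ ENNReal.ofReal (‖y‖ ^ (2 * s) * f y) * ENNReal.ofReal (‖y‖ ^ (-q)) :=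
                mul_le_mul' (ENNReal.ofReal_le_ofReal hb) (ENNReal.ofReal_le_ofReal hk)
            _ = _ := by
                rw [← ENNReal.ofReal_mul' (by positivity)]
                congr 1
                have : ‖y‖ ^ (2 * s) * ‖y‖ ^ (-q) = ‖y‖ ^ (-(n : ℝ)) := by
                  rw [← Real.rpow_add hy0]; congr 1; rw [hq]; ring
                rw [← this]; ring
      _ ≤ ENNReal.ofReal (C₁ * (max r ρ) ^ (-(2 * s))) := h₁ _ (le_max_right _ _)
      _ ≤ _ := by
          apply ENNReal.ofReal_le_ofReal
          refine mul_le_mul_of_nonneg_left ?_ hC₁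
          exact Real.rpow_le_rpow_of_nonpos hr0 (le_max_left _ _) (by linarith)
  have hcover : (Set.univ : Set (E n)) ⊆ (Metric.ball 0 ρ ∪ annulus n ρ r) ∪
      (Metric.ball 0 (max r ρ))ᶜ := by
    intro y _
    simp only [Set.mem_union, mem_ball_zero_iff, mem_annulus, Set.mem_compl_iff, not_lt, max_le_iff]
    by_cases h1 : ‖y‖ < ρ
    · exact Or.inl (Or.inl h1)
    · rcases le_total ‖y‖ r with h2 | h2
      · exact Or.inl (Or.inr ⟨not_lt.1 h1, h2⟩)
      · exact Or.inr ⟨h2, not_lt.1 h1⟩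
  calc ∫⁻ y, F y = ∫⁻ y in Set.univ, F y := by rw [setLIntegral_univ]
    _ ≤ ∫⁻ y in (Metric.ball 0 ρ ∪ annulus n ρ r) ∪ (Metric.ball 0 (max r ρ))ᶜ, F y :=
        lintegral_mono_set hcover
    _ ≤ ((∫⁻ y in Metric.ball 0 ρ, F y) + ∫⁻ y in annulus n ρ r, F y) +
        ∫⁻ y in (Metric.ball 0 (max r ρ))ᶜ, F y :=
        (lintegral_union_le _ _ _).trans (add_le_add_left (lintegral_union_le _ _ _) _)
    _ ≤ (ENNReal.ofReal (A₁ * r ^ (-(2 * s))) + ENNReal.ofReal (A₂ * r ^ (-(2 * s)))) +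
        ENNReal.ofReal (C₁ * r ^ (-(2 * s))) := add_le_add (add_le_add hin hmid) hout
    _ = _ := by
        rw [← ENNReal.ofReal_add (by positivity) (by positivity),
          ← ENNReal.ofReal_add (by positivity) (by positivity)]
        congr 1
        ring

end HenonGelfand

/-! ### Exponential integrability at all scales -/

namespace HenonGelfand

variable {n : ℕ} {s a : ℝ}

/-- The jumps of length at least `θ r` from a point of the ball of radius `M r` see a function
through a kernel comparable with `(r + |y|) ^ (-n - 2 s)`. -/
lemma lintegral_farLevy_shift_le {g : E n → ENNReal} (hg : Measurable g)
    (hq : 0 ≤ (n : ℝ) + 2 * s) {θ M r : ℝ} (hθ : 0 < θ) (hr : 0 < r) (hM : 0 ≤ M) {x : E n}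
    (hx : ‖x‖ ≤ M * r) :
    ∫⁻ z, g (x + z) ∂(farLevy n s (θ * r)) ≤
      ENNReal.ofReal (((1 + M) / θ + 1) ^ ((n : ℝ) + 2 * s)) *
        ∫⁻ y, g y * ENNReal.ofReal ((r + ‖y‖) ^ (-((n : ℝ) + 2 * s))) := by
  set q := (n : ℝ) + 2 * s with hqdef
  set K := (1 + M) / θ + 1 with hK
  have hK0 : 0 < K := by positivity
  have hgm : Measurable fun z => g (x + z) := hg.comp (measurable_const_add x)
  rw [farLevy, setLIntegral_levy hgm measurableSet_ball.compl]
  calc ∫⁻ z in (Metric.ball (0 : E n) (θ * r))ᶜ, ENNReal.ofReal (‖z‖ ^ (-q)) * g (x + z)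
      ≤ ∫⁻ z in (Metric.ball (0 : E n) (θ * r))ᶜ, ENNReal.ofReal (K ^ q) *
          (g (x + z) * ENNReal.ofReal ((r + ‖x + z‖) ^ (-q))) := by
        refine setLIntegral_mono' measurableSet_ball.compl fun z hz => ?_
        have hz' : θ * r ≤ ‖z‖ := by simpa using hz
        have hz0 : 0 < ‖z‖ := lt_of_lt_of_le (by positivity) hz'
        have h1 : r + ‖x + z‖ ≤ K * ‖z‖ := by
          have h2 := norm_add_le x z
          have h3 : (1 + M) * r ≤ (1 + M) / θ * ‖z‖ := by
            rw [div_mul_eq_mul_div, le_div_iff₀ hθ]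
            nlinarith
          rw [hK]; linarith
        have h4 : ‖z‖ ^ (-q) ≤ K ^ q * (r + ‖x + z‖) ^ (-q) := by
          calc ‖z‖ ^ (-q) = K ^ q * (K * ‖z‖) ^ (-q) := by
                rw [Real.mul_rpow hK0.le hz0.le, ← mul_assoc, ← Real.rpow_add hK0]
                simp
            _ ≤ _ := by
                refine mul_le_mul_of_nonneg_left ?_ (by positivity)
                exact Real.rpow_le_rpow_of_nonpos (by positivity) h1 (by linarith)
        calc ENNReal.ofReal (‖z‖ ^ (-q)) * g (x + z)
            ≤ ENNReal.ofReal (K ^ q * (r + ‖x + z‖) ^ (-q)) * g (x + z) :=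
              mul_le_mul' (ENNReal.ofReal_le_ofReal h4) le_rfl
          _ = _ := by
              rw [ENNReal.ofReal_mul (by positivity)]
              ring
    _ ≤ ∫⁻ z, ENNReal.ofReal (K ^ q) *
          (g (x + z) * ENNReal.ofReal ((r + ‖x + z‖) ^ (-q))) := setLIntegral_le_lintegral _ _
    _ = ENNReal.ofReal (K ^ q) *
          ∫⁻ z, g (x + z) * ENNReal.ofReal ((r + ‖x + z‖) ^ (-q)) := by
        rw [lintegral_const_mul]
        exact hgm.mul (by fun_prop)
    _ = _ := by
        rw [lintegral_add_left_eq_self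
          (fun y => g y * ENNReal.ofReal ((r + ‖y‖) ^ (-q))) x]

/-- Smooth cutoffs equal to one on an annulus and vanishing on a smaller ball. -/
lemma exists_annular_cutoff {l' l L : ℝ} (hl' : 0 < l') (hl : l' < l) (hL : l ≤ L) :
    ∃ (η : E n → ℝ) (L₁ L₂ L₁' L₂' : ℝ), 0 ≤ L₁ ∧ 0 ≤ L₂' ∧ TestBound η 1 (2 * L) L₁ L₂ ∧
      TestBound (fun x => η x ^ 2) 1 (2 * L) L₁' L₂' ∧ (∀ x, 0 ≤ η x) ∧
      (∀ x, ‖x‖ < l' → η x = 0) ∧ ∀ x, l ≤ ‖x‖ → ‖x‖ ≤ L → η x = 1 := by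
  have hL0 : 0 < L := by linarith
  let b : ContDiffBump (0 : E n) := ⟨L, 2 * L, hL0, by linarith⟩
  let b₀ : ContDiffBump (0 : E n) := ⟨l', l, hl', hl⟩
  set η : E n → ℝ := fun x => b x * (1 - b₀ x) with hη
  have hcd : ContDiff ℝ ∞ η := by
    have h1 : ContDiff ℝ ∞ b := b.contDiff
    have h2 : ContDiff ℝ ∞ b₀ := b₀.contDiff
    exact h1.mul (contDiff_const.sub h2)
  have hcs : HasCompactSupport η := b.hasCompactSupport.mul_right
  have h0 : ∀ x, 0 ≤ η x := fun x => mul_nonneg b.nonneg (sub_nonneg.2 b₀.le_one)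
  have h1 : ∀ x, η x ≤ 1 := fun x =>
    mul_le_one₀ b.le_one (sub_nonneg.2 b₀.le_one) (by linarith [b₀.nonneg (x := x)])
  have hsupp : ∀ x, 2 * L ≤ ‖x‖ → η x = 0 := fun x hx => by
    have : b x = 0 := b.zero_of_le_dist (by simpa using hx)
    simp [hη, this]
  obtain ⟨_, _, L₁, L₂, -, -, hL₁, -, hT⟩ := IsTestFunction.testBound (Ω := Set.univ) (φ := η)
    ⟨hcd, hcs, Set.subset_univ _⟩
  have hcs2 : HasCompactSupport fun x => η x ^ 2 := by
    simp only [pow_two]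
    exact hcs.mul_right
  obtain ⟨_, _, L₁', L₂', -, -, -, hL₂', hT'⟩ := IsTestFunction.testBound (Ω := Set.univ)
    (φ := fun x => η x ^ 2) ⟨hcd.pow 2, hcs2, Set.subset_univ _⟩
  refine ⟨η, L₁, L₂, L₁', L₂', hL₁, hL₂', ⟨⟨hcd.continuous.measurable, fun x => ?_, hsupp⟩,
    hT.incr_sq_le, hT.secondDiff_le⟩, ⟨⟨(hcd.continuous.pow 2).measurable, fun x => ?_,
    fun x hx => ?_⟩, hT'.incr_sq_le, hT'.secondDiff_le⟩, h0, fun x hx => ?_, fun x hx hx' => ?_⟩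
  · rw [abs_of_nonneg (h0 x)]; exact h1 x
  · rw [abs_of_nonneg (sq_nonneg _)]; exact pow_le_one₀ (h0 x) (h1 x)
  · simp [hsupp x hx]
  · have : b₀ x = 1 := b₀.one_of_mem_closedBall (by simpa using hx.le)
    simp [hη, this]
  · have e1 : b x = 1 := b.one_of_mem_closedBall (by simpa using hx')
    have e2 : b₀ x = 0 := b₀.zero_of_le_dist (by simpa using hx)
    simp [hη, e1, e2]

/-- Removing the truncation by Fatou's lemma. -/
lemma lintegral_mul_exp_le_of_truncExp {c : ℝ} {f v : E n → ℝ} (hf : Measurable f)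
    (hv : Measurable v) {μ : Measure (E n)} {M : ENNReal}
    (h : ∀ k : ℕ, ∫⁻ x, ENNReal.ofReal (f x * truncExp c k (v x)) ∂μ ≤ M) :
    ∫⁻ x, ENNReal.ofReal (f x * Real.exp (c * v x)) ∂μ ≤ M := by
  have hlim : ∀ x, liminf (fun k : ℕ => ENNReal.ofReal (f x * truncExp c k (v x))) atTop =
      ENNReal.ofReal (f x * Real.exp (c * v x)) := fun x => by
    refine Tendsto.liminf_eq (tendsto_const_nhds.congr' ?_)
    obtain ⟨k₀, hk₀⟩ := exists_nat_ge (v x)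
    filter_upwards [eventually_ge_atTop k₀] with k hk
    have : v x ≤ k := hk₀.trans (by exact_mod_cast hk)
    rw [truncExp, min_eq_left this]
  calc _ = ∫⁻ x, liminf (fun k : ℕ => ENNReal.ofReal (f x * truncExp c k (v x))) atTop ∂μ := by
        simp only [hlim]
    _ ≤ liminf (fun k : ℕ => ∫⁻ x, ENNReal.ofReal (f x * truncExp c k (v x)) ∂μ) atTop :=
        lintegral_liminf_le fun k =>
          (hf.mul ((measurable_truncExp c k).comp hv)).ennreal_ofReal
    _ ≤ M := liminf_le_of_frequently_le' (Frequently.of_forall h)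

lemma exp_rescaled_le {u : E n → ℝ} (ha : 0 ≤ a) {l r : ℝ} (hl : 0 < l) (hr : 0 < r) {x : E n}
    (hx : l * r ≤ ‖x‖) :
    Real.exp (u x + (2 * s + a) * Real.log r) ≤ l ^ (-a) * r ^ (2 * s) * henonExp a u x := by
  have h1 : (l * r) ^ a ≤ ‖x‖ ^ a := Real.rpow_le_rpow (by positivity) hx ha
  have h2 : Real.exp ((2 * s + a) * Real.log r) = r ^ (2 * s) * r ^ a := by
    rw [mul_comm, ← Real.rpow_def_of_pos hr, Real.rpow_add hr]
  rw [Real.exp_add, h2, henonExp]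
  calc Real.exp (u x) * (r ^ (2 * s) * r ^ a)
      = l ^ (-a) * r ^ (2 * s) * ((l * r) ^ a * Real.exp (u x)) := by
        rw [Real.mul_rpow hl.le hr.le, Real.rpow_neg hl.le]
        field_simp
    _ ≤ _ := by gcongr

/-- Scale-invariant exponential integrability outside the ball of radius `R`: the rescaled solution
`v = u + (2 s + a) log r` satisfies `∫ e^{q v} ≤ C r ^ n` on annuli of size `r`. -/
def ScaledExpBound (s a : ℝ) (u : E n → ℝ) (R q : ℝ) : Prop :=
  ∀ l L ρ : ℝ, 0 < l → l ≤ L → R < ρ → ∃ C : ℝ, 0 ≤ C ∧ ∀ r : ℝ, ρ ≤ l * r →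
    ∫⁻ x in annulus n (l * r) (L * r),
      ENNReal.ofReal (Real.exp (q * (u x + (2 * s + a) * Real.log r))) ≤
        ENNReal.ofReal (C * r ^ (n : ℝ))

lemma scaledExpBound_one {u : E n → ℝ} {R : ℝ} (hs0 : 0 < s) (hs1 : s < 1) (hn : 2 * s < n)
    (ha : 0 ≤ a) (hR : 0 < R) (hum : Measurable u)
    (hstab : IsStableIn s a u (Metric.closedBall 0 R)ᶜ)
    (hf : LocallyIntegrable (henonExp a u) volume) : ScaledExpBound s a u R 1 := by
  intro l L ρ hl hL hρ
  obtain ⟨C, hC, h⟩ := hstab.lintegral_annulus_le hs0 hs1 hn hR hρ hf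
  have hL0 : 0 < L := by linarith
  refine ⟨l ^ (-a) * (C * L ^ ((n : ℝ) - 2 * s)), by positivity, fun r hr => ?_⟩
  have hr0 : 0 < r := by
    by_contra hc
    nlinarith
  calc ∫⁻ x in annulus n (l * r) (L * r),
        ENNReal.ofReal (Real.exp (1 * (u x + (2 * s + a) * Real.log r)))
      ≤ ∫⁻ x in annulus n (l * r) (L * r),
          ENNReal.ofReal (l ^ (-a) * r ^ (2 * s)) * ENNReal.ofReal (henonExp a u x) := by
        refine setLIntegral_mono' (measurableSet_annulus _ _) fun x hx => ?_
        rw [mem_annulus] at hx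
        rw [← ENNReal.ofReal_mul (by positivity), one_mul]
        exact ENNReal.ofReal_le_ofReal (exp_rescaled_le ha hl hr0 hx.1)
    _ ≤ ENNReal.ofReal (l ^ (-a) * r ^ (2 * s)) *
          ∫⁻ x in annulus n ρ (L * r), ENNReal.ofReal (henonExp a u x) := by
        rw [lintegral_const_mul _ (measurable_henonExp hum).ennreal_ofReal]
        refine mul_le_mul' le_rfl (lintegral_mono_set fun x hx => ?_)
        rw [mem_annulus] at hx ⊢
        exact ⟨hr.trans hx.1, hx.2⟩
    _ ≤ ENNReal.ofReal (l ^ (-a) * r ^ (2 * s)) *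
          ENNReal.ofReal (C * (L * r) ^ ((n : ℝ) - 2 * s)) := by
        refine mul_le_mul' le_rfl (h _ (hr.trans ?_))
        gcongr
    _ = _ := by
        rw [← ENNReal.ofReal_mul (by positivity), Real.mul_rpow hL0.le hr0.le]
        congr 1
        have : r ^ (2 * s) * r ^ ((n : ℝ) - 2 * s) = r ^ (n : ℝ) := by
          rw [← Real.rpow_add hr0]; congr 1; ring
        rw [← this]
        ring

end HenonGelfand

/-! ### The bootstrap -/

namespace HenonGelfand

variable {n : ℕ} {s a : ℝ}

set_option maxHeartbeats 1000000 in
/-- Self-improvement of exponential integrability: the energy estimate at scale `r` turns a bound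
for `e^{q v}` with `q ≥ 2 α` into a bound for `e^{(1 + 2 α) v}` on a slightly smaller annulus. -/
theorem ScaledExpBound.improve {u : E n → ℝ} {R q α : ℝ} (hs0 : 0 < s) (hs1 : s < 1)
    (hn : 2 * s < n) (ha : 0 < a) (hR : 0 < R) (hsol : IsSolution s a u) (hu : FracLocal s u)
    (hstab : IsStableIn s a u (Metric.closedBall 0 R)ᶜ) (hα0 : 0 < α) (hα2 : α < 2)
    (hq : 2 * α ≤ q) (hb : ScaledExpBound s a u R q) :
    ScaledExpBound s a u R (1 + 2 * α) := by
  intro l L ρ hl hL hρ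
  have hn0 : 0 < n := by
    have : (0 : ℝ) < n := by linarith
    exact_mod_cast this
  have hρ0 : 0 < ρ := by linarith
  have hL0 : 0 < L := by linarith
  set ρ' := (R + ρ) / 2 with hρ'
  have hρ'0 : 0 < ρ' := by linarith
  have hρ'R : R < ρ' := by linarith
  have hρ'ρ : ρ' < ρ := by linarith
  -- the inner radii, in units of `r`: the jumps shorter than `θ r` lead from the support of the
  -- cutoff, which lies in `|x| ≥ l' r`, to `|x| ≥ l'' r ≥ ρ'`
  set l'' := ρ' / ρ * l with hl''
  have hl''0 : 0 < l'' := by positivity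
  have hl''l : l'' < l := by
    rw [hl'']
    exact mul_lt_of_lt_one_left hl ((div_lt_one hρ0).2 hρ'ρ)
  set l' := (l + l'') / 2 with hl'
  set θ := (l - l'') / 2 with hθ
  have hθ0 : 0 < θ := by linarith
  obtain ⟨η, L₁, L₂, L₁', L₂', hL₁, hL₂', hη, hη2, hη0, hηin, hη1⟩ :=
    exists_annular_cutoff (n := n) (l' := l') (l := l) (L := L) (by linarith) (by linarith) hL
  obtain ⟨CE, hCE, hE⟩ := energy_estimate (n := n) (s := s) (a := a) hs0 hs1 hn0 hα0 hα2
  obtain ⟨CS, hCS, hS⟩ := hb l'' (2 * L + θ) ρ' hl''0 (by linarith) hρ'R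
  obtain ⟨CN, hCN, hN⟩ := integral_sq_nearLevy_le (n := n) hs1 hn0
  obtain ⟨CT, hCT, hT⟩ := farLevy_real_univ_le (n := n) hs0 hn0
  obtain ⟨CF, hCF, hF⟩ := hstab.lintegral_annulus_le hs0 hs1 hn hR hρ hsol.locallyIntegrable
  obtain ⟨Cτ, hCτ, hτ⟩ := lintegral_tail_le hs0 hn ha hρ0 hCF hu.measurable
    hsol.memWeightedL.1 hF (r₀ := ρ / l) (by positivity)
  set K := ((1 + 2 * L) / θ + 1) ^ ((n : ℝ) + 2 * s) with hK
  have hK0 : 0 ≤ K := by positivity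
  set W := (2 * L + θ + 1) ^ (n : ℝ) * volume.real (Metric.ball (0 : E n) 1) with hW
  have hW0 : 0 ≤ W := by positivity
  set D := CE * ((L₁ + L₂') * (CN * θ ^ (2 - 2 * s)) + CT * θ ^ (-(2 * s)) + K * Cτ) *
    (CS + 2 * W) with hD
  have hD0 : 0 ≤ D := by positivity
  refine ⟨l ^ (-a) * D, by positivity, fun r hr => ?_⟩
  have hr0 : 0 < r := by
    by_contra hc
    nlinarith
  have hr₀ : ρ / l ≤ r := by rw [div_le_iff₀ hl]; linarith
  have hl''r : ρ' ≤ l'' * r := by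
    calc ρ' = ρ' / ρ * ρ := by field_simp
      _ ≤ ρ' / ρ * (l * r) := by gcongr
      _ = l'' * r := by rw [hl'']; ring
  set m := (2 * s + a) * Real.log r with hm
  set A := annulus n (l'' * r) ((2 * L + θ) * r) with hA
  have hAm : MeasurableSet A := measurableSet_annulus _ _
  have hAsub : A ⊆ Metric.ball 0 ((2 * L + θ + 1) * r) := fun x hx => by
    rw [hA, mem_annulus] at hx
    rw [mem_ball_zero_iff]
    nlinarith [hx.2]
  have hAfin : volume A ≠ ⊤ := ne_top_of_le_ne_top measure_ball_lt_top.ne (measure_mono hAsub)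
  have hAvol : volume.real A ≤ W * r ^ (n : ℝ) := by
    calc volume.real A ≤ volume.real (Metric.ball (0 : E n) ((2 * L + θ + 1) * r)) :=
          measureReal_mono hAsub measure_ball_lt_top.ne
      _ = _ := by
          rw [volume_real_ball hn0 (by positivity), Real.mul_rpow (by positivity) hr0.le, hW]
          ring
  have hvm : Measurable fun x => u x + m := hu.measurable.add_const m
  have hSr := hS r hl''r
  have hexp : ∫⁻ x in A, ENNReal.ofReal (Real.exp (2 * α * (u x + m))) ≤
      ENNReal.ofReal ((CS + W) * r ^ (n : ℝ)) := by
    calc ∫⁻ x in A, ENNReal.ofReal (Real.exp (2 * α * (u x + m)))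
        ≤ ∫⁻ x in A, (ENNReal.ofReal (Real.exp (q * (u x + m))) + 1) := by
          refine lintegral_mono fun x => ?_
          rw [← ENNReal.ofReal_one, ← ENNReal.ofReal_add (Real.exp_pos _).le zero_le_one]
          apply ENNReal.ofReal_le_ofReal
          rcases le_total (u x + m) 0 with h | h
          · have : Real.exp (2 * α * (u x + m)) ≤ 1 :=
              Real.exp_le_one_iff.2 (mul_nonpos_of_nonneg_of_nonpos (by positivity) h)
            linarith [Real.exp_pos (q * (u x + m))]
          · have : Real.exp (2 * α * (u x + m)) ≤ Real.exp (q * (u x + m)) :=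
              Real.exp_le_exp.2 (mul_le_mul_of_nonneg_right hq h)
            linarith
      _ = (∫⁻ x in A, ENNReal.ofReal (Real.exp (q * (u x + m)))) + volume A := by
          rw [lintegral_add_right _ measurable_const, setLIntegral_one]
      _ ≤ ENNReal.ofReal (CS * r ^ (n : ℝ)) + ENNReal.ofReal (W * r ^ (n : ℝ)) := by
          refine add_le_add hSr ?_
          rw [← ofReal_measureReal hAfin]
          exact ENNReal.ofReal_le_ofReal hAvol
      _ = _ := by
          rw [← ENNReal.ofReal_add (by positivity) (by positivity)]
          congr 1
          ring
  have hint : IntegrableOn (fun x => Real.exp (2 * α * (u x + m))) A volume := by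
    refine ⟨(by fun_prop : Measurable _).aestronglyMeasurable, ?_⟩
    rw [hasFiniteIntegral_iff_ofReal (Eventually.of_forall fun x => (Real.exp_pos _).le)]
    exact hexp.trans_lt ENNReal.ofReal_lt_top
  have hintle : ∫ x in A, Real.exp (2 * α * (u x + m)) ≤ (CS + W) * r ^ (n : ℝ) := by
    rw [integral_eq_lintegral_of_nonneg_ae (Eventually.of_forall fun x => (Real.exp_pos _).le)
      hint.aestronglyMeasurable]
    exact ENNReal.toReal_le_of_le_ofReal (by positivity) hexp
  -- the cutoff at scale `r`
  have hnorm : ∀ x : E n, ‖r⁻¹ • x‖ = ‖x‖ / r := fun x => by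
    rw [norm_smul, norm_inv, Real.norm_eq_abs, abs_of_pos hr0, inv_mul_eq_div]
  have hηr := hη.dilate hr0
  have hηr2 : TestBound (fun x => dilate r η x ^ 2) 1 (r * (2 * L)) (L₁' / r ^ 2) (L₂' / r ^ 2) :=
    hη2.dilate hr0
  have hin : ∀ x : E n, ‖x‖ < l' * r → dilate r η x = 0 := fun x hx =>
    hηin _ (by rw [hnorm, div_lt_iff₀ hr0]; exact hx)
  have hone : ∀ x : E n, l * r ≤ ‖x‖ → ‖x‖ ≤ L * r → dilate r η x = 1 := fun x h1 h2 =>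
    hη1 _ (by rw [hnorm, le_div_iff₀ hr0]; exact h1) (by rw [hnorm, div_le_iff₀ hr0]; exact h2)
  have hne : ∀ x : E n, dilate r η x ≠ 0 → l' * r ≤ ‖x‖ ∧ ‖x‖ ≤ 2 * L * r := fun x hx => by
    refine ⟨not_lt.1 fun h => hx (hin x h), ?_⟩
    by_contra hc
    exact hx (hηr.supp x (by linarith))
  have hsub : ∀ x z : E n, ‖z‖ < θ * r → dilate r η x ≠ 0 → x + z ∈ A := by
    intro x z hz hx
    obtain ⟨h1, h2⟩ := hne x hx
    rw [hA, mem_annulus]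
    have h3 := norm_add_le x z
    have h4 := norm_sub_le (x + z) z
    rw [add_sub_cancel_right] at h4
    have h5 : l' * r - θ * r = l'' * r := by rw [hl', hθ]; ring
    constructor <;> linarith
  have hmain : ∀ k : ℕ, ∫ x, henonExp a u x *
      (truncExp (2 * α) k (u x + m) * dilate r η x ^ 2) ≤ D * r ^ ((n : ℝ) - 2 * s) := by
    intro k
    have hz : ∀ x : E n, ‖x‖ < ρ' → dilate r η x = 0 := fun x hx => hin x <| by
      refine hx.trans_le (hl''r.trans ?_)
      gcongr
      linarith
    have h := hE u hsol hu R ρ' hρ'R hstab m (dilate r η) _ _ _ _ _ (θ * r) _ _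
      (K * (Cτ * r ^ (-(2 * s)))) k A hηr hηr2 (by positivity) (by positivity) (fun x => hη0 _) hz
      (by positivity) (Nat.cast_nonneg k) (by positivity) hAm hAfin hsub hint
      (hN _ (by positivity)) (hT _ (by positivity)) (fun x hx => by
        refine (lintegral_farLevy_shift_le (g := fun y => ENNReal.ofReal (u y + m))
          (M := 2 * L) hvm.ennreal_ofReal (by positivity) hθ0 hr0 (by positivity)
          (hne x hx).2).trans ?_
        rw [ENNReal.ofReal_mul hK0]
        exact mul_le_mul' le_rfl (hτ r hr₀))
    have e1 : (θ * r) ^ (2 - 2 * s) = θ ^ (2 - 2 * s) * (r ^ 2 * r ^ (-(2 * s))) := by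
      rw [Real.mul_rpow hθ0.le hr0.le, ← Real.rpow_natCast, ← Real.rpow_add hr0]
      norm_num [sub_eq_add_neg]
    have e2 : (θ * r) ^ (-(2 * s)) = θ ^ (-(2 * s)) * r ^ (-(2 * s)) :=
      Real.mul_rpow hθ0.le hr0.le
    have e3 : r ^ ((n : ℝ) - 2 * s) = r ^ (n : ℝ) * r ^ (-(2 * s)) := by
      rw [← Real.rpow_add hr0, sub_eq_add_neg]
    refine h.trans ?_
    calc _ ≤ CE * ((L₁ / r ^ 2 + L₂' / r ^ 2) * (CN * (θ * r) ^ (2 - 2 * s)) +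
          CT * (θ * r) ^ (-(2 * s)) + K * (Cτ * r ^ (-(2 * s)))) *
          ((CS + W) * r ^ (n : ℝ) + W * r ^ (n : ℝ)) := by gcongr
      _ = _ := by
          rw [e1, e2, e3, hD]
          field_simp
          ring
  have hfm := measurable_henonExp (a := a) hu.measurable
  have hlint : ∫⁻ x in annulus n (l * r) (L * r),
      ENNReal.ofReal (henonExp a u x * Real.exp (2 * α * (u x + m))) ≤
        ENNReal.ofReal (D * r ^ ((n : ℝ) - 2 * s)) := by
    refine lintegral_mul_exp_le_of_truncExp hfm hvm fun k => ?_
    have hbc : BddComp (fun x => truncExp (2 * α) k (u x + m) * dilate r η x ^ 2)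
        (Real.exp (2 * α * k)) (r * (2 * L)) := by
      refine ⟨((measurable_truncExp _ _).comp hvm).mul hηr2.measurable, fun x => ?_, fun x hx => ?_⟩
      · rw [abs_mul, abs_of_pos (truncExp_pos _ _ _)]
        calc _ ≤ Real.exp (2 * α * k) * 1 :=
              mul_le_mul (truncExp_le (by positivity) _ _) (hηr2.bound x) (abs_nonneg _)
                (Real.exp_pos _).le
          _ = _ := mul_one _
      · rw [hηr2.supp x hx, mul_zero]
    refine le_trans ?_ (ENNReal.ofReal_le_ofReal (hmain k))
    rw [ofReal_integral_eq_lintegral_ofReal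
      (hbc.integrable_mul_of_locallyIntegrable hsol.locallyIntegrable)
      (Eventually.of_forall fun x => mul_nonneg (henonExp_nonneg a u x)
        (mul_nonneg (truncExp_pos _ _ _).le (sq_nonneg _)))]
    refine (setLIntegral_mono' (measurableSet_annulus _ _) fun x hx => ?_).trans
      (setLIntegral_le_lintegral (annulus n (l * r) (L * r)) _)
    rw [mem_annulus] at hx
    rw [hone x hx.1 hx.2, one_pow, mul_one]
  calc ∫⁻ x in annulus n (l * r) (L * r), ENNReal.ofReal (Real.exp ((1 + 2 * α) * (u x + m)))
      ≤ ∫⁻ x in annulus n (l * r) (L * r), ENNReal.ofReal (l ^ (-a) * r ^ (2 * s)) *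
          ENNReal.ofReal (henonExp a u x * Real.exp (2 * α * (u x + m))) := by
        refine setLIntegral_mono' (measurableSet_annulus _ _) fun x hx => ?_
        rw [mem_annulus] at hx
        rw [← ENNReal.ofReal_mul (by positivity), ← mul_assoc, add_mul, one_mul, Real.exp_add]
        apply ENNReal.ofReal_le_ofReal
        exact mul_le_mul_of_nonneg_right (exp_rescaled_le ha.le hl hr0 hx.1) (Real.exp_pos _).le
    _ ≤ ENNReal.ofReal (l ^ (-a) * r ^ (2 * s)) * ENNReal.ofReal (D * r ^ ((n : ℝ) - 2 * s)) := by
        rw [lintegral_const_mul _ (by fun_prop)]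
        exact mul_le_mul' le_rfl hlint
    _ = _ := by
        rw [← ENNReal.ofReal_mul (by positivity)]
        congr 1
        have : r ^ (2 * s) * r ^ ((n : ℝ) - 2 * s) = r ^ (n : ℝ) := by
          rw [← Real.rpow_add hr0]; congr 1; ring
        rw [← this]
        ring

/-- The bootstrap, gaining at most one at each step, up to the exponent `5` which limits the use
of stability. -/
theorem scaledExpBound_of_lt_five {u : E n → ℝ} {R p : ℝ} (hs0 : 0 < s) (hs1 : s < 1)
    (hn : 2 * s < n) (ha : 0 < a) (hR : 0 < R) (hsol : IsSolution s a u) (hu : FracLocal s u)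
    (hstab : IsStableIn s a u (Metric.closedBall 0 R)ᶜ) (hp1 : 1 ≤ p) (hp5 : p < 5) :
    ScaledExpBound s a u R p := by
  have base := scaledExpBound_one hs0 hs1 hn ha.le hR hu.measurable hstab hsol.locallyIntegrable
  have step : ∀ {q p : ℝ}, ScaledExpBound s a u R q → 1 < p → p < 5 → p ≤ q + 1 →
      ScaledExpBound s a u R p := by
    intro q p hq h1 h5 hpq
    have h := ScaledExpBound.improve (α := (p - 1) / 2) hs0 hs1 hn ha hR hsol hu hstab
      (by linarith) (by linarith) (by linarith) hq
    rwa [show 1 + 2 * ((p - 1) / 2) = p by ring] at h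
  rcases hp1.eq_or_lt with rfl | hp1
  · exact base
  have b2 : ScaledExpBound s a u R 2 := step base (by norm_num) (by norm_num) (by norm_num)
  have b3 : ScaledExpBound s a u R 3 := step b2 (by norm_num) (by norm_num) (by norm_num)
  have b4 : ScaledExpBound s a u R 4 := step b3 (by norm_num) (by norm_num) (by norm_num)
  rcases le_total p 2 with h | h
  · exact step base hp1 hp5 (by linarith)
  · exact step b4 hp1 hp5 (by linarith)

end HenonGelfand

/-! ### Powers of the nonlinearity -/

namespace HenonGelfand

variable {n : ℕ} {s a : ℝ}

lemma ScaledExpBound.lintegral_henonExp_rpow_le {u : E n → ℝ} {R p : ℝ}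
    (hb : ScaledExpBound s a u R p) (hum : Measurable u) (ha : 0 ≤ a) (hp : 0 ≤ p) (hR : 0 < R)
    {l L ρ : ℝ} (hl : 0 < l) (hL : l ≤ L) (hρ : R < ρ) :
    ∃ C : ℝ, 0 ≤ C ∧ ∀ r : ℝ, ρ ≤ l * r →
      ∫⁻ x in annulus n (l * r) (L * r), ENNReal.ofReal (henonExp a u x ^ p) ≤
        ENNReal.ofReal (C * r ^ ((n : ℝ) - 2 * p * s)) := by
  obtain ⟨C, hC, h⟩ := hb l L ρ hl hL hρ
  have hL0 : 0 < L := by linarith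
  refine ⟨L ^ (a * p) * C, by positivity, fun r hr => ?_⟩
  have hr0 : 0 < r := by
    by_contra hc
    nlinarith
  calc ∫⁻ x in annulus n (l * r) (L * r), ENNReal.ofReal (henonExp a u x ^ p)
      ≤ ∫⁻ x in annulus n (l * r) (L * r), ENNReal.ofReal (L ^ (a * p) * r ^ (-(2 * p * s))) *
          ENNReal.ofReal (Real.exp (p * (u x + (2 * s + a) * Real.log r))) := by
        refine setLIntegral_mono' (measurableSet_annulus _ _) fun x hx => ?_
        rw [mem_annulus] at hx
        rw [← ENNReal.ofReal_mul (by positivity)]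
        apply ENNReal.ofReal_le_ofReal
        have e1 : Real.exp (p * (u x + (2 * s + a) * Real.log r)) =
            Real.exp (u x * p) * r ^ (p * (2 * s + a)) := by
          rw [Real.rpow_def_of_pos hr0, ← Real.exp_add]
          congr 1
          ring
        have e2 : r ^ (-(2 * p * s)) * r ^ (p * (2 * s + a)) = r ^ (a * p) := by
          rw [← Real.rpow_add hr0]; congr 1; ring
        rw [henonExp, Real.mul_rpow (by positivity) (Real.exp_pos _).le,
          ← Real.rpow_mul (norm_nonneg _), ← Real.exp_mul, e1]
        calc ‖x‖ ^ (a * p) * Real.exp (u x * p) ≤ (L * r) ^ (a * p) * Real.exp (u x * p) := by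
              gcongr
              exact hx.2
          _ = L ^ (a * p) * (r ^ (-(2 * p * s)) * r ^ (p * (2 * s + a))) * Real.exp (u x * p) := by
              rw [e2, Real.mul_rpow hL0.le hr0.le]
          _ = _ := by ring
    _ ≤ ENNReal.ofReal (L ^ (a * p) * r ^ (-(2 * p * s))) *
          ENNReal.ofReal (C * r ^ (n : ℝ)) := by
        rw [lintegral_const_mul _ (by fun_prop)]
        exact mul_le_mul' le_rfl (h r hr)
    _ = _ := by
        rw [← ENNReal.ofReal_mul (by positivity), sub_eq_add_neg, Real.rpow_add hr0]
        congr 1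
        ring

/-- Geometric summation over dyadic annuli, for a positive power of the radius. -/
lemma lintegral_annulus_le_of_dyadic {g : E n → ENNReal} {ρ C γ : ℝ} (hρ : 0 < ρ) (hC : 0 ≤ C)
    (hγ : 0 < γ) (h : ∀ t : ℝ, 2 * ρ ≤ t →
      ∫⁻ x in annulus n (t / 2) t, g x ≤ ENNReal.ofReal (C * t ^ γ)) :
    ∃ C' : ℝ, 0 ≤ C' ∧ ∀ t : ℝ, ρ ≤ t →
      ∫⁻ x in annulus n ρ t, g x ≤ ENNReal.ofReal (C' * t ^ γ) := by
  set d : ℝ := (2 : ℝ) ^ (-γ) with hd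
  have hd1 : d < 1 := Real.rpow_lt_one_of_one_lt_of_neg (by norm_num) (by linarith)
  have h1d : 0 < 1 - d := by linarith
  have hd0 : 0 < d := by positivity
  set C' := C * 2 ^ γ + C / (1 - d) with hC'
  have hC'0 : 0 ≤ C' := by positivity
  have hstep : C' * d + C ≤ C' := by
    have : C / (1 - d) * (1 - d) = C := div_mul_cancel₀ _ h1d.ne'
    have : 0 ≤ C * 2 ^ γ * (1 - d) := by positivity
    nlinarith
  have hbase : ∀ t : ℝ, ρ ≤ t → t ≤ 2 * ρ →
      ∫⁻ x in annulus n ρ t, g x ≤ ENNReal.ofReal (C' * t ^ γ) := by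
    intro t ht ht2
    have ht0 : 0 < t := by linarith
    calc ∫⁻ x in annulus n ρ t, g x ≤ ∫⁻ x in annulus n (2 * ρ / 2) (2 * ρ), g x := by
          refine lintegral_mono_set fun x hx => ?_
          rw [mem_annulus] at hx ⊢
          exact ⟨by linarith [hx.1], hx.2.trans ht2⟩
      _ ≤ ENNReal.ofReal (C * (2 * ρ) ^ γ) := h _ le_rfl
      _ ≤ _ := by
          apply ENNReal.ofReal_le_ofReal
          have h1 : ρ ^ γ ≤ t ^ γ := Real.rpow_le_rpow hρ.le ht hγ.le
          calc C * (2 * ρ) ^ γ = C * 2 ^ γ * ρ ^ γ := by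
                rw [Real.mul_rpow (by norm_num) hρ.le]; ring
            _ ≤ C' * t ^ γ := by
                refine mul_le_mul ?_ h1 (by positivity) hC'0
                exact le_add_of_nonneg_right (by positivity)
  have hind : ∀ k : ℕ, ∀ t : ℝ, ρ ≤ t → t ≤ 2 * ρ * 2 ^ k →
      ∫⁻ x in annulus n ρ t, g x ≤ ENNReal.ofReal (C' * t ^ γ) := by
    intro k
    induction k with
    | zero => intro t ht ht2; exact hbase t ht (by simpa using ht2)
    | succ k ih =>
      intro t ht htk
      have ht0 : 0 < t := by linarith
      rcases le_total t (2 * ρ) with h2 | h2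
      · exact hbase t ht h2
      · have hcov : annulus n ρ t ⊆ annulus n ρ (t / 2) ∪ annulus n (t / 2) t := by
          intro x hx
          simp only [Set.mem_union, mem_annulus] at hx ⊢
          rcases le_total ‖x‖ (t / 2) with h3 | h3
          · exact Or.inl ⟨hx.1, h3⟩
          · exact Or.inr ⟨h3, hx.2⟩
        calc ∫⁻ x in annulus n ρ t, g x
            ≤ ∫⁻ x in annulus n ρ (t / 2) ∪ annulus n (t / 2) t, g x := lintegral_mono_set hcov
          _ ≤ _ := lintegral_union_le _ _ _
          _ ≤ ENNReal.ofReal (C' * (t / 2) ^ γ) + ENNReal.ofReal (C * t ^ γ) := by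
              refine add_le_add (ih _ (by linarith) ?_) (h t h2)
              rw [pow_succ] at htk
              linarith
          _ = ENNReal.ofReal ((C' * d + C) * t ^ γ) := by
              rw [← ENNReal.ofReal_add (by positivity) (by positivity),
                Real.div_rpow ht0.le (by norm_num), hd, Real.rpow_neg (by norm_num)]
              congr 1
              ring
          _ ≤ _ := ENNReal.ofReal_le_ofReal (by gcongr)
  refine ⟨C', hC'0, fun t ht => ?_⟩
  obtain ⟨k, hk⟩ := pow_unbounded_of_one_lt (t / (2 * ρ)) (one_lt_two : (1 : ℝ) < 2)
  refine hind k t ht ?_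
  rw [div_lt_iff₀ (by positivity)] at hk
  linarith

lemma integrableOn_and_setIntegral_le {g : E n → ℝ} (hg : Measurable g) (hg0 : ∀ x, 0 ≤ g x)
    {S T : Set (E n)} (hST : S ⊆ T) {M : ℝ} (hM : 0 ≤ M)
    (h : ∫⁻ x in T, ENNReal.ofReal (g x) ≤ ENNReal.ofReal M) :
    IntegrableOn g S volume ∧ ∫ x in S, g x ≤ M := by
  have hS : ∫⁻ x in S, ENNReal.ofReal (g x) ≤ ENNReal.ofReal M := (lintegral_mono_set hST).trans h
  refine ⟨⟨hg.aestronglyMeasurable, ?_⟩, ?_⟩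
  · rw [hasFiniteIntegral_iff_ofReal (Eventually.of_forall hg0)]
    exact hS.trans_lt ENNReal.ofReal_lt_top
  · rw [integral_eq_lintegral_of_nonneg_ae (Eventually.of_forall hg0) hg.aestronglyMeasurable]
    exact ENNReal.toReal_le_of_le_ofReal hM hS

/-- Scale-invariant bounds for the powers `p < 5` of the nonlinearity on annuli outside the ball of
radius `R`. -/
theorem lintegral_henonExp_rpow_annulus_le {u : E n → ℝ} {R p : ℝ} (hs0 : 0 < s) (hs1 : s < 1)
    (hn : 2 * s < n) (ha : 0 < a) (hR : 0 < R) (huH : MemDotHLoc s u) (hsol : IsSolution s a u)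
    (hum : Measurable u) (hstab : IsStableIn s a u (Metric.closedBall 0 R)ᶜ) (hp1 : 1 ≤ p)
    (hp5 : p < 5) {l L ρ : ℝ} (hl : 0 < l) (hL : l ≤ L) (hρ : R < ρ) :
    ∃ C : ℝ, 0 ≤ C ∧ ∀ r : ℝ, ρ ≤ l * r →
      ∫⁻ x in annulus n (l * r) (L * r), ENNReal.ofReal (henonExp a u x ^ p) ≤
        ENNReal.ofReal (C * r ^ ((n : ℝ) - 2 * p * s)) :=
  (scaledExpBound_of_lt_five hs0 hs1 hn ha hR hsol (fracLocal_of_mem hum hsol.memWeightedL huH)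
    hstab hp1 hp5).lintegral_henonExp_rpow_le hum ha.le (by linarith) hR hl hL hρ

/-! ### Independence of the representative -/

lemma henonExp_congr {u u' : E n → ℝ} (h : u =ᵐ[volume] u') :
    henonExp a u =ᵐ[volume] henonExp a u' := by
  filter_upwards [h] with x hx
  rw [henonExp, henonExp, hx]

lemma MemWeightedL.congr {u u' : E n → ℝ} (h : u =ᵐ[volume] u') (hu : MemWeightedL s u) :
    MemWeightedL s u' := by
  refine ⟨hu.1.congr h, hu.2.congr ?_⟩
  filter_upwards [h] with x hx
  rw [hx]

lemma MemDotHLoc.congr {u u' : E n → ℝ} (h : u =ᵐ[volume] u') (hu : MemDotHLoc s u) :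
    MemDotHLoc s u' := by
  intro Ω hΩ hb
  obtain ⟨h1, h2⟩ := hu Ω hΩ hb
  refine ⟨fun K hK hKΩ => (h1 K hK hKΩ).ae_eq (ae_restrict_of_ae h), ?_⟩
  refine (lintegral_congr_ae ?_).trans_lt h2
  filter_upwards [ae_restrict_of_ae h] with x hx
  refine lintegral_congr_ae ?_
  filter_upwards [ae_restrict_of_ae h] with y hy
  rw [hx, hy]

lemma IsSolution.congr {u u' : E n → ℝ} (h : u =ᵐ[volume] u') (hu : IsSolution s a u) :
    IsSolution s a u' := by
  refine ⟨hu.memWeightedL.congr h, hu.locallyIntegrable.congr (henonExp_congr h), fun φ hφ => ?_⟩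
  have h1 : ∫ x, u' x * fracLaplacian s φ x = ∫ x, u x * fracLaplacian s φ x :=
    integral_congr_ae (by filter_upwards [h] with x hx; rw [hx])
  have h2 : ∫ x, henonExp a u' x * φ x = ∫ x, henonExp a u x * φ x :=
    integral_congr_ae (by filter_upwards [henonExp_congr (a := a) h] with x hx; rw [hx])
  rw [h1, h2, hu.weak_eq φ hφ]

lemma IsStableIn.congr {u u' : E n → ℝ} {Ω : Set (E n)} (h : u =ᵐ[volume] u')
    (hu : IsStableIn s a u Ω) : IsStableIn s a u' Ω := by
  intro φ hφ
  have h2 : ∫ x, henonExp a u' x * φ x ^ 2 = ∫ x, henonExp a u x * φ x ^ 2 :=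
    integral_congr_ae (by filter_upwards [henonExp_congr (a := a) h] with x hx; rw [hx])
  rw [h2]
  exact hu φ hφ

end HenonGelfand

/-! ### Integral estimates outside the ball -/

theorem proposition2p6 (n : ℕ) (s a : ℝ) (hs0 : 0 < s) (hs1 : s < 1) (ha : 0 < a)
    (hn : 2 * s < (n : ℝ)) (u : HenonGelfand.E n → ℝ)
    (huL : HenonGelfand.MemWeightedL s u) (huH : HenonGelfand.MemDotHLoc s u)
    (hu : HenonGelfand.IsSolution s a u) (R : ℝ) (hR : 0 < R)
    (hstab : HenonGelfand.IsStableIn s a u (Metric.closedBall 0 R)ᶜ) :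
    (∀ p : ℝ, 1 ≤ p → p < min 5 (1 + (n : ℝ) / (2 * s)) →
      ∃ C : ℝ, 0 < C ∧ ∃ r₀ : ℝ, ∀ r : ℝ, r₀ ≤ r →
        IntegrableOn (fun x => HenonGelfand.henonExp a u x ^ p)
          (Metric.ball 0 (2 * r) \ Metric.ball 0 r) volume ∧
        ∫ x in Metric.ball 0 (2 * r) \ Metric.ball 0 r, HenonGelfand.henonExp a u x ^ p
          ≤ C * r ^ ((n : ℝ) - 2 * p * s)) ∧
    (∀ p : ℝ, 1 ≤ p → p < min 5 (1 + (n : ℝ) / (2 * s)) →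
      ∃ C : ℝ, 0 < C ∧ ∃ r₀ : ℝ, ∀ x : HenonGelfand.E n, r₀ ≤ ‖x‖ →
        IntegrableOn (fun y => HenonGelfand.henonExp a u y ^ p)
          (Metric.ball x (‖x‖ / 2)) volume ∧
        ∫ y in Metric.ball x (‖x‖ / 2), HenonGelfand.henonExp a u y ^ p
          ≤ C * ‖x‖ ^ ((n : ℝ) - 2 * p * s)) ∧
    (∀ p : ℝ, 1 ≤ p → p < min 5 ((n : ℝ) / (2 * s)) →
      ∃ C : ℝ, 0 < C ∧ ∃ r₀ : ℝ, ∀ r : ℝ, r₀ ≤ r →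
        IntegrableOn (fun x => HenonGelfand.henonExp a u x ^ p)
          (Metric.ball 0 r \ Metric.ball 0 (2 * R)) volume ∧
        ∫ x in Metric.ball 0 r \ Metric.ball 0 (2 * R), HenonGelfand.henonExp a u x ^ p
          ≤ C * r ^ ((n : ℝ) - 2 * p * s)) := by
  -- all assertions concern the class of `u` up to null sets
  let u' : HenonGelfand.E n → ℝ := huL.1.aestronglyMeasurable.mk u
  have hum : Measurable u' := huL.1.aestronglyMeasurable.stronglyMeasurable_mk.measurable
  have huu : u =ᵐ[volume] u' := huL.1.aestronglyMeasurable.ae_eq_mk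
  have hfae := HenonGelfand.henonExp_congr (a := a) huu
  have hfm := HenonGelfand.measurable_henonExp (a := a) hum
  have hn0 : (0 : ℝ) < n := by linarith
  have bound : ∀ {p l L ρ : ℝ}, 1 ≤ p → p < 5 → 0 < l → l ≤ L → R < ρ →
      ∃ C : ℝ, 0 ≤ C ∧ ∀ r : ℝ, ρ ≤ l * r → ∫⁻ x in HenonGelfand.annulus n (l * r) (L * r),
        ENNReal.ofReal (HenonGelfand.henonExp a u' x ^ p) ≤
          ENNReal.ofReal (C * r ^ ((n : ℝ) - 2 * p * s)) := fun h1 h5 hl hL hρ =>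
    HenonGelfand.lintegral_henonExp_rpow_annulus_le hs0 hs1 hn ha hR (huH.congr huu)
      (hu.congr huu) hum (hstab.congr huu) h1 h5 hl hL hρ
  have concl : ∀ {p M : ℝ} {S T : Set (HenonGelfand.E n)}, S ⊆ T → 0 ≤ M →
      ∫⁻ x in T, ENNReal.ofReal (HenonGelfand.henonExp a u' x ^ p) ≤ ENNReal.ofReal M →
      IntegrableOn (fun x => HenonGelfand.henonExp a u x ^ p) S volume ∧
        ∫ x in S, HenonGelfand.henonExp a u x ^ p ≤ M := by
    intro p M S T hST hM h
    have hae : (fun x => HenonGelfand.henonExp a u' x ^ p) =ᵐ[volume.restrict S]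
        fun x => HenonGelfand.henonExp a u x ^ p := by
      filter_upwards [ae_restrict_of_ae hfae] with x hx
      rw [hx]
    obtain ⟨h1, h2⟩ := HenonGelfand.integrableOn_and_setIntegral_le (hfm.pow_const p)
      (fun x => Real.rpow_nonneg (HenonGelfand.henonExp_nonneg a u' x) p) hST hM h
    exact ⟨h1.congr hae, by rwa [← integral_congr_ae hae]⟩
  have weaken : ∀ {C r γ : ℝ}, 0 < r → C * r ^ γ ≤ (C + 1) * r ^ γ := fun {C r γ} hr => by
    gcongr
    linarith
  refine ⟨fun p hp1 hp => ?_, fun p hp1 hp => ?_, fun p hp1 hp => ?_⟩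
  · obtain ⟨C, hC, h⟩ := bound (l := 1) (L := 2) (ρ := 2 * R) hp1
      (hp.trans_le (min_le_left _ _)) one_pos one_le_two (by linarith)
    refine ⟨C + 1, by linarith, 2 * R, fun r hr => ?_⟩
    have hr0 : 0 < r := by linarith
    have hsub : Metric.ball 0 (2 * r) \ Metric.ball 0 r ⊆
        HenonGelfand.annulus n (1 * r) (2 * r) := fun x hx => by
      rw [HenonGelfand.mem_annulus, one_mul]
      simp only [Set.mem_sdiff, mem_ball_zero_iff, not_lt] at hx
      exact ⟨hx.2, hx.1.le⟩
    obtain ⟨h1, h2⟩ := concl hsub (by positivity) (h r (by linarith))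
    exact ⟨h1, h2.trans (weaken hr0)⟩
  · obtain ⟨C, hC, h⟩ := bound (l := 1 / 2) (L := 2) (ρ := 2 * R) hp1
      (hp.trans_le (min_le_left _ _)) (by norm_num) (by norm_num) (by linarith)
    refine ⟨C + 1, by linarith, 4 * R, fun x hx => ?_⟩
    have hr0 : 0 < ‖x‖ := by linarith
    have hsub : Metric.ball x (‖x‖ / 2) ⊆
        HenonGelfand.annulus n (1 / 2 * ‖x‖) (2 * ‖x‖) := fun y hy => by
      rw [HenonGelfand.mem_annulus]
      rw [mem_ball_iff_norm] at hy
      have h1 := norm_sub_norm_le x y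
      have h2 := norm_sub_norm_le y x
      rw [norm_sub_rev] at h1
      constructor <;> linarith
    obtain ⟨h1, h2⟩ := concl hsub (by positivity) (h ‖x‖ (by linarith))
    exact ⟨h1, h2.trans (weaken hr0)⟩
  · have hγ : 0 < (n : ℝ) - 2 * p * s := by
      have := hp.trans_le (min_le_right _ _)
      rw [lt_div_iff₀ (by positivity)] at this
      linarith
    obtain ⟨C, hC, h⟩ := bound (l := 1 / 2) (L := 1) (ρ := 2 * R) hp1
      (hp.trans_le (min_le_left _ _)) (by norm_num) (by norm_num) (by linarith)
    obtain ⟨C', hC', h'⟩ := HenonGelfand.lintegral_annulus_le_of_dyadic (ρ := 2 * R) (by linarith)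
      hC hγ fun t ht => by
        have := h t (by linarith)
        rwa [one_mul, one_div_mul_eq_div] at this
    refine ⟨C' + 1, by linarith, 2 * R, fun r hr => ?_⟩
    have hr0 : 0 < r := by linarith
    have hsub : Metric.ball 0 r \ Metric.ball 0 (2 * R) ⊆
        HenonGelfand.annulus n (2 * R) r := fun x hx => by
      rw [HenonGelfand.mem_annulus]
      simp only [Set.mem_sdiff, mem_ball_zero_iff, not_lt] at hx
      exact ⟨hx.2, hx.1.le⟩
    obtain ⟨h1, h2⟩ := concl hsub (by positivity) (h' r hr)
    exact ⟨h1, h2.trans (weaken hr0)⟩
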